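/- **Definitions.** All alphabets are finite. The convolution $\mathrm{conv}(x_1,\dots,x_r)$ of words is the word of length $\max_j|x_j|$ whose $i$-th letter is the tuple of the $i$-th letters of $x_1,\dots,x_r$, where a padding symbol $\boxdot$ is used after the end of a word. An *automatic family* $\{L_e : e\in I\}$ consists of a regular set $I$ of words (indices) and nonempty languages $L_e\subseteq\Sigma^*$ ($e \in I$) such that $\{\mathrm{conv}(e,x) : e\in I,\ x\in L_e\}$ is regular; an *automatic class* is the set of languages of an automatic family. A *text* for $L$ is an infinite sequence $w_0,w_1,\dots$ of words whose set of members is exactly $L$. A *learner* has an initial memory and a map (old memory, new datum) $\mapsto$ (new memory, new conjecture), applied successively to $w_0,w_1,\dots$. With an automatic family $\{H_d : d\in J\}$ as hypothesis space, it *learns* a class $\mathcal L$ if, for every $L\in\mathcal L$ and every text for $L$, all its conjectures are in $J$ and they are from some point on equal to a fixed $d$ with $H_d=L$. A class is *learnable* if some learner, without restriction on its memory, learns it using some automatic family as hypothesis space. An *automatic learner* is a learner whose memories are words over a finite alphabet and whose map $M$ has a regular graph $\{\mathrm{conv}(om,dat,nm,nc) : M(om,dat)=(nm,nc)\}$. A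 *linear-time learner with $k$ additional stacks* is a deterministic Turing machine with a one-sided infinite base tape (with an unmodifiable marker $\boxplus$ at its left end) and $k$ stacks that are initially empty; in each step it reads the scanned symbol and the tops of the stacks, writes a symbol, moves its head by at most one cell, and pushes one symbol on, pops one symbol from, or leaves unchanged each stack. It works in cycles. The $n$-th cycle begins in the start state with the head at $\boxplus$ and the base tape containing $\boxplus\,\mathrm{conv}(w_n,m_n)\,\boxdot^\infty$, where $w_n$ is the current datum and $m_n$ the long-term memory (a word; $m_0$ is fixed); the cycle ends in an accepting state with the base tape beginning with $\boxplus\,\mathrm{conv}(m_{n+1},e_n)\,\boxdot$, where $e_n$ is the conjecture. The stacks are not modified between cycles. There must be a constant $c$ such that, for every sequence of data $w_0,w_1,\dots$ and every $n$, the $n$-th cycle takes at most $c\cdot(|\mathrm{conv}(w_n,m_n)|+1)$ steps and $|m_{n+1}|$ and $|e_n|$ are at most $\max_{i\le n}|w_i|+c$. **Theorem 3.8.** 1. There is an automatic family $\{L_e : e\in I\}$ whose class is learnt, with $\{L_e : e\in I\}$ itself as hypothesis space, by a linear-time learner with one additional stack, but is not learnt by any automatic learner (with any automatic family as hypothesis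 space). 2. For every automatic family $\{L_e : e\in I\}$ whose class is learnable, the class is learnt, with $\{L_e : e\in I\}$ itself as hypothesis space, by a linear-time learner with two additional stacks. -/

import Mathlib

namespace AutLearn

/-! ### Convolution and automatic families -/

/-- The convolution of two words: position `i` carries the pair of the `i`-th letters,
where `none` is the padding symbol used after the end of the shorter word. -/
def conv {A B : Type} (x : List A) (y : List B) : List (Option A × Option B) :=
  (List.range (max x.length y.length)).map fun i => (x[i]?, y[i]?)

/-- The convolution of four words. -/
def conv₄ {A B C D : Type} (x : List A) (y : List B) (z : List C) (w : List D) :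
    List (Option A × Option B × Option C × Option D) :=
  (List.range (max (max x.length y.length) (max z.length w.length))).map
    fun i => (x[i]?, y[i]?, z[i]?, w[i]?)

/-- An automatic family `{L_e : e ∈ I}` of nonempty languages over `A`, with indices that are
words over `B`: both `I` and `{conv(e,x) : e ∈ I, x ∈ L_e}` are regular. The value `lang e` is
irrelevant when `e` is not in `index`. -/
structure AutomaticFamily (B A : Type) where
  index : Language B
  lang : List B → Language A
  index_regular : index.IsRegular
  graph_regular :
    Language.IsRegular
      ({w | ∃ e x, e ∈ index ∧ x ∈ lang e ∧ w = conv e x} : Language (Option B × Option A))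
  lang_nonempty : ∀ e ∈ index, ∃ x, x ∈ lang e

/-- The class of languages presented by an automatic family. -/
def AutomaticFamily.languages {B A : Type} (F : AutomaticFamily B A) : Set (Language A) :=
  {L | ∃ e ∈ F.index, F.lang e = L}

/-! ### Learning in the limit -/

/-- `T` is a text for `L`: it lists exactly the elements of `L`. -/
def IsText {A : Type} (T : ℕ → List A) (L : Language A) : Prop :=
  ∀ x, x ∈ L ↔ ∃ n, T n = x

/-- The sequence `hyp` consists of indices of the hypothesis space `H` and is eventually
constant, equal to an index of `L`. -/
def ConvergesTo {B A : Type} (H : AutomaticFamily B A) (hyp : ℕ → List B) (L : Language A) :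
    Prop :=
  (∀ n, hyp n ∈ H.index) ∧ ∃ e ∈ H.index, H.lang e = L ∧ ∃ k, ∀ n, k ≤ n → hyp n = e

/-- A learner maps (old memory, new datum) to (new memory, new conjecture); conjectures are
words over `B`. -/
structure Learner (A B : Type) where
  Mem : Type
  init : Mem
  update : Mem → List A → Mem × List B

/-- The memory at the beginning of cycle `n`. -/
def Learner.memory {A B : Type} (M : Learner A B) (T : ℕ → List A) : ℕ → M.Mem
  | 0 => M.init
  | n + 1 => (M.update (M.memory T n) (T n)).1

/-- The conjecture issued in cycle `n`. -/
def Learner.conjecture {A B : Type} (M : Learner A B) (T : ℕ → List A) (n : ℕ) : List B :=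
  (M.update (M.memory T n) (T n)).2

/-- `M` learns every language of the class `𝓛` from every text, with conjectures interpreted
in `H`. -/
def Learner.Learns {A B : Type} (M : Learner A B) (H : AutomaticFamily B A)
    (𝓛 : Set (Language A)) : Prop :=
  ∀ L ∈ 𝓛, ∀ T : ℕ → List A, IsText T L → ConvergesTo H (M.conjecture T) L

/-- Learnability without any restriction on the memory, using some automatic family as
hypothesis space. -/
def Learnable {A : Type} (𝓛 : Set (Language A)) : Prop :=
  ∃ (B : Type) (_ : Finite B) (H : AutomaticFamily B A) (M : Learner A B), M.Learns H 𝓛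

/-- The learner with words over `C` as memory, given by an initial memory and an update map. -/
def wordLearner {A B C : Type} (m₀ : List C) (f : List C → List A → List C × List B) :
    Learner A B where
  Mem := List C
  init := m₀
  update := f

/-- An update map is automatic if its graph, coded by convolution, is regular. -/
def IsAutomaticUpdate {A B C : Type} (f : List C → List A → List C × List B) : Prop :=
  Language.IsRegular
    ({w | ∃ om dat, w = conv₄ om dat (f om dat).1 (f om dat).2} :
      Language (Option C × Option A × Option C × Option B))

/-- Learnability by an automatic learner, using some automatic family as hypothesis space. -/
def AutomaticallyLearnable {A : Type} (𝓛 : Set (Language A)) : Prop :=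
  ∃ (B : Type) (_ : Finite B) (H : AutomaticFamily B A) (C : Type) (_ : Finite C)
    (m₀ : List C) (f : List C → List A → List C × List B),
    IsAutomaticUpdate f ∧ (wordLearner m₀ f).Learns H 𝓛

/-! ### Turing machine learners with a base tape and additional stacks -/

/-- The symbols that a cell of the base tape to the right of the left-end marker can carry:
the blank, a letter of conv(datum, old memory), a letter of conv(new memory, hypothesis),
or a further work symbol. -/
inductive Cell (A B C W : Type)
  | blank
  | input (s : Option A × Option C)
  | output (s : Option C × Option B)
  | work (w : W)

/-- Head movements. -/
inductive Move
  | left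
  | stay
  | right

/-- What is done to a stack in one step. -/
inductive StackOp (S : Type)
  | keep
  | pop
  | push (s : S)

/-- The effect of an operation on a stack; the head of the list is the top of the stack.
Popping an empty stack has no effect. -/
def StackOp.apply {S : Type} : StackOp S → List S → List S
  | .keep, l => l
  | .pop, l => l.tail
  | .push s, l => s :: l

/-- A deterministic Turing machine with a base tape and `k` stacks, for data over `A` and
hypotheses over `B`. `C`, `W` and `S` are the alphabets of the long term memory, of the further
work symbols, and of the stacks. The transition depends on the state, on the scanned symbol
(`none` is the left-end marker) and on the top symbols of the stacks (`none` for an empty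
stack). -/
structure StackLearner (A B : Type) (k : ℕ) where
  C : Type
  W : Type
  S : Type
  Q : Type
  finite_C : Finite C
  finite_W : Finite W
  finite_S : Finite S
  finite_Q : Finite Q
  start : Q
  accept : Q → Bool
  δ : Q → Option (Cell A B C W) → (Fin k → Option S) →
    Q × Cell A B C W × Move × (Fin k → StackOp S)
  initMem : List C

namespace StackLearner

variable {A B : Type} {k : ℕ} (M : StackLearner A B k)

/-- A configuration. Cell number `0` of the base tape carries the left-end marker; `cells i` is
the content of cell number `i + 1`. -/
structure Config where
  state : M.Q
  head : ℕ
  cells : ℕ → Cell A B M.C M.W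
  stk : Fin k → List M.S

/-- The symbol under the head. -/
def scanned (c : M.Config) : Option (Cell A B M.C M.W) :=
  match c.head with
  | 0 => none
  | i + 1 => some (c.cells i)

/-- Writing a symbol at the head position; the left-end marker cannot be modified. -/
def write (head : ℕ) (cells : ℕ → Cell A B M.C M.W) (s : Cell A B M.C M.W) :
    ℕ → Cell A B M.C M.W :=
  match head with
  | 0 => cells
  | i + 1 => Function.update cells i s

/-- Moving the head; moving left from the left-end marker has no effect. -/
def moveHead (head : ℕ) : Move → ℕ
  | .left => head - 1
  | .stay => head
  | .right => head + 1

/-- One step of the machine. Nothing changes once an accepting state has been reached. -/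
def step (c : M.Config) : M.Config :=
  if M.accept c.state then c
  else
    let r := M.δ c.state (M.scanned c) (fun j => (c.stk j).head?)
    { state := r.1
      head := moveHead c.head r.2.2.1
      cells := M.write c.head c.cells r.2.1
      stk := fun j => (r.2.2.2 j).apply (c.stk j) }

/-- The configuration at the beginning of a cycle with datum `x`, long term memory `m` and given
stacks: the base tape is conv(x, m) followed by blanks, and the head is at the left-end marker. -/
def startConfig (x : List A) (m : List M.C) (stk : Fin k → List M.S) : M.Config where
  state := M.start
  head := 0
  cells := fun i => ((conv x m)[i]?).elim Cell.blank Cell.input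
  stk := stk

/-- Up to its first blank, the base tape contains conv(m, e); what follows is arbitrary. -/
def Outputs (c : M.Config) (m : List M.C) (e : List B) : Prop :=
  ∀ i, i ≤ (conv m e).length → c.cells i = ((conv m e)[i]?).elim Cell.blank Cell.output

/-- One cycle: with datum `x`, memory `m` and stacks `stk`, the machine accepts within `t` steps,
leaving the memory `m'`, the hypothesis `e` and the stacks `stk'`. -/
def Cycle (t : ℕ) (x : List A) (m : List M.C) (stk : Fin k → List M.S)
    (m' : List M.C) (e : List B) (stk' : Fin k → List M.S) : Prop :=
  let c := M.step^[t] (M.startConfig x m stk)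
  M.accept c.state = true ∧ M.Outputs c m' e ∧ c.stk = stk'

/-- The length of the longest of the data `T 0, …, T n`. -/
def longest (T : ℕ → List A) (n : ℕ) : ℕ :=
  (Finset.range (n + 1)).sup fun i => (T i).length

/-- `mem`, `stk`, `hyp` describe the run of `M` on the data sequence `T` (memory and stacks at
the beginning of each cycle, hypothesis at its end), and it respects the resource bounds with
constant `c`: each cycle takes time linear in the length of the base tape, and the memory and the
hypothesis exceed the length of the longest datum seen so far by at most a constant. -/
def IsLinearRun (c : ℕ) (T : ℕ → List A) (mem : ℕ → List M.C) (stk : ℕ → Fin k → List M.S)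
    (hyp : ℕ → List B) : Prop :=
  mem 0 = M.initMem ∧ (∀ j, stk 0 j = []) ∧
  ∀ n,
    M.Cycle (c * ((conv (T n) (mem n)).length + 1)) (T n) (mem n) (stk n)
      (mem (n + 1)) (hyp n) (stk (n + 1)) ∧
    (mem (n + 1)).length ≤ longest T n + c ∧
    (hyp n).length ≤ longest T n + c

/-- `M` is a linear-time learner (it respects the resource bounds on all data sequences) and
learns every language of `𝓛` from every text, with conjectures interpreted in `H`. The run on
`T` is unique, as `M` is deterministic. -/
def LearnsInLinearTime (H : AutomaticFamily B A) (𝓛 : Set (Language A)) : Prop :=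
  ∃ c : ℕ, ∀ T : ℕ → List A, ∃ mem stk hyp, M.IsLinearRun c T mem stk hyp ∧
    ∀ L ∈ 𝓛, IsText T L → ConvergesTo H hyp L

end StackLearner

end AutLearn

/-! First claim. The language with index `b :: q` contains a query that announces `q` and all facts
`true :: p` with |p| = |q|, except that the fact about `q` itself is present only if `b` is true.
Facts may precede the query, so a learner has to remember which facts it saw. An automatic update
lengthens the memory by at most a constant (`IsAutomaticUpdate.exists_length_bound`, by pumping).
After n facts of length O(n) there are thus only 2^O(n) memories, while 2^(n²) sets of facts compete
for them. Two of these sets lead to the same memory, and a query about a fact that separates them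
defeats the learner. One stack suffices to learn the class: facts are pushed until the query
arrives, and afterwards each cycle pops one stored fact and compares it with the query.

Second claim. A locking sequence shows that each language of a learnable class has a finite
tell-tale set (`Learnable.exists_telltale`). For an automatic family, a finite classification of the
tails of indices makes this uniform: the words of L_e of length at most |e| + c form a tell-tale set
(`AutomaticFamily.exists_uniform_telltale`). Hence L_e is the target L as soon as L ⊆ L_e and all
words of L_e of length at most |e| + c are in L. Both conditions are tested against the data.
Candidates for e and test words are treated as numbers and enumerated by counting. All data are kept
on two stacks. A pass moves them from one stack to the other, one stored word per cycle, and checks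
whether each datum is in L_e and whether the test word has occurred. A candidate is rejected if it
is no index, if some datum is outside L_e, or if a short test word in L_e has not occurred. A
candidate that survives all its test words becomes the conjecture, and the search restarts from 0.
It also restarts, with a larger limit, when all candidates up to the current limit have failed, so
rejections caused by missing data are revised later.

Let a₀ be the least code of an index of L. Eventually a₀ is never rejected, while each smaller
candidate is rejected at a bounded test number. `search_converges` derives that the conjecture
settles on a₀. Such an index fits into the memory because every language has an index at most a
constant longer than one of its elements (`AutomaticFamily.exists_index_le_length`). -/

namespace AutLearn

/-! ### Convolutions and padded words -/

/-- A pair of letters as a letter of a convolution; `none` beyond the end of both words. -/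
def padLetter {A B : Type} : Option A × Option B → Option (Option A × Option B)
  | (none, none) => none
  | p => some p

theorem padLetter_injective {A B : Type} : Function.Injective (padLetter (A := A) (B := B)) := by
  rintro ⟨_ | a, _ | b⟩ ⟨_ | a', _ | b'⟩ h <;> simp_all [padLetter]

theorem padLetter_eq_some {A B : Type} {p : Option A × Option B} (h : p ≠ (none, none)) :
    padLetter p = some p := by
  rcases p with ⟨_ | a, _ | b⟩ <;> simp_all [padLetter]

theorem conv_getElem? {A B : Type} (x : List A) (y : List B) (i : ℕ) :
    (conv x y)[i]? = padLetter (x[i]?, y[i]?) := by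
  unfold conv
  rw [List.getElem?_map]
  by_cases h : i < max x.length y.length
  · rw [List.getElem?_range h, Option.map_some, padLetter_eq_some]
    intro h'
    simp only [Prod.mk.injEq, List.getElem?_eq_none_iff] at h'
    omega
  · have h1 : x[i]? = none := by rw [List.getElem?_eq_none_iff]; omega
    have h2 : y[i]? = none := by rw [List.getElem?_eq_none_iff]; omega
    rw [h1, h2, List.getElem?_eq_none (by simpa using h)]
    rfl

@[simp]
theorem length_conv {A B : Type} (x : List A) (y : List B) :
    (conv x y).length = max x.length y.length := by simp [conv]

theorem conv_inj {A B : Type} {x x' : List A} {y y' : List B} (h : conv x y = conv x' y') :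
    x = x' ∧ y = y' := by
  have key : ∀ i : ℕ, x[i]? = x'[i]? ∧ y[i]? = y'[i]? := fun i => by
    have := congrArg (fun l => l[i]?) h
    simp only [conv_getElem?] at this
    simpa using padLetter_injective this
  exact ⟨List.ext_getElem? fun i => (key i).1, List.ext_getElem? fun i => (key i).2⟩

/-- A convolution may be cut at a position provided that neither word resumes after its padding has
begun. The three alternatives are the ways in which this can be ensured. -/
theorem conv_append {A B : Type} {u v : List A} {x y : List B}
    (h : u.length = x.length ∨ (u.length ≤ x.length ∧ v = []) ∨ (x.length ≤ u.length ∧ y = [])) :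
    conv (u ++ v) (x ++ y) = conv u x ++ conv v y := by
  apply List.ext_getElem?
  intro i
  rw [List.getElem?_append, conv_getElem?, conv_getElem?, conv_getElem?, length_conv,
    List.getElem?_append, List.getElem?_append]
  rcases h with h | ⟨h, rfl⟩ | ⟨h, rfl⟩
  · rw [h, max_self]
    split_ifs <;> rfl
  · rw [max_eq_right h]
    split_ifs with h1 h2 h3
    · rfl
    · omega
    · simp [List.getElem?_eq_none (not_lt.1 h1)]
    · simp
  · rw [max_eq_left h]
    split_ifs with h1 h2 h3
    · rfl
    · simp [List.getElem?_eq_none (not_lt.1 h2)]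
    · omega
    · simp

/-- The automaton reading words over `α` that are padded by `none`. -/
def padDFA {α σ : Type} (M : DFA α σ) : DFA (Option α) (Option (σ × Bool)) where
  step s a := match s, a with
    | none, _ => none
    | some (q, _), none => some (q, true)
    | some (q, false), some a => some (M.step q a, false)
    | some (_, true), some _ => none
  start := some (M.start, false)
  accept := {s | ∃ q ∈ M.accept, ∃ b, s = some (q, b)}

theorem padDFA_evalFrom_none {α σ : Type} (M : DFA α σ) (l : List (Option α)) :
    (padDFA M).evalFrom none l = none := by
  induction l with
  | nil => rfl
  | cons a l ih => exact ih

theorem padDFA_evalFrom_ended {α σ : Type} (M : DFA α σ) (q : σ) (l : List (Option α)) :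
    (padDFA M).evalFrom (some (q, true)) l ∈ (padDFA M).accept ↔
      (∀ a ∈ l, a = none) ∧ q ∈ M.accept := by
  induction l with
  | nil => simp [padDFA]
  | cons a l ih =>
    rcases a with _ | a
    · have : (padDFA M).evalFrom (some (q, true)) (none :: l) =
        (padDFA M).evalFrom (some (q, true)) l := rfl
      rw [this, ih]
      simp
    · have : (padDFA M).evalFrom (some (q, true)) (some a :: l) = none :=
        padDFA_evalFrom_none M l
      rw [this]
      refine iff_of_false ?_ (fun h => ?_)
      · rintro ⟨_, _, _, h⟩
        exact absurd h (by simp)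
      · simpa using h.1

theorem padDFA_evalFrom {α σ : Type} (M : DFA α σ) (q : σ) (l : List (Option α)) :
    (padDFA M).evalFrom (some (q, false)) l ∈ (padDFA M).accept ↔
      ∃ z, M.evalFrom q z ∈ M.accept ∧ ∃ k, l = z.map some ++ List.replicate k none := by
  induction l generalizing q with
  | nil =>
    constructor
    · intro h
      refine ⟨[], ?_, 0, rfl⟩
      simpa [padDFA] using h
    · rintro ⟨z, hz, k, h⟩
      simp only [List.nil_eq, List.append_eq_nil_iff, List.map_eq_nil_iff] at h
      rw [h.1] at hz
      simpa [padDFA] using hz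
  | cons a l ih =>
    rcases a with _ | a
    · have : (padDFA M).evalFrom (some (q, false)) (none :: l) =
        (padDFA M).evalFrom (some (q, true)) l := rfl
      rw [this, padDFA_evalFrom_ended]
      constructor
      · rintro ⟨h, hq⟩
        refine ⟨[], hq, l.length + 1, ?_⟩
        simp only [List.map_nil, List.nil_append, List.replicate_succ, List.cons.injEq, true_and]
        exact List.eq_replicate_of_mem h
      · rintro ⟨z, hz, k, h⟩
        rcases z with _ | ⟨b, z⟩
        · rcases k with _ | k
          · simp at h
          · simp only [List.map_nil, List.nil_append, List.replicate_succ, List.cons.injEq,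
              true_and] at h
            exact ⟨fun a ha => (List.mem_replicate.1 (h ▸ ha)).2, hz⟩
        · simp at h
    · have : (padDFA M).evalFrom (some (q, false)) (some a :: l) =
        (padDFA M).evalFrom (some (M.step q a, false)) l := rfl
      rw [this, ih]
      constructor
      · rintro ⟨z, hz, k, rfl⟩
        exact ⟨a :: z, hz, k, rfl⟩
      · rintro ⟨z, hz, k, h⟩
        rcases z with _ | ⟨b, z⟩
        · rcases k with _ | k <;> simp [List.replicate_succ] at h
        · simp only [List.map_cons, List.cons_append, List.cons.injEq, Option.some.injEq] at h
          obtain ⟨rfl, h⟩ := h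
          exact ⟨z, hz, k, h⟩

/-- A track is a function on all positions. Once it is padding from `N` on, reading its first `N`
symbols decides whether it spells an accepted word; a letter after padding sends the automaton to
the dead state `none`. -/
theorem padDFA_eval_range {α σ : Type} (M : DFA α σ) (f : ℕ → Option α) (N : ℕ)
    (hf : ∀ i, N ≤ i → f i = none) :
    (padDFA M).eval ((List.range N).map f) ∈ (padDFA M).accept ↔
      ∃ z ∈ M.accepts, ∀ i, f i = z[i]? := by
  have := padDFA_evalFrom M M.start ((List.range N).map f)
  refine this.trans (exists_congr fun z => and_congr Iff.rfl ?_)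
  constructor
  · rintro ⟨k, hk⟩ i
    by_cases hi : i < N
    · have h := congrArg (fun l => l[i]?) hk
      simp only [List.getElem?_map, List.getElem?_range hi, Option.map_some,
        List.getElem?_append, List.length_map, List.getElem?_replicate] at h
      split_ifs at h with h1 h2
      · rw [List.getElem?_eq_getElem h1] at h ⊢
        simpa using h
      · rw [List.getElem?_eq_none (not_lt.1 h1)]
        simpa using h
    · rw [hf i (not_lt.1 hi), List.getElem?_eq_none]
      have h := congrArg List.length hk
      simp at h
      omega
  · intro h
    have hz : z.length ≤ N := by
      have := h N
      rw [hf N le_rfl] at this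
      exact List.getElem?_eq_none_iff.1 this.symm
    refine ⟨N - z.length, ?_⟩
    apply List.ext_getElem?
    intro i
    simp only [List.getElem?_map, List.getElem?_append, List.length_map,
      List.getElem?_replicate]
    by_cases hi : i < N
    · rw [List.getElem?_range hi, Option.map_some, h]
      split_ifs with h1 h2
      · rw [List.getElem?_eq_getElem h1]; rfl
      · rw [List.getElem?_eq_none (not_lt.1 h1)]
      · omega
    · rw [List.getElem?_eq_none (by simpa using hi), if_neg (by omega), if_neg (by omega)]
      rfl

/-- Membership in a regular set of convolutions, decided on padded tracks. -/
theorem padDFA_conv {A B σ : Type} (M : DFA (Option A × Option B) σ)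
    (f : ℕ → Option A) (g : ℕ → Option B) (N : ℕ)
    (hf : ∀ i, N ≤ i → f i = none) (hg : ∀ i, N ≤ i → g i = none)
    (hM : ∀ z ∈ M.accepts, ∃ x y, z = conv x y) :
    (padDFA M).eval ((List.range N).map fun i => padLetter (f i, g i)) ∈ (padDFA M).accept ↔
      ∃ x y, conv x y ∈ M.accepts ∧ (∀ i, f i = x[i]?) ∧ ∀ i, g i = y[i]? := by
  rw [padDFA_eval_range M _ N (fun i hi => by rw [hf i hi, hg i hi]; rfl)]
  constructor
  · rintro ⟨z, hz, h⟩
    obtain ⟨x, y, rfl⟩ := hM z hz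
    have key : ∀ i, f i = x[i]? ∧ g i = y[i]? := fun i => by
      have := h i
      rw [conv_getElem?] at this
      simpa using padLetter_injective this
    exact ⟨x, y, hz, fun i => (key i).1, fun i => (key i).2⟩
  · rintro ⟨x, y, hz, h1, h2⟩
    exact ⟨_, hz, fun i => by rw [conv_getElem?, h1, h2]⟩

/-! ### The graph of an automatic family -/

/-- The convolutions of an index and an element of the language it denotes. -/
def AutomaticFamily.graph {B A : Type} (F : AutomaticFamily B A) :
    Language (Option B × Option A) :=
  {w | ∃ e x, e ∈ F.index ∧ x ∈ F.lang e ∧ w = conv e x}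

theorem AutomaticFamily.conv_mem_graph {B A : Type} (F : AutomaticFamily B A) (e : List B)
    (x : List A) : conv e x ∈ F.graph ↔ e ∈ F.index ∧ x ∈ F.lang e := by
  constructor
  · rintro ⟨e', x', he, hx, h⟩
    obtain ⟨rfl, rfl⟩ := conv_inj h
    exact ⟨he, hx⟩
  · rintro ⟨he, hx⟩
    exact ⟨e, x, he, hx, rfl⟩

/-! ### Texts and tell-tale sets -/

theorem exists_isText {A : Type} [Countable A] {L : Language A} (h : ∃ x, x ∈ L) :
    ∃ T, IsText T L := by
  obtain ⟨T, hT⟩ := (Set.to_countable (L : Set (List A))).exists_eq_range h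
  exact ⟨T, fun x => by rw [hT]; rfl⟩

/-- The sequence `t` preceded by the list `l`. -/
def prepend {α : Type} (l : List α) (t : ℕ → α) (n : ℕ) : α :=
  if h : n < l.length then l[n] else t (n - l.length)

theorem prepend_length_add {α : Type} (l : List α) (t : ℕ → α) (n : ℕ) :
    prepend l t (l.length + n) = t n := by
  simp [prepend]

theorem map_range_prepend {α : Type} (l : List α) (t : ℕ → α) (n : ℕ) :
    (List.range (l.length + n)).map (prepend l t) = l ++ (List.range n).map t := by
  rw [List.range_add, List.map_append, List.map_map]
  congr 1
  · apply List.ext_getElem (by simp)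
    intro i h1 h2
    simp [prepend, h2]
  · exact List.map_congr_left fun i _ => prepend_length_add l t i

theorem isText_prepend {A : Type} {L : Language A} {l : List (List A)} {t : ℕ → List A}
    (hl : ∀ x ∈ l, x ∈ L) (ht1 : ∀ n, t n ∈ L) (ht2 : ∀ x ∈ L, x ∈ l ∨ ∃ n, t n = x) :
    IsText (prepend l t) L := by
  intro x
  constructor
  · intro hx
    rcases ht2 x hx with h | ⟨n, rfl⟩
    · obtain ⟨i, hi, rfl⟩ := List.getElem_of_mem h
      exact ⟨i, by simp [prepend, hi]⟩
    · exact ⟨l.length + n, prepend_length_add l t n⟩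
  · rintro ⟨n, rfl⟩
    unfold prepend
    split_ifs with h
    · exact hl _ (List.getElem_mem h)
    · exact ht1 _

/-- The memory of a learner after processing a list of data. -/
def Learner.memoryAfter {A B : Type} (M : Learner A B) (l : List (List A)) : M.Mem :=
  l.foldl (fun μ x => (M.update μ x).1) M.init

theorem Learner.memory_eq {A B : Type} (M : Learner A B) (T : ℕ → List A) (n : ℕ) :
    M.memory T n = M.memoryAfter ((List.range n).map T) := by
  induction n with
  | zero => rfl
  | succ n ih =>
    rw [List.range_succ, List.map_append, Learner.memoryAfter, List.foldl_append]
    rw [Learner.memoryAfter] at ih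
    simp [Learner.memory, ih]

theorem Learner.conjecture_prepend {A B : Type} (M : Learner A B) (l : List (List A))
    (t : ℕ → List A) (n : ℕ) :
    M.conjecture (prepend l t) (l.length + n) =
      (M.update (M.memoryAfter (l ++ (List.range n).map t)) (t n)).2 := by
  rw [Learner.conjecture, Learner.memory_eq, map_range_prepend, prepend_length_add]

theorem exists_limit_of_prefixes {α : Type} (σ : ℕ → List α)
    (hp : ∀ k, σ k <+: σ (k + 1)) (hl : ∀ k, k ≤ (σ k).length) :
    ∃ T : ℕ → α, ∀ k, σ k = (List.range (σ k).length).map T := by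
  have mono : ∀ i j, i ≤ j → σ i <+: σ j := by
    intro i j h
    induction j, h using Nat.le_induction with
    | base => exact List.prefix_rfl
    | succ j _ ih => exact ih.trans (hp j)
  refine ⟨fun i => (σ (i + 1))[i]'(hl (i + 1)), fun k => ?_⟩
  apply List.ext_getElem (by simp)
  intro i h1 h2
  rw [List.getElem_map, List.getElem_range]
  rcases le_total k (i + 1) with h | h
  · exact (mono _ _ h).getElem h1
  · exact ((mono _ _ h).getElem (hl (i + 1))).symm

/-- Some finite sequence of elements of a learnt language fixes the conjecture for good. -/
theorem Learner.Learns.exists_locking {A B : Type} [Countable A] {M : Learner A B}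
    {H : AutomaticFamily B A} {𝓛 : Set (Language A)} (hM : M.Learns H 𝓛) {L : Language A}
    (hL : L ∈ 𝓛) (hne : ∃ x, x ∈ L) :
    ∃ (l : List (List A)) (d : List B), (∀ x ∈ l, x ∈ L) ∧
      ∀ l' : List (List A), (∀ x ∈ l', x ∈ L) → ∀ x ∈ L,
        (M.update (M.memoryAfter (l ++ l')) x).2 = d := by
  -- Without a locking sequence, every finite sequence from `L` extends to one on which the
  -- conjecture changes. Interleaving such extensions with a text `t` yields a text without
  -- convergence.
  by_contra! hcon
  obtain ⟨t, ht⟩ := exists_isText hne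
  have htL : ∀ n, t n ∈ L := fun n => (ht _).2 ⟨n, rfl⟩
  have step : ∀ (l : {l : List (List A) // ∀ x ∈ l, x ∈ L}) (k : ℕ),
      ∃ (l' : List (List A)) (x : List A), (∀ y ∈ l', y ∈ L) ∧ x ∈ L ∧
        (M.update (M.memoryAfter (l.1 ++ [t k] ++ l')) x).2 ≠
          (M.update (M.memoryAfter l.1) (t k)).2 := by
    intro l k
    obtain ⟨l', hl', x, hx, hd⟩ := hcon (l.1 ++ [t k]) (M.update (M.memoryAfter l.1) (t k)).2
      (by
        intro x hx
        rcases List.mem_append.1 hx with h | h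
        · exact l.2 x h
        · rw [List.mem_singleton.1 h]; exact htL k)
    exact ⟨l', x, hl', hx, hd⟩
  choose τ z hτ hz hne' using step
  -- Stage `k` appends `t k`, so that the limit lists all of `L`, and then an extension whose last
  -- datum draws a conjecture different from the one issued at `t k`.
  let σ : ℕ → {l : List (List A) // ∀ x ∈ l, x ∈ L} := fun n => Nat.rec ⟨[], by simp⟩
    (fun k l => ⟨l.1 ++ [t k] ++ τ l k ++ [z l k], by
      intro x hx
      simp only [List.mem_append, List.mem_singleton] at hx
      rcases hx with ((h | rfl) | h) | rfl
      · exact l.2 x h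
      · exact htL k
      · exact hτ l k x h
      · exact hz l k⟩) n
  have hσ : ∀ k, (σ (k + 1)).1 = (σ k).1 ++ [t k] ++ τ (σ k) k ++ [z (σ k) k] := fun k => rfl
  obtain ⟨T, hT⟩ := exists_limit_of_prefixes (fun k => (σ k).1)
    (fun k => by
      rw [hσ, List.append_assoc, List.append_assoc]
      exact List.prefix_append _ _)
    (fun k => by
      induction k with
      | zero => simp
      | succ k ih => rw [hσ]; simp only [List.length_append, List.length_singleton]; omega)
  have hlen : ∀ k, k ≤ (σ k).1.length := by
    intro k
    induction k with
    | zero => simp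
    | succ k ih => rw [hσ]; simp only [List.length_append, List.length_singleton]; omega
  have hpart : ∀ k l x l', (σ k).1 = l ++ x :: l' → T l.length = x ∧ M.memory T l.length =
      M.memoryAfter l := by
    intro k l x l' h
    have h1 := hT k
    rw [h] at h1
    have h2 : (List.range (l ++ x :: l').length).map T =
        (List.range l.length).map T ++ T l.length ::
          (List.range l'.length).map (fun i => T (l.length + 1 + i)) := by
      rw [List.length_append, List.length_cons, add_comm l'.length 1, ← add_assoc, List.range_add,
        List.range_succ]
      simp [Function.comp_def]
    rw [h2] at h1
    obtain ⟨h3, h4⟩ := List.append_inj h1 (by simp)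
    simp only [List.cons.injEq] at h4
    exact ⟨h4.1.symm, by rw [Learner.memory_eq, ← h3]⟩
  have htext : IsText T L := by
    intro x
    constructor
    · intro hx
      obtain ⟨k, rfl⟩ := (ht x).1 hx
      exact ⟨_, (hpart (k + 1) (σ k).1 (t k) (τ (σ k) k ++ [z (σ k) k]) (by rw [hσ]; simp)).1⟩
    · rintro ⟨n, rfl⟩
      have h1 := (σ (n + 1)).2
      have h2 := hT (n + 1)
      rw [h2] at h1
      exact h1 _ (List.mem_map_of_mem (List.mem_range.2 (hlen (n + 1))))
  -- Stage `k` lies beyond the point of convergence, so both of its differing conjectures would have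
  -- to equal `e`.
  obtain ⟨-, e, -, -, k, hk⟩ := hM L hL T htext
  obtain ⟨h1, h2⟩ := hpart (k + 1) (σ k).1 (t k) (τ (σ k) k ++ [z (σ k) k]) (by rw [hσ]; simp)
  obtain ⟨h3, h4⟩ := hpart (k + 1) ((σ k).1 ++ [t k] ++ τ (σ k) k) (z (σ k) k) []
    (by rw [hσ])
  refine hne' (σ k) k ?_
  rw [← h4, ← h2]
  conv_lhs => rw [← h3]
  conv_rhs => rw [← h1]
  have e1 := hk _ (hlen k)
  have e2 := hk ((σ k).1 ++ [t k] ++ τ (σ k) k).length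
    (by have := hlen k; simp only [List.length_append]; omega)
  rw [Learner.conjecture] at e1 e2
  rw [e1, e2]

/-- Angluin's condition: the short elements of a language of a learnable class distinguish it
from all its proper subsets in the class. -/
theorem Learnable.exists_telltale {A : Type} [Countable A] {𝓛 : Set (Language A)}
    (h : Learnable 𝓛) (hne : ∀ L ∈ 𝓛, ∃ x, x ∈ L) {L : Language A} (hL : L ∈ 𝓛) :
    ∃ b : ℕ, ∀ L' ∈ 𝓛, (∀ x ∈ L, x.length ≤ b → x ∈ L') → (∀ x ∈ L', x ∈ L) → L' = L := by
  obtain ⟨B, _, H, M, hM⟩ := h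
  obtain ⟨l, d, hl, hd⟩ := hM.exists_locking hL (hne L hL)
  -- A text of `L'` preceded by the locking sequence consists of elements of `L`, so the conjecture
  -- remains `d`; as it is also a text for `L'`, the index `d` must denote `L'`. The same holds for
  -- `L`.
  have key : ∀ L' ∈ 𝓛, (∀ x ∈ l, x ∈ L') → (∀ x ∈ L', x ∈ L) → H.lang d = L' := by
    intro L' hL' hl' hsub
    obtain ⟨t, ht⟩ := exists_isText (hne L' hL')
    have htL : ∀ n, t n ∈ L' := fun n => (ht _).2 ⟨n, rfl⟩
    obtain ⟨-, e, -, he, k, hk⟩ := hM L' hL' _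
      (isText_prepend hl' htL fun x hx => Or.inr ((ht x).1 hx))
    have := hk (l.length + k) (by omega)
    rw [Learner.conjecture_prepend, hd] at this
    · rw [this, he]
    · intro x hx
      obtain ⟨i, -, rfl⟩ := List.mem_map.1 hx
      exact hsub _ (htL i)
    · exact hsub _ (htL k)
  -- The sum is a crude bound for the length of each word of the locking sequence.
  refine ⟨(l.map List.length).sum, fun L' hL' h1 h2 => ?_⟩
  rw [← key L' hL' (fun x hx => h1 x (hl x hx)
    (List.single_le_sum (by simp) _ (List.mem_map_of_mem hx))) h2]
  exact key L hL hl fun x hx => hx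

/-! ### Uniform bounds -/

/-- Used to replace the tail of an index by one of bounded length that has the same finite type. -/
theorem exists_small_representatives {α β : Type} [Finite β] (f : α → β) (size : α → ℕ) :
    ∃ K, ∀ a, ∃ a', f a' = f a ∧ size a' ≤ K := by
  classical
  have : ∀ b : Set.range f, ∃ a, f a = b := fun b => b.2
  choose g hg using this
  obtain ⟨K, hK⟩ := (Set.finite_range fun b => size (g b)).bddAbove
  exact ⟨K, fun a => ⟨g ⟨f a, a, rfl⟩, hg _, hK ⟨_, rfl⟩⟩⟩

/-- A finite language has an index that is only by a constant longer than its elements. -/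
theorem AutomaticFamily.exists_index_bound {B A : Type} (F : AutomaticFamily B A) :
    ∃ K, ∀ e ∈ F.index, ∀ m, (∀ x ∈ F.lang e, x.length ≤ m) →
      ∃ e' ∈ F.index, F.lang e' = F.lang e ∧ e'.length ≤ m + K := by
  obtain ⟨Q, _, M, hM⟩ := F.graph_regular
  change M.accepts = F.graph at hM
  -- The type of a tail `v` records, for each state, whether `v` is accepted next to an exhausted
  -- datum, and whether it is accepted next to some further nonempty part of a datum.
  obtain ⟨K, hK⟩ := exists_small_representatives
    (fun v : List B => ((fun q => M.evalFrom q (conv v []) ∈ M.accept,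
      fun q => ∃ x, x ≠ [] ∧ M.evalFrom q (conv v x) ∈ M.accept) : (Q → Prop) × (Q → Prop)))
    List.length
  refine ⟨K, fun e he m hm => ?_⟩
  rcases le_or_gt e.length m with hem | hem
  · exact ⟨e, he, rfl, by omega⟩
  obtain ⟨v', hv, hlen⟩ := hK (e.drop m)
  simp only [Prod.mk.injEq, funext_iff, eq_iff_iff] at hv
  obtain ⟨hv1, hv2⟩ := hv
  have hu : (e.take m).length = m := by simp [hem.le]
  have short : ∀ v x, x.length ≤ m → (conv (e.take m ++ v) x ∈ F.graph ↔
      M.evalFrom (M.eval (conv (e.take m) x)) (conv v []) ∈ M.accept) := by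
    intro v x hx
    have : conv (e.take m ++ v) (x ++ []) = conv (e.take m) x ++ conv v [] :=
      conv_append (Or.inr (Or.inr ⟨by omega, rfl⟩))
    rw [List.append_nil] at this
    rw [← hM, DFA.mem_accepts, this, DFA.eval, DFA.evalFrom_of_append]
  have long : ∀ v x y, x.length = m → (conv (e.take m ++ v) (x ++ y) ∈ F.graph ↔
      M.evalFrom (M.eval (conv (e.take m) x)) (conv v y) ∈ M.accept) := by
    intro v x y hx
    rw [← hM, DFA.mem_accepts, conv_append (Or.inl (by omega)), DFA.eval, DFA.evalFrom_of_append]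
  have he' : ∀ x, conv (e.take m ++ v') x ∈ F.graph ↔ conv e x ∈ F.graph := by
    intro x
    conv_rhs => rw [← List.take_append_drop m e]
    rcases le_or_gt x.length m with hx | hx
    · rw [short _ _ hx, short _ _ hx, hv1]
    -- Neither index admits a word longer than `m`: by the second component of the type, such a word
    -- for the new tail would yield some word longer than `m` for the old one.
    · refine iff_of_false (fun h => ?_) (fun h => ?_)
      · rw [← List.take_append_drop m x, long _ _ _ (by simp [hx.le])] at h
        obtain ⟨y, hy, h2⟩ := (hv2 _).1 ⟨x.drop m, by simpa using hx, h⟩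
        rw [← long _ (x.take m) _ (by simp [hx.le]), List.take_append_drop, F.conv_mem_graph] at h2
        have := hm _ h2.2
        have h3 := List.length_pos_iff.2 hy
        simp only [List.length_append, List.length_take] at this
        omega
      · rw [List.take_append_drop, F.conv_mem_graph] at h
        have := hm _ h.2
        omega
  -- The new word is an index because its convolution with one element of the language is in the
  -- graph.
  obtain ⟨x, hx⟩ := F.lang_nonempty e he
  have hidx := ((F.conv_mem_graph _ _).1 ((he' x).2 ((F.conv_mem_graph _ _).2 ⟨he, hx⟩))).1
  refine ⟨_, hidx, ?_, by rw [List.length_append, hu]; omega⟩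
  ext y
  have := he' y
  rw [F.conv_mem_graph, F.conv_mem_graph] at this
  tauto

/-- For each of the finitely many `t`, the downward closed set of `n` with `P t n` is everything or
omits some number; the maximum of these numbers serves for all `t`. -/
theorem exists_uniform_bound {τ : Type} [Finite τ] (P : τ → ℕ → Prop)
    (hP : ∀ t m n, m ≤ n → P t n → P t m) : ∃ c, ∀ t, P t c → ∀ n, P t n := by
  classical
  have : ∀ t, ∃ c, P t c → ∀ n, P t n := by
    intro t
    by_cases h : ∀ n, P t n
    · exact ⟨0, fun _ => h⟩
    · push Not at h
      obtain ⟨n, hn⟩ := h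
      exact ⟨n, fun h => absurd h hn⟩
  choose c hc using this
  obtain ⟨C, hC⟩ := (Set.finite_range c).bddAbove
  exact ⟨C, fun t ht => hc t (hP t _ _ (hC ⟨t, rfl⟩) ht)⟩

/-- If every language of an automatic family has a tell-tale set, then the elements of `L_e` of
length at most `|e| + c` form one, where the constant `c` does not depend on `e`. -/
theorem AutomaticFamily.exists_uniform_telltale {B A : Type} (F : AutomaticFamily B A)
    (hF : ∀ e ∈ F.index, ∃ b, ∀ e' ∈ F.index, (∀ x ∈ F.lang e, x.length ≤ b → x ∈ F.lang e') →
      (∀ x ∈ F.lang e', x ∈ F.lang e) → F.lang e' = F.lang e) :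
    ∃ c, ∀ e ∈ F.index, ∀ e' ∈ F.index,
      (∀ x ∈ F.lang e, x.length ≤ e.length + c → x ∈ F.lang e') →
      (∀ x ∈ F.lang e', x ∈ F.lang e) → F.lang e' = F.lang e := by
  obtain ⟨Q, _, M, hM⟩ := F.graph_regular
  change M.accepts = F.graph at hM
  -- A pair in `R` consists of the states reached by two indices on a common prefix of data. `good`
  -- says that, beyond this prefix, the language belonging to the tail `v` is a proper part of the
  -- other one.
  let good (R : Set (Q × Q)) (v : List B) : Prop :=
    (∀ p ∈ R, ∀ y, M.evalFrom p.2 (conv v y) ∈ M.accept → M.evalFrom p.1 (conv [] y) ∈ M.accept) ∧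
    ∃ p ∈ R, ∃ y, M.evalFrom p.1 (conv [] y) ∈ M.accept ∧ M.evalFrom p.2 (conv v y) ∉ M.accept
  let agree (R : Set (Q × Q)) (v : List B) (b : ℕ) : Prop :=
    ∀ p ∈ R, ∀ y, y.length ≤ b → M.evalFrom p.1 (conv [] y) ∈ M.accept →
      M.evalFrom p.2 (conv v y) ∈ M.accept
  -- The component `v = []` is needed because a prefix of the index that is too short can be
  -- continued by the empty tail only. The other component decides membership of short data.
  let typ (v : List B) : Prop × (Q → Prop) := (v = [], fun q => M.evalFrom q (conv v []) ∈ M.accept)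
  -- If some good tail of a given type agrees up to length `c`, then for each length there is a good
  -- tail of that type agreeing up to that length.
  obtain ⟨c, hc⟩ := exists_uniform_bound
    (fun (t : Set (Q × Q) × Prop × (Q → Prop)) b => ∃ v, typ v = t.2 ∧ good t.1 v ∧ agree t.1 v b)
    (fun t m n hmn ⟨v, h1, h2, h3⟩ => ⟨v, h1, h2, fun p hp y hy => h3 p hp y (hy.trans hmn)⟩)
  refine ⟨c, fun e he e' he' hshort hsub => ?_⟩
  by_contra hne
  set n := e.length with hn
  set u := e'.take n with hu
  set v := e'.drop n with hv
  have huv : u ++ v = e' := List.take_append_drop n e'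
  have hcase : u.length = n ∨ (u.length ≤ n ∧ v = []) := by
    rcases le_or_gt n e'.length with h | h
    · left; simp [hu, h]
    · right; simp [hu, hv, h.le]
  let R : Set (Q × Q) := {p | ∃ x : List A, x.length = n ∧ p = (M.eval (conv e x), M.eval (conv u x))}
  have long_e : ∀ x y : List A, x.length = n → (conv e (x ++ y) ∈ F.graph ↔
      M.evalFrom (M.eval (conv e x)) (conv [] y) ∈ M.accept) := by
    intro x y hx
    have : conv (e ++ []) (x ++ y) = conv e x ++ conv [] y := conv_append (Or.inl (by omega))
    rw [List.append_nil] at this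
    rw [← hM, DFA.mem_accepts, this, DFA.eval, DFA.evalFrom_of_append]
  have long : ∀ v' (x y : List A), (v' = [] ↔ v = []) → x.length = n →
      (conv (u ++ v') (x ++ y) ∈ F.graph ↔
        M.evalFrom (M.eval (conv u x)) (conv v' y) ∈ M.accept) := by
    intro v' x y hv' hx
    rw [← hM, DFA.mem_accepts, conv_append, DFA.eval, DFA.evalFrom_of_append]
    rcases hcase with h | ⟨h, h'⟩
    · left; omega
    · right; left; exact ⟨by omega, hv'.2 h'⟩
  have short : ∀ v' (x : List A), (v' = [] ↔ v = []) → x.length ≤ n →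
      (conv (u ++ v') x ∈ F.graph ↔
        M.evalFrom (M.eval (conv u x)) (conv v' []) ∈ M.accept) := by
    intro v' x hv' hx
    have : conv (u ++ v') (x ++ []) = conv u x ++ conv v' [] := by
      rcases hcase with h | ⟨h, h'⟩
      · exact conv_append (Or.inr (Or.inr ⟨by omega, rfl⟩))
      · rw [hv'.2 h']
        simp only [List.append_nil]
        simp [conv]
    rw [List.append_nil] at this
    rw [← hM, DFA.mem_accepts, this, DFA.eval, DFA.evalFrom_of_append]
  have split : ∀ x : List A, n ≤ x.length → ∃ y z, x = y ++ z ∧ y.length = n := fun x hx =>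
    ⟨x.take n, x.drop n, (List.take_append_drop n x).symm, by simp [hx]⟩
  have mem_e : ∀ x, conv e x ∈ F.graph ↔ x ∈ F.lang e := fun x => by
    rw [F.conv_mem_graph]; tauto
  have mem_e' : ∀ x, conv (u ++ v) x ∈ F.graph ↔ x ∈ F.lang e' := fun x => by
    rw [huv, F.conv_mem_graph]; tauto
  have hgood : good R v := by
    constructor
    · rintro _ ⟨x, hx, rfl⟩ y hy
      rw [← long v x y Iff.rfl hx, mem_e'] at hy
      rw [← long_e x y hx, mem_e]
      exact hsub _ hy
    · have : ∃ x ∈ F.lang e, x ∉ F.lang e' := by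
        by_contra! h
        exact hne (Set.ext fun x => ⟨hsub x, h x⟩)
      obtain ⟨x, hx, hx'⟩ := this
      obtain ⟨y, z, rfl, hy⟩ := split x (by
        by_contra hlt
        exact hx' (hshort x hx (by omega)))
      refine ⟨_, ⟨y, hy, rfl⟩, z, ?_, ?_⟩
      · rwa [← long_e y z hy, mem_e]
      · rwa [← long v y z Iff.rfl hy, mem_e']
  have hagree : agree R v c := by
    rintro _ ⟨x, hx, rfl⟩ y hy h
    rw [← long_e x y hx, mem_e] at h
    rw [← long v x y Iff.rfl hx, mem_e']
    exact hshort _ h (by simp; omega)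
  obtain ⟨b, hb⟩ := hF e he
  obtain ⟨x₀, hx₀⟩ := F.lang_nonempty e he
  -- With `v'` in place of `v`, the index `u ++ v'` still denotes a proper subset of `F.lang e`, now
  -- containing all its words up to length `b`, which contradicts the choice of `b`. The summand
  -- `x₀.length` puts `x₀` into this subset and so shows that `u ++ v'` is an index.
  obtain ⟨v', ht, ⟨hg1, hg2⟩, ha⟩ := hc (R, typ v) ⟨v, rfl, hgood, hagree⟩ (b + x₀.length)
  simp only [typ, Prod.mk.injEq, eq_iff_iff, funext_iff] at ht
  obtain ⟨hnil, hq⟩ := ht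
  have hsmall : ∀ x ∈ F.lang e, x.length ≤ b + x₀.length → conv (u ++ v') x ∈ F.graph := by
    intro x hx hxb
    rcases le_or_gt x.length n with h | h
    · rw [short v' x hnil h, hq, ← short v x Iff.rfl h, mem_e']
      exact hshort x hx (by omega)
    · obtain ⟨y, z, rfl, hy⟩ := split x h.le
      rw [long v' y z hnil hy]
      refine ha _ ⟨y, hy, rfl⟩ z (by simp at hxb; omega) ?_
      rwa [← long_e y z hy, mem_e]
  have hidx : u ++ v' ∈ F.index :=
    ((F.conv_mem_graph _ _).1 (hsmall x₀ hx₀ (by omega))).1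
  have hfin := hb (u ++ v') hidx
    (fun x hx hxb => ((F.conv_mem_graph _ _).1 (hsmall x hx (by omega))).2) (by
      intro x hx
      have hx : conv (u ++ v') x ∈ F.graph := (F.conv_mem_graph _ _).2 ⟨hidx, hx⟩
      rcases le_or_gt x.length n with h | h
      · rw [short v' x hnil h, hq, ← short v x Iff.rfl h, mem_e'] at hx
        exact hsub x hx
      · obtain ⟨y, z, rfl, hy⟩ := split x h.le
        rw [long v' y z hnil hy] at hx
        have := hg1 _ ⟨y, hy, rfl⟩ z hx
        rwa [← long_e y z hy, mem_e] at this)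
  obtain ⟨_, ⟨x, hx, rfl⟩, y, h1, h2⟩ := hg2
  rw [← long_e x y hx, mem_e, ← hfin] at h1
  rw [← long v' x y hnil hx, F.conv_mem_graph] at h2
  exact h2 ⟨hidx, h1⟩

/-! ### A class that is not learnt by any automatic learner -/

theorem conv_cons {A B : Type} (a : A) (b : B) (x : List A) (y : List B) :
    conv (a :: x) (b :: y) = (some a, some b) :: conv x y :=
  conv_append (u := [a]) (x := [b]) (v := x) (y := y) (Or.inl rfl)

/-- For a nonempty word `b :: q`, the language consisting of the query `false :: q` and the facts
`true :: p` with `|p| = |q|`, where the fact `true :: q` is missing if `b` is false. -/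
def queryLang : List Bool → Language Bool
  | [] => 0
  | b :: q => {x | x = false :: q ∨ ∃ p, x = true :: p ∧ p.length = q.length ∧ (p ≠ q ∨ b = true)}

/-- A word is accepted from `some (some (b, t, eq))` iff it is the convolution of words `q`, `p` of
equal length for which `t :: p` is in the language with index `b :: q`; here `eq` says that the
letters read so far agree. -/
def queryDFA : DFA (Option Bool × Option Bool) (Option (Option (Bool × Bool × Bool))) where
  step s a := match s, a with
    | some none, (some b, some t) => some (some (b, t, true))
    | some (some (b, t, eq)), (some u, some v) => some (some (b, t, eq && decide (u = v)))
    | _, _ => none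
  start := some none
  accept := {s | ∃ b t eq, s = some (some (b, t, eq)) ∧ (if t then (!eq || b) else eq) = true}

theorem queryDFA_evalFrom_none (w : List (Option Bool × Option Bool)) :
    queryDFA.evalFrom none w = none := by
  induction w with
  | nil => rfl
  | cons a w ih => exact ih

theorem queryDFA_evalFrom_conv (b t eq : Bool) (q p : List Bool) (h : p.length = q.length) :
    queryDFA.evalFrom (some (some (b, t, eq))) (conv q p) =
      some (some (b, t, eq && decide (q = p))) := by
  induction q generalizing p eq with
  | nil =>
    obtain rfl := List.length_eq_zero_iff.1 h
    simp [conv]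
  | cons u q ih =>
    rcases p with _ | ⟨v, p⟩
    · simp at h
    · rw [conv_cons]
      have : queryDFA.evalFrom (some (some (b, t, eq))) ((some u, some v) :: conv q p) =
        queryDFA.evalFrom (some (some (b, t, eq && decide (u = v)))) (conv q p) := rfl
      rw [this, ih _ _ (by simpa using h), Bool.and_assoc]
      simp

theorem queryDFA_evalFrom_eq_some (b t eq : Bool) (w : List (Option Bool × Option Bool))
    (s : Option (Bool × Bool × Bool))
    (h : queryDFA.evalFrom (some (some (b, t, eq))) w = some s) :
    ∃ q p : List Bool, p.length = q.length ∧ w = conv q p := by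
  induction w generalizing eq with
  | nil => exact ⟨[], [], rfl, rfl⟩
  | cons a w ih =>
    rcases a with ⟨_ | u, _ | v⟩
    iterate 3
      have h' : queryDFA.evalFrom none w = some s := h
      rw [queryDFA_evalFrom_none] at h'
      exact absurd h' (by simp)
    obtain ⟨q, p, hl, rfl⟩ := ih (eq && decide (u = v)) h
    exact ⟨u :: q, v :: p, by simp [hl], (conv_cons u v q p).symm⟩

theorem mem_queryLang_cons (b t : Bool) (q p : List Bool) :
    t :: p ∈ queryLang (b :: q) ↔
      p.length = q.length ∧ (if t then (!decide (q = p) || b) else decide (q = p)) = true := by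
  change (t :: p = false :: q ∨ ∃ p', t :: p = true :: p' ∧ p'.length = q.length ∧
    (p' ≠ q ∨ b = true)) ↔ _
  rcases t with _ | _
  · simp only [List.cons.injEq, true_and, Bool.false_eq_true, false_and, exists_const, or_false,
      if_false, decide_eq_true_eq]
    exact ⟨fun h => by simp [h], fun h => h.2.symm⟩
  · rw [if_pos rfl, Bool.or_eq_true, Bool.not_eq_true', decide_eq_false_iff_not]
    constructor
    · rintro (h | ⟨p', h, hl, hp⟩)
      · simp at h
      · simp only [List.cons.injEq, true_and] at h
        subst h
        exact ⟨hl, hp.imp Ne.symm id⟩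
    · rintro ⟨hl, h⟩
      exact Or.inr ⟨p, rfl, hl, h.imp Ne.symm id⟩

theorem queryLang_graph_regular :
    Language.IsRegular
      ({w | ∃ e x, e ∈ ({e | e ≠ []} : Language Bool) ∧ x ∈ queryLang e ∧ w = conv e x} :
        Language (Option Bool × Option Bool)) := by
  refine ⟨_, inferInstance, queryDFA, ?_⟩
  ext w
  rw [DFA.mem_accepts]
  constructor
  · rintro ⟨b, t, eq, h, hacc⟩
    rcases w with _ | ⟨⟨_ | b', _ | t'⟩, w⟩
    · exact absurd h (by simp [queryDFA])
    iterate 3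
      have h' : queryDFA.evalFrom none w = _ := h
      rw [queryDFA_evalFrom_none] at h'
      exact absurd h' (by simp)
    have h' : queryDFA.evalFrom (some (some (b', t', true))) w = _ := h
    obtain ⟨q, p, hl, rfl⟩ := queryDFA_evalFrom_eq_some _ _ _ _ _ h'
    rw [queryDFA_evalFrom_conv _ _ _ _ _ hl] at h'
    simp only [Bool.true_and, Option.some.injEq, Prod.mk.injEq] at h'
    obtain ⟨rfl, rfl, rfl⟩ := h'
    exact ⟨b' :: q, t' :: p, List.cons_ne_nil _ _, (mem_queryLang_cons _ _ _ _).2 ⟨hl, hacc⟩,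
      (conv_cons _ _ _ _).symm⟩
  · rintro ⟨e, x, he, hx, rfl⟩
    rcases e with _ | ⟨b, q⟩
    · exact absurd rfl he
    rcases x with _ | ⟨t, p⟩
    · rcases hx with hx | ⟨_, hx, _⟩ <;> simp at hx
    rw [mem_queryLang_cons] at hx
    refine ⟨b, t, decide (q = p), ?_, hx.2⟩
    rw [conv_cons]
    exact (queryDFA_evalFrom_conv b t true q p hx.1).trans (by simp)

theorem nonempty_words_regular : Language.IsRegular ({e | e ≠ []} : Language Bool) := by
  refine ⟨Bool, inferInstance, ⟨fun _ _ => true, false, {true}⟩, ?_⟩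
  ext w
  rw [DFA.mem_accepts]
  rcases List.eq_nil_or_concat w with rfl | ⟨w, a, rfl⟩
  · exact iff_of_false (by simp) fun h => h rfl
  · rw [List.concat_eq_append, DFA.eval_append_singleton]
    exact iff_of_true rfl (show w ++ [a] ≠ [] by simp)

/-- The languages `queryLang e` as an automatic family. -/
def queryFamily : AutomaticFamily Bool Bool where
  index := {e | e ≠ []}
  lang := queryLang
  index_regular := nonempty_words_regular
  graph_regular := queryLang_graph_regular
  lang_nonempty := by
    rintro (_ | ⟨b, q⟩) he
    · exact absurd rfl he
    · exact ⟨false :: q, Or.inl rfl⟩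

/-! ### Bounded growth of automatic memories and the counting argument. -/

theorem filterMap_range_getElem? {A : Type} (x : List A) (n : ℕ) (h : x.length ≤ n) :
    (List.range n).filterMap (fun i => x[i]?) = x := by
  induction x generalizing n with
  | nil => simp
  | cons a x ih =>
    obtain ⟨n, rfl⟩ : ∃ k, n = k + 1 := ⟨n - 1, by simp at h; omega⟩
    rw [List.range_succ_eq_map, List.filterMap_cons_some (by rfl), List.filterMap_map]
    congr 1
    exact ih n (by simpa using h)

/-- An automatic update map increases lengths by at most a constant. -/
theorem IsAutomaticUpdate.exists_length_bound {A B C : Type}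
    {f : List C → List A → List C × List B} (h : IsAutomaticUpdate f) :
    ∃ c, ∀ om dat, (f om dat).1.length ≤ max om.length dat.length + c := by
  obtain ⟨σ, _, M, hM⟩ := h
  refine ⟨Fintype.card σ, fun om dat => ?_⟩
  by_contra! hlt
  set m := max om.length dat.length with hm
  set w := conv₄ om dat (f om dat).1 (f om dat).2 with hw
  have hacc : w ∈ M.accepts := by rw [hM]; exact ⟨om, dat, rfl⟩
  -- Both arguments of the update can be read off its coded graph.
  have tracks : ∀ om dat, (conv₄ om dat (f om dat).1 (f om dat).2).filterMap (·.1) = om ∧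
      (conv₄ om dat (f om dat).1 (f om dat).2).filterMap (·.2.1) = dat := by
    intro om dat
    unfold conv₄
    rw [List.filterMap_map, List.filterMap_map]
    exact ⟨filterMap_range_getElem? om _ (by omega), filterMap_range_getElem? dat _ (by omega)⟩
  have hlen : w.length = max m (max (f om dat).1.length (f om dat).2.length) := by
    simp [hw, conv₄, hm]
  have hdrop : ∀ a ∈ w.drop m, a.1 = none ∧ a.2.1 = none := by
    intro a ha
    obtain ⟨i, hi, rfl⟩ := List.getElem_of_mem ha
    have h1 : om.length ≤ m + i := by omega
    have h2 : dat.length ≤ m + i := by omega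
    simp [hw, conv₄, h1, h2]
  -- Beyond position `m` only padding remains on the tracks of the arguments. A state repeats there,
  -- and deleting the loop `b` leaves both arguments unchanged.
  obtain ⟨q, a, b, c, habc, -, hb, h1, h2, h3⟩ := M.evalFrom_split (x := w.drop m)
    (s := M.eval (w.take m)) (by rw [List.length_drop]; omega) rfl
  have hdel : ∀ {D : Type} (g : Option C × Option A × Option C × Option B → Option D),
      (∀ a ∈ w.drop m, g a = none) → (w.take m ++ (a ++ c)).filterMap g = w.filterMap g := by
    intro D g hg
    conv_rhs => rw [← List.take_append_drop m w]
    simp only [List.filterMap_append (l := w.take m)]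
    congr 1
    rw [List.filterMap_eq_nil_iff.2 hg, List.filterMap_eq_nil_iff.2]
    intro x hx
    apply hg
    rw [habc]
    simp only [List.mem_append] at hx ⊢
    tauto
  have hacc' : w.take m ++ (a ++ c) ∈ M.accepts := by
    rw [DFA.mem_accepts, DFA.eval, DFA.evalFrom_of_append, DFA.evalFrom_of_append]
    change M.evalFrom (M.evalFrom (M.eval (w.take m)) a) c ∈ _
    rw [h1, h3]
    change M.evalFrom (M.evalFrom _ _) _ ∈ _
    rw [← DFA.evalFrom_of_append, List.take_append_drop]
    exact hacc
  rw [hM] at hacc'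
  obtain ⟨om', dat', h'⟩ := hacc'
  have e1 := (tracks om' dat').1
  have e2 := (tracks om' dat').2
  rw [← h', hdel _ fun a ha => (hdrop a ha).1, (tracks om dat).1] at e1
  rw [← h', hdel _ fun a ha => (hdrop a ha).2, (tracks om dat).2] at e2
  -- The shortened word codes the same arguments, hence the same values, and so it would have to
  -- equal `w`.
  rw [← e1, ← e2, ← hw] at h'
  conv_rhs at h' => rw [← List.take_append_drop m w, habc]
  have := congrArg List.length h'
  have hb' := List.length_pos_iff.2 hb
  simp only [List.length_append] at this
  omega

/-- The length of the data enters through a maximum and only their number is multiplied by `c`: many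
long data still leave a short memory. -/
theorem length_memoryAfter_wordLearner {A B C : Type} {f : List C → List A → List C × List B}
    {c : ℕ} (hc : ∀ om dat, (f om dat).1.length ≤ max om.length dat.length + c) (m₀ : List C)
    (n : ℕ) (l : List (List A)) (hl : ∀ x ∈ l, x.length ≤ n) :
    (show List C from (wordLearner m₀ f).memoryAfter l).length ≤
      max m₀.length n + c * l.length := by
  induction l using List.reverseRecOn with
  | nil => simp [Learner.memoryAfter, wordLearner]
  | append_singleton l x ih =>
    have h1 := ih fun y hy => hl y (by simp [hy])
    have h2 := hl x (by simp)
    have h3 := hc (show List C from (wordLearner m₀ f).memoryAfter l) x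
    have h4 : (wordLearner m₀ f).memoryAfter (l ++ [x]) =
        (f ((wordLearner m₀ f).memoryAfter l) x).1 := by
      simp only [Learner.memoryAfter, List.foldl_append, List.foldl_cons, List.foldl_nil]
      rfl
    rw [h4, List.length_append, List.length_singleton, mul_add]
    dsimp only at h1 h3 ⊢
    omega

/-- After equal memories and with a common continuation, the learner issues the same conjectures, so
it cannot tell the two texts apart. -/
theorem Learner.Learns.eq_of_memoryAfter_eq {A B : Type} {M : Learner A B}
    {H : AutomaticFamily B A} {𝓛 : Set (Language A)} (hM : M.Learns H 𝓛) {L L' : Language A}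
    (hL : L ∈ 𝓛) (hL' : L' ∈ 𝓛) {l l' : List (List A)} {t : ℕ → List A}
    (h : M.memoryAfter l = M.memoryAfter l') (ht : IsText (prepend l t) L)
    (ht' : IsText (prepend l' t) L') : L = L' := by
  have key : ∀ n, M.conjecture (prepend l t) (l.length + n) =
      M.conjecture (prepend l' t) (l'.length + n) := fun n => by
    rw [Learner.conjecture_prepend, Learner.conjecture_prepend]
    unfold Learner.memoryAfter at h ⊢
    rw [List.foldl_append, List.foldl_append, h]
  obtain ⟨-, e, -, he, k, hk⟩ := hM L hL _ ht
  obtain ⟨-, e', -, he', k', hk'⟩ := hM L' hL' _ ht'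
  have h1 := hk (l.length + (k + k')) (by omega)
  have h2 := hk' (l'.length + (k + k')) (by omega)
  rw [← he, ← he', ← h1, key, h2]

/-- Compares the exponents in the counting argument: linear for memories, quadratic for sets of
facts. -/
theorem exists_lt_mul_self (k a b : ℕ) : ∃ n, 0 < n ∧ k * (a + b * n) < n * n := by
  refine ⟨k * (a + b) + 1, by omega, ?_⟩
  have h1 : k * (a + b * (k * (a + b) + 1)) ≤ k * (a + b) * (k * (a + b) + 1) := by
    rw [mul_assoc]
    apply Nat.mul_le_mul_left
    rw [add_mul]
    have : a * 1 ≤ a * (k * (a + b) + 1) := Nat.mul_le_mul_left _ (by omega)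
    omega
  exact h1.trans_lt (Nat.mul_lt_mul_of_pos_right (Nat.lt_succ_self _) (by omega))

/-- The fact of length `2 * n + 1` that consists of the `i`-th unit vector and `v`. -/
def unitFact {n : ℕ} (i : Fin n) (v : Fin n → Bool) : List Bool :=
  List.ofFn (fun j => decide (j = i)) ++ List.ofFn v

theorem length_unitFact {n : ℕ} (i : Fin n) (v : Fin n → Bool) :
    (unitFact i v).length = n + n := by simp [unitFact]

theorem unitFact_inj {n : ℕ} {i j : Fin n} {v w : Fin n → Bool} (h : unitFact i v = unitFact j w) :
    i = j ∧ v = w := by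
  obtain ⟨h1, h2⟩ := List.append_inj h (by simp)
  refine ⟨?_, List.ofFn_injective h2⟩
  have := congrFun (List.ofFn_injective h1) i
  simpa using this

theorem not_automaticallyLearnable_queryFamily :
    ¬ AutomaticallyLearnable queryFamily.languages := by
  rintro ⟨B, _, H, C, _, m₀, f, hf, hM⟩
  have := Fintype.ofFinite C
  obtain ⟨c, hc⟩ := hf.exists_length_bound
  set k := Fintype.card C + 1 with hk
  -- Here `k` counts the memory letters together with the padding. There are at most `k ^ X`
  -- memories with `X` linear in `n`, and `2 ^ (n * n)` functions `g`.
  obtain ⟨n, hn, hkn⟩ := exists_lt_mul_self k (m₀.length + 1) (2 + c)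
  let seq (g : Fin n → Fin n → Bool) : List (List Bool) :=
    List.ofFn fun i => true :: unitFact i (g i)
  let mem (g : Fin n → Fin n → Bool) : List C := (wordLearner m₀ f).memoryAfter (seq g)
  have hlen : ∀ g, (mem g).length ≤ m₀.length + 1 + (2 + c) * n := by
    intro g
    have := length_memoryAfter_wordLearner hc m₀ (n + n + 1) (seq g) (by
      intro x hx
      obtain ⟨i, rfl⟩ := List.mem_ofFn.1 hx
      simp [length_unitFact])
    have h2 : (seq g).length = n := by simp [seq]
    rw [h2] at this
    refine this.trans ?_
    rw [add_mul]
    omega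
  set X := m₀.length + 1 + (2 + c) * n with hX
  obtain ⟨g, g', hne, heq⟩ := Fintype.exists_ne_map_eq_of_card_lt
    (fun (g : Fin n → Fin n → Bool) (i : Fin X) => (mem g)[(i : ℕ)]?) (by
      simp only [Fintype.card_fun, Fintype.card_fin, Fintype.card_bool, Fintype.card_option]
      rw [← hk, ← pow_mul]
      calc k ^ X ≤ (2 ^ k) ^ X := Nat.pow_le_pow_left (Nat.lt_two_pow_self).le _
        _ = 2 ^ (k * X) := (pow_mul _ _ _).symm
        _ < 2 ^ (n * n) := Nat.pow_lt_pow_right (by omega) hkn)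
  have hmem : mem g = mem g' := by
    apply List.ext_getElem?
    intro i
    rcases lt_or_ge i X with h | h
    · exact congrFun heq ⟨i, h⟩
    · rw [List.getElem?_eq_none ((hlen g).trans h), List.getElem?_eq_none ((hlen g').trans h)]
  obtain ⟨i, hi⟩ := Function.ne_iff.1 hne
  -- The fact about `q` occurs in `seq g` but not in `seq g'`, since the unit vector allows only the
  -- `i`-th fact to match. Followed by the same text of `queryLang (false :: q)`, the two sequences
  -- therefore become texts for different languages.
  set q := unitFact i (g i) with hq
  have h0 : queryLang (false :: q) ∈ queryFamily.languages :=
    ⟨false :: q, List.cons_ne_nil _ _, rfl⟩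
  have h1 : queryLang (true :: q) ∈ queryFamily.languages :=
    ⟨true :: q, List.cons_ne_nil _ _, rfl⟩
  obtain ⟨t, ht⟩ := exists_isText (L := queryLang (false :: q)) ⟨false :: q, Or.inl rfl⟩
  have htm : ∀ n, t n ∈ queryLang (false :: q) := fun n => (ht _).2 ⟨n, rfl⟩
  have hsub : ∀ x ∈ queryLang (false :: q), x ∈ queryLang (true :: q) := by
    rintro x (hx | ⟨p, hx, hp, -⟩)
    · exact Or.inl hx
    · exact Or.inr ⟨p, hx, hp, Or.inr rfl⟩
  have := hM.eq_of_memoryAfter_eq h1 h0 (l := seq g) (l' := seq g') (t := t) hmem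
    (isText_prepend (by
      intro x hx
      obtain ⟨j, rfl⟩ := List.mem_ofFn.1 hx
      exact Or.inr ⟨_, rfl, by simp [hq, length_unitFact], Or.inr rfl⟩) (fun n => hsub _ (htm n)) (by
      rintro x (hx | ⟨p, rfl, hp, -⟩)
      · exact Or.inr ((ht _).1 (Or.inl hx))
      · by_cases hpq : p = q
        · exact Or.inl (List.mem_ofFn.2 ⟨i, by rw [hpq]⟩)
        · exact Or.inr ((ht _).1 (Or.inr ⟨p, rfl, hp, Or.inl hpq⟩))))
    (isText_prepend (by
      intro x hx
      obtain ⟨j, rfl⟩ := List.mem_ofFn.1 hx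
      refine Or.inr ⟨_, rfl, by simp [hq, length_unitFact], Or.inl fun h => hi ?_⟩
      obtain ⟨rfl, h2⟩ := unitFact_inj h
      exact h2.symm) htm fun x hx => Or.inr ((ht x).1 hx))
  have hq1 : true :: q ∈ queryLang (true :: q) := Or.inr ⟨q, rfl, rfl, Or.inr rfl⟩
  rw [this] at hq1
  rcases hq1 with h | ⟨p, h, -, h2⟩
  · simp at h
  · simp only [List.cons.injEq, true_and] at h
    rcases h2 with h2 | h2
    · exact h2 h.symm
    · simp at h2

/-! ### Sweeps of the head of a stack machine -/

namespace StackLearner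

variable {A B : Type} {k : ℕ} (M : StackLearner A B k)

theorem step_eq {s s' : M.Q} {hd : ℕ} {cells : ℕ → Cell A B M.C M.W} {stk : Fin k → List M.S}
    {b : Cell A B M.C M.W} {mv : Move} {ops : Fin k → StackOp M.S}
    (hs : M.accept s = false)
    (h : M.δ s (M.scanned ⟨s, hd, cells, stk⟩) (fun j => (stk j).head?) = (s', b, mv, ops)) :
    M.step ⟨s, hd, cells, stk⟩ =
      ⟨s', moveHead hd mv, M.write hd cells b, fun j => (ops j).apply (stk j)⟩ := by
  simp only [step, hs, Bool.false_eq_true, if_false, h]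

/-- A sweep to the right over the first `N` cells. -/
theorem iterate_step_right (s : ℕ → M.Q) (stk : ℕ → Fin k → List M.S)
    (b : ℕ → Cell A B M.C M.W) (cells : ℕ → Cell A B M.C M.W) (N : ℕ)
    (h : ∀ i < N, M.accept (s i) = false ∧ ∃ ops,
      M.δ (s i) (some (cells i)) (fun j => (stk i j).head?) = (s (i + 1), b i, .right, ops) ∧
      stk (i + 1) = fun j => (ops j).apply (stk i j)) :
    M.step^[N] ⟨s 0, 1, cells, stk 0⟩ =
      ⟨s N, N + 1, fun i => if i < N then b i else cells i, stk N⟩ := by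
  induction N with
  | zero => simp
  | succ N ih =>
    rw [Function.iterate_succ_apply', ih fun i hi => h i (by omega)]
    obtain ⟨h1, ops, h2, h3⟩ := h N (by omega)
    rw [M.step_eq h1 (s' := s (N + 1)) (b := b N) (mv := .right) (ops := ops)]
    · rw [← h3]
      simp only [moveHead, write, Config.mk.injEq, true_and, and_true]
      funext i
      by_cases hi : i = N
      · subst hi; simp
      · rw [Function.update_of_ne hi]
        have : i < N + 1 ↔ i < N := by omega
        simp only [this]
    · rw [← h2]
      simp [scanned]

/-- A sweep to the left over the `N` cells that follow the first `o` cells. -/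
theorem iterate_step_left (s : ℕ → M.Q) (stk : ℕ → Fin k → List M.S)
    (b : ℕ → Cell A B M.C M.W) (o : ℕ) (N : ℕ) (cells : ℕ → Cell A B M.C M.W)
    (h : ∀ i, o ≤ i → i < o + N → M.accept (s (i + 1)) = false ∧ ∃ ops,
      M.δ (s (i + 1)) (some (cells i)) (fun j => (stk (i + 1) j).head?) = (s i, b i, .left, ops) ∧
      stk i = fun j => (ops j).apply (stk (i + 1) j)) :
    M.step^[N] ⟨s (o + N), o + N, cells, stk (o + N)⟩ =
      ⟨s o, o, fun i => if o ≤ i ∧ i < o + N then b i else cells i, stk o⟩ := by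
  induction N generalizing cells with
  | zero =>
    simp only [Function.iterate_zero, id_eq, add_zero, Config.mk.injEq, true_and, and_true]
    funext i
    rw [if_neg (by omega)]
  | succ N ih =>
    obtain ⟨h1, ops, h2, h3⟩ := h (o + N) (by omega) (by omega)
    rw [Function.iterate_succ_apply, ← add_assoc,
      M.step_eq (cells := cells) (hd := o + N + 1) h1 (by simpa only [scanned] using h2), ← h3]
    simp only [moveHead, write, Nat.add_sub_cancel]
    rw [ih]
    · simp only [Config.mk.injEq, true_and, and_true]
      funext i
      by_cases hi : i = o + N
      · subst hi; simp
      · rw [Function.update_of_ne hi]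
        have : (o ≤ i ∧ i < o + N + 1) ↔ (o ≤ i ∧ i < o + N) := by omega
        simp only [this]
    · intro i hi1 hi2
      rw [Function.update_of_ne (by omega)]
      exact h i hi1 (by omega)

theorem iterate_step_trans {m n : ℕ} {c c' c'' : M.Config} (h : M.step^[m] c = c')
    (h' : M.step^[n] c' = c'') : M.step^[m + n] c = c'' := by
  rw [add_comm, Function.iterate_add_apply, h, h']

theorem iterate_step_of_accept {n t : ℕ} {c c' : M.Config} (h : M.step^[n] c = c')
    (ha : M.accept c'.state = true) (hn : n ≤ t) : M.step^[t] c = c' := by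
  obtain ⟨d, rfl⟩ := Nat.exists_eq_add_of_le hn
  refine M.iterate_step_trans h ?_
  induction d with
  | zero => rfl
  | succ d ih =>
    rw [Function.iterate_succ_apply']
    rw [ih (by omega), step, if_pos ha]

theorem cycle_of_iterate {n t : ℕ} {x : List A} {m m' : List M.C} {e : List B}
    {stk stk' : Fin k → List M.S} {c : M.Config}
    (h : M.step^[n] (M.startConfig x m stk) = c) (ha : M.accept c.state = true) (hn : n ≤ t)
    (ho : M.Outputs c m' e) (hs : c.stk = stk') : M.Cycle t x m stk m' e stk' := by
  unfold Cycle
  rw [M.iterate_step_of_accept h ha hn]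
  exact ⟨ha, ho, hs⟩

theorem startConfig_eq (x : List A) (m : List M.C) (stk : Fin k → List M.S) :
    M.startConfig x m stk =
      ⟨M.start, 0, fun i => (padLetter (x[i]?, m[i]?)).elim .blank .input, stk⟩ := by
  unfold startConfig
  simp only [conv_getElem?]

theorem outputs_iff {c : M.Config} {m : List M.C} {e : List B} :
    M.Outputs c m e ↔ ∀ i, i ≤ max m.length e.length →
      c.cells i = (padLetter (m[i]?, e[i]?)).elim .blank .output := by
  unfold Outputs
  simp only [conv_getElem?, length_conv]

theorem longest_succ (T : ℕ → List A) (n : ℕ) :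
    longest T (n + 1) = max (longest T n) (T (n + 1)).length := by
  unfold longest
  rw [Finset.range_add_one, Finset.sup_insert, sup_comm]

theorem length_le_longest (T : ℕ → List A) {i n : ℕ} (h : i ≤ n) : (T i).length ≤ longest T n :=
  Finset.le_sup (f := fun i => (T i).length) (by simpa [Nat.lt_succ_iff] using h)

end StackLearner

/-! ### A learner with one stack for the class of query languages -/

/-- The states of the machine for the query languages. -/
inductive QState
  | start
  | first
  | pushRight
  | pushLeft
  | term
  | copy
  | cmp (bit eqw eqs : Bool)
  | back (bit : Bool)
  | fin (bit : Bool)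
  | acc

/-- The states as a finite type. -/
def QState.code : QState → Fin 9 × Bool × Bool × Bool
  | .start => (0, false, false, false)
  | .first => (1, false, false, false)
  | .pushRight => (2, false, false, false)
  | .pushLeft => (3, false, false, false)
  | .term => (4, false, false, false)
  | .copy => (5, false, false, false)
  | .cmp a b c => (6, a, b, c)
  | .back a => (7, a, false, false)
  | .fin a => (8, a, false, false)
  | .acc => (0, true, false, false)

theorem QState.code_injective : Function.Injective QState.code := by
  rintro (_ | _ | _ | _ | _ | _ | _ | _ | _ | _) (_ | _ | _ | _ | _ | _ | _ | _ | _ | _) h <;>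
    simp_all [QState.code]

instance : Finite QState := Finite.of_injective _ QState.code_injective

/-- Comparison of the top of the stack with a letter, or with the end of a word. -/
def topEnds : Option (Option Bool) → Bool
  | some (some _) => false
  | _ => true

/-- The transition function. A fact `true :: p` is pushed as a block with `none` on top of the
letters of `p`. -/
def queryδ : QState → Option (Cell Bool Bool Bool Unit) → Option (Option Bool) →
    QState × Cell Bool Bool Bool Unit × Move × StackOp (Option Bool)
  | .start, _, _ => (.first, .blank, .right, .keep)
  | .first, some (.input (some true, none)), _ => (.pushRight, .work (), .right, .keep)
  | .first, some (.input (some false, none)), _ =>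
    (.copy, .output (some false, some false), .right, .keep)
  | .first, some (.input (w, some b)), t =>
    (.cmp b (decide (w = some true)) (decide (t = some none)), .output (some b, some b), .right,
      .pop)
  | .first, _, _ => (.term, .output (none, some false), .right, .keep)
  | .pushRight, some (.input x), _ => (.pushRight, .input x, .right, .keep)
  | .pushRight, _, _ => (.pushLeft, .blank, .left, .keep)
  | .pushLeft, some (.input (some v, x)), _ =>
    (.pushLeft, .input (some v, x), .left, .push (some v))
  | .pushLeft, _, _ => (.term, .output (none, some false), .right, .push none)
  | .term, _, _ => (.acc, .blank, .stay, .keep)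
  | .copy, some (.input (some v, _)), _ => (.copy, .output (some v, some v), .right, .keep)
  | .copy, _, _ => (.acc, .blank, .stay, .keep)
  | .cmp b eqw eqs, some (.input (w, some u)), some (some v) =>
    (.cmp b (eqw && decide (w = some u)) (eqs && decide (v = u)), .output (some u, some u), .right,
      .pop)
  | .cmp b eqw _, some (.input (w, some u)), _ =>
    (.cmp b (eqw && decide (w = some u)) false, .output (some u, some u), .right, .keep)
  | .cmp b eqw eqs, some .blank, t => (.back (b || eqw || (eqs && topEnds t)), .blank, .left, .keep)
  | .cmp b _ eqs, some _, t => (.back (b || (eqs && topEnds t)), .blank, .left, .keep)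
  | .cmp _ _ _, none, _ => (.acc, .blank, .stay, .keep)
  | .back b, some c, _ => (.back b, c, .left, .keep)
  | .back b, none, _ => (.fin b, .blank, .right, .keep)
  | .fin b, _, _ => (.acc, .output (some b, some b), .stay, .keep)
  | .acc, _, _ => (.acc, .blank, .stay, .keep)

/-- The machine for the query languages. -/
abbrev queryMachine : StackLearner Bool Bool 1 where
  C := Bool
  W := Unit
  S := Option Bool
  Q := QState
  finite_C := inferInstance
  finite_W := inferInstance
  finite_S := inferInstance
  finite_Q := inferInstance
  start := .start
  accept q := match q with
    | .acc => true
    | _ => false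
  δ q c t := let r := queryδ q c (t 0); (r.1, r.2.1, r.2.2.1, fun _ => r.2.2.2)
  initMem := []

/-- Comparison of the next letter of a word with the top of the stack. -/
def cmpStep (r : Bool × List (Option Bool)) (u : Bool) : Bool × List (Option Bool) :=
  match r.2 with
  | some v :: s => (r.1 && decide (v = u), s)
  | s => (false, s)

/-- Comparison of a word with the block on top of the stack. -/
def cmpWord (q : List Bool) (s : List (Option Bool)) : Bool × List (Option Bool) :=
  q.foldl cmpStep (decide (s.head? = some none), s.tail)

/-- The effect of one cycle on memory and stack. -/
def queryCycle (m : List Bool) (s : List (Option Bool)) (w : List Bool) :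
    List Bool × List (Option Bool) :=
  match m, w with
  | [], true :: p => ([], none :: p.map some ++ s)
  | [], [] => ([], s)
  | [], false :: p => (false :: p, s)
  | b :: q, w =>
    let r := cmpWord q s
    ((b || decide (w = true :: q) || (r.1 && topEnds r.2.head?)) :: q, r.2)

/-- The conjecture that belongs to a memory. -/
def queryConj (m : List Bool) : List Bool := if m = [] then [false] else m

theorem queryMachine_cycle_nil (s : List (Option Bool)) (t : ℕ) (ht : 3 ≤ t) :
    queryMachine.Cycle t [] [] (fun _ => s) [] [false] (fun _ => s) := by
  refine queryMachine.cycle_of_iterate (n := 3) rfl rfl ht ?_ ?_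
  · rw [StackLearner.outputs_iff]
    intro i hi
    have : i = 0 ∨ i = 1 := by simp at hi; omega
    rcases this with rfl | rfl <;> rfl
  · rfl

/-- Letters are pushed on the way back, so the first letter of `p` ends up on top, below the marker.
The symbol `.work ()` in the first cell tells the returning head where to stop. -/
theorem queryMachine_cycle_fact (p : List Bool) (s : List (Option Bool)) (t : ℕ)
    (ht : 2 * p.length + 5 ≤ t) :
    queryMachine.Cycle t (true :: p) [] (fun _ => s) [] [false]
      (fun _ => none :: p.map some ++ s) := by
  set cells : ℕ → Cell Bool Bool Bool Unit :=
    fun i => (padLetter ((true :: p)[i]?, (none : Option Bool))).elim .blank .input with hcells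
  have hcell : ∀ i, (h : i < p.length) → cells (i + 1) = .input (some p[i], none) := by
    intro i h
    simp [hcells, h, padLetter]
  have hblank : cells (p.length + 1) = .blank := by
    simp [hcells, padLetter]
  have h1 : queryMachine.step^[1] (queryMachine.startConfig (true :: p) [] fun _ => s) =
      ⟨.first, 1, cells, fun _ => s⟩ := by
    rw [StackLearner.startConfig_eq]
    rfl
  have h2 := queryMachine.iterate_step_right
    (fun i => if i = 0 then QState.first else .pushRight) (fun _ _ => s)
    (fun i => if i = 0 then .work () else cells i) cells (p.length + 1) (by
      intro i hi
      rcases i with _ | i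
      · exact ⟨rfl, fun _ => .keep, rfl, rfl⟩
      · refine ⟨rfl, fun _ => .keep, ?_, rfl⟩
        rw [hcell i (by omega)]
        rfl)
  set cells' : ℕ → Cell Bool Bool Bool Unit := fun i => if i < p.length + 1 then
    if i = 0 then .work () else cells i else cells i with hcells'
  have h3 : queryMachine.step^[1] ⟨QState.pushRight, p.length + 2, cells', fun _ => s⟩ =
      ⟨QState.pushLeft, 1 + p.length, cells', fun _ => s⟩ := by
    rw [Function.iterate_one, queryMachine.step_eq (s' := QState.pushLeft) (b := .blank)
      (mv := .left) (ops := fun _ => .keep) rfl]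
    · have : Function.update cells' (p.length + 1) Cell.blank = cells' := by
        rw [Function.update_eq_self_iff]
        simp [hcells', hblank]
      simp only [StackLearner.write, StackLearner.moveHead, this, StackOp.apply,
        StackLearner.Config.mk.injEq, true_and, and_true]
      omega
    · simp only [StackLearner.scanned]
      simp only [hcells', if_neg (lt_irrefl _), hblank]
      rfl
  have h4 := queryMachine.iterate_step_left (fun _ => QState.pushLeft)
    (fun i _ => (p.drop (i - 1)).map some ++ s) cells' 1 p.length cells' (by
      intro i hi1 hi2
      obtain ⟨i, rfl⟩ : ∃ j, i = j + 1 := ⟨i - 1, by omega⟩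
      have hi : i < p.length := by omega
      refine ⟨rfl, fun _ => .push (some p[i]), ?_, ?_⟩
      · simp only [hcells']
        rw [if_pos (by omega), if_neg (by omega), hcell i hi]
        rfl
      · funext _
        simp only [Nat.add_sub_cancel, StackOp.apply]
        rw [List.drop_eq_getElem_cons hi]
        rfl)
  have e1 : (fun (_ : Fin 1) => (p.drop (1 + p.length - 1)).map some ++ s) = fun _ => s := by
    simp
  rw [e1] at h4
  have h5 := queryMachine.iterate_step_trans (queryMachine.iterate_step_trans
    (queryMachine.iterate_step_trans h1 h2) h3) h4
  simp only [ite_self, Nat.sub_self, List.drop_zero] at h5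
  have h6 : queryMachine.step^[2] ⟨QState.pushLeft, 1, cells', fun _ => p.map some ++ s⟩ =
      ⟨QState.acc, 2, Function.update (Function.update cells' 0 (.output (none, some false))) 1
        .blank, fun _ => none :: p.map some ++ s⟩ := rfl
  refine queryMachine.cycle_of_iterate (queryMachine.iterate_step_trans h5 h6) rfl (by omega) ?_ rfl
  rw [StackLearner.outputs_iff]
  intro i hi
  have : i = 0 ∨ i = 1 := by simp at hi; omega
  rcases this with rfl | rfl <;> simp [padLetter]

theorem queryMachine_cycle_query (q : List Bool) (s : List (Option Bool)) (t : ℕ)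
    (ht : q.length + 3 ≤ t) :
    queryMachine.Cycle t (false :: q) [] (fun _ => s) (false :: q) (false :: q) (fun _ => s) := by
  set cells : ℕ → Cell Bool Bool Bool Unit :=
    fun i => (padLetter ((false :: q)[i]?, (none : Option Bool))).elim .blank .input with hcells
  have hcell : ∀ i, (h : i < q.length) → cells (i + 1) = .input (some q[i], none) := by
    intro i h
    simp [hcells, h, padLetter]
  have hblank : cells (q.length + 1) = .blank := by
    simp [hcells, padLetter]
  have h1 : queryMachine.step^[1] (queryMachine.startConfig (false :: q) [] fun _ => s) =
      ⟨.first, 1, cells, fun _ => s⟩ := by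
    rw [StackLearner.startConfig_eq]
    rfl
  have h2 := queryMachine.iterate_step_right
    (fun i => if i = 0 then QState.first else .copy) (fun _ _ => s)
    (fun i => .output ((false :: q)[i]?, (false :: q)[i]?)) cells (q.length + 1) (by
      intro i hi
      rcases i with _ | i
      · exact ⟨rfl, fun _ => .keep, rfl, rfl⟩
      · refine ⟨rfl, fun _ => .keep, ?_, rfl⟩
        have hi : i < q.length := by omega
        rw [hcell i hi]
        simp only [List.getElem?_cons_succ, List.getElem?_eq_getElem hi]
        rfl)
  set cells' : ℕ → Cell Bool Bool Bool Unit := fun i => if i < q.length + 1 then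
    .output ((false :: q)[i]?, (false :: q)[i]?) else cells i with hcells'
  have h3 : queryMachine.step^[1] ⟨QState.copy, q.length + 2, cells', fun _ => s⟩ =
      ⟨QState.acc, q.length + 2, cells', fun _ => s⟩ := by
    rw [Function.iterate_one, queryMachine.step_eq (s' := QState.acc) (b := .blank)
      (mv := .stay) (ops := fun _ => .keep) rfl]
    · have : Function.update cells' (q.length + 1) Cell.blank = cells' := by
        rw [Function.update_eq_self_iff]
        simp [hcells', hblank]
      simp only [StackLearner.write, StackLearner.moveHead, this, StackOp.apply]
    · simp only [StackLearner.scanned]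
      simp only [hcells', if_neg (lt_irrefl _), hblank]
      rfl
  refine queryMachine.cycle_of_iterate (queryMachine.iterate_step_trans
    (queryMachine.iterate_step_trans h1 h2) h3) rfl (by omega) ?_ rfl
  rw [StackLearner.outputs_iff]
  intro i hi
  simp only [max_self, List.length_cons] at hi
  rcases Nat.lt_or_eq_of_le hi with hi | rfl
  · simp only [hcells', if_pos hi]
    rw [List.getElem?_eq_getElem (by simpa using hi)]
    rfl
  · simp [hcells', hblank, padLetter]

theorem cmpWord_succ (q : List Bool) (s : List (Option Bool)) (i : ℕ) (hi : i < q.length) :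
    cmpWord (q.take (i + 1)) s = cmpStep (cmpWord (q.take i) s) q[i] := by
  unfold cmpWord
  rw [List.take_succ_eq_append_getElem hi, List.foldl_append]
  rfl

/-- A single sweep to the right compares `q` with the datum and with the top block at once. The
result belongs in the first cell but is known only at the right end, hence the sweep back. -/
theorem queryMachine_cycle_compare (b : Bool) (q : List Bool) (s : List (Option Bool))
    (w : List Bool) (t : ℕ) (ht : 2 * q.length + 6 ≤ t) :
    let m := (b || decide (w = true :: q) ||
      ((cmpWord q s).1 && topEnds (cmpWord q s).2.head?)) :: q
    queryMachine.Cycle t w (b :: q) (fun _ => s) m m (fun _ => (cmpWord q s).2) := by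
  intro m
  set bit := b || decide (w = true :: q) ||
      ((cmpWord q s).1 && topEnds (cmpWord q s).2.head?) with hbit
  set cells : ℕ → Cell Bool Bool Bool Unit :=
    fun i => (padLetter (w[i]?, (b :: q)[i]?)).elim .blank .input with hcells
  have hcell : ∀ i, (h : i < q.length) → cells (i + 1) = .input (w[i + 1]?, some q[i]) := by
    intro i h
    simp only [hcells, List.getElem?_cons_succ, List.getElem?_eq_getElem h]
    rw [padLetter_eq_some (by simp)]
    rfl
  have h1 : queryMachine.step^[1] (queryMachine.startConfig w (b :: q) fun _ => s) =
      ⟨.first, 1, cells, fun _ => s⟩ := by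
    rw [StackLearner.startConfig_eq]
    rfl
  -- The datum agrees with `true :: q` up to and including position `i`.
  let eqw (i : ℕ) : Bool := decide (∀ j ≤ i, w[j]? = (true :: q)[j]?)
  have h2 := queryMachine.iterate_step_right
    (fun i => if i = 0 then QState.first else
      .cmp b (eqw (i - 1)) (cmpWord (q.take (i - 1)) s).1)
    (fun i _ => if i = 0 then s else (cmpWord (q.take (i - 1)) s).2)
    (fun i => .output ((b :: q)[i]?, (b :: q)[i]?)) cells (q.length + 1) (by
      intro i hi
      rcases i with _ | i
      · refine ⟨rfl, fun _ => .pop, ?_, by funext; rfl⟩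
        have : cells 0 = .input (w[0]?, some b) := by
          simp only [hcells, List.getElem?_cons_zero]
          rw [padLetter_eq_some (by simp)]
          rfl
        rw [this]
        have e : eqw 0 = decide (w[0]? = some true) := by
          simp [eqw]
        simp only [if_pos, Nat.zero_add, one_ne_zero, if_false, Nat.sub_self, List.take_zero, e]
        rcases w[0]? with _ | _ | _ <;> rfl
      · have hi : i < q.length := by omega
        have e : eqw (i + 1) = (eqw i && decide (w[i + 1]? = some q[i])) := by
          simp only [eqw]
          rw [← Bool.decide_and, decide_eq_decide]
          constructor
          · intro h
            refine ⟨fun j hj => h j (by omega), ?_⟩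
            rw [h (i + 1) le_rfl, List.getElem?_cons_succ, List.getElem?_eq_getElem hi]
          · rintro ⟨h1, h2⟩ j hj
            rcases Nat.lt_or_eq_of_le hj with hj | rfl
            · exact h1 j (by omega)
            · rw [h2, List.getElem?_cons_succ, List.getElem?_eq_getElem hi]
        simp only [Nat.add_sub_cancel, Nat.succ_ne_zero, if_false]
        rw [hcell i hi, e, cmpWord_succ _ _ _ hi, List.getElem?_cons_succ,
          List.getElem?_eq_getElem hi]
        rcases hc : cmpWord (q.take i) s with ⟨ok, _ | ⟨_ | v, r⟩⟩
        · exact ⟨trivial, fun _ => .keep, rfl, rfl⟩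
        · exact ⟨trivial, fun _ => .keep, rfl, rfl⟩
        · exact ⟨trivial, fun _ => .pop, rfl, rfl⟩)
  simp only [if_true, Nat.succ_ne_zero, if_false, Nat.add_sub_cancel, List.take_length] at h2
  set cells' : ℕ → Cell Bool Bool Bool Unit := fun i => if i < q.length + 1 then
    .output ((b :: q)[i]?, (b :: q)[i]?) else cells i with hcells'
  have h3 : queryMachine.step^[1] ⟨QState.cmp b (eqw q.length) (cmpWord q s).1, q.length + 2,
      cells', fun _ => (cmpWord q s).2⟩ =
      ⟨QState.back bit, 0 + (q.length + 1), Function.update cells' (q.length + 1) .blank,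
        fun _ => (cmpWord q s).2⟩ := by
    rw [Function.iterate_one, queryMachine.step_eq (s' := QState.back bit) (b := .blank)
      (mv := .left) (ops := fun _ => .keep) rfl]
    · simp only [StackLearner.write, StackLearner.moveHead, StackOp.apply, zero_add]
      rfl
    · simp only [StackLearner.scanned]
      have hb : (b :: q)[q.length + 1]? = none := by simp
      simp only [hcells', if_neg (lt_irrefl _), hcells, hb]
      -- At the turning point a blank means that the datum is no longer than `true :: q`, and any
      -- other symbol means that it is longer and hence different.
      rcases hw : w[q.length + 1]? with _ | a
      · have : eqw q.length = decide (w = true :: q) := by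
          simp only [eqw]
          rw [decide_eq_decide]
          refine ⟨fun h => List.ext_getElem? fun j => ?_, fun h => h ▸ fun _ _ => rfl⟩
          rcases le_or_gt j q.length with hj | hj
          · exact h j hj
          · rw [List.getElem?_eq_none_iff] at hw
            rw [List.getElem?_eq_none (l := w) (by omega),
              List.getElem?_eq_none (by simpa using hj)]
        rw [this]
        rfl
      · have : decide (w = true :: q) = false := by
          rw [decide_eq_false_iff_not]
          rintro rfl
          simp at hw
        rw [hbit, this, Bool.or_false]
        rfl
  set cells'' := Function.update cells' (q.length + 1) .blank with hcells''
  have h4 := queryMachine.iterate_step_left (fun _ => QState.back bit)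
    (fun _ _ => (cmpWord q s).2) cells'' 0 (q.length + 1) cells'' (by
      intro i _ hi
      exact ⟨rfl, fun _ => .keep, rfl, rfl⟩)
  simp only [ite_self] at h4
  have h5 : queryMachine.step^[2] ⟨QState.back bit, 0, cells'', fun _ => (cmpWord q s).2⟩ =
      ⟨QState.acc, 1, Function.update cells'' 0 (.output (some bit, some bit)),
        fun _ => (cmpWord q s).2⟩ := rfl
  refine queryMachine.cycle_of_iterate (queryMachine.iterate_step_trans
    (queryMachine.iterate_step_trans (queryMachine.iterate_step_trans
    (queryMachine.iterate_step_trans h1 h2) h3) h4) h5) rfl (by omega) ?_ rfl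
  rw [StackLearner.outputs_iff]
  intro i hi
  simp only [m, max_self, List.length_cons] at hi
  rcases i with _ | i
  · simp only [m, padLetter, List.getElem?_cons_zero, Function.update_self]
    rfl
  · dsimp only
    rw [Function.update_of_ne (by omega)]
    rcases Nat.lt_or_eq_of_le hi with hi | hi
    · rw [hcells'', Function.update_of_ne (by omega)]
      simp only [hcells', if_pos hi, m, List.getElem?_cons_succ]
      rw [List.getElem?_eq_getElem (by omega)]
      rfl
    · rw [Nat.succ.inj hi]
      simp [hcells'', m, padLetter]

theorem queryMachine_cycle (m : List Bool) (s : List (Option Bool)) (w : List Bool) (t : ℕ)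
    (ht : 6 * (max w.length m.length + 1) ≤ t) :
    queryMachine.Cycle t w m (fun _ => s) (queryCycle m s w).1 (queryConj (queryCycle m s w).1)
      (fun _ => (queryCycle m s w).2) := by
  rcases m with _ | ⟨b, q⟩
  · rcases w with _ | ⟨_ | _, p⟩ <;> simp only [List.length_cons, List.length_nil] at ht
    · exact queryMachine_cycle_nil s t (by omega)
    · exact queryMachine_cycle_query p s t (by omega)
    · exact queryMachine_cycle_fact p s t (by omega)
  · simp only [List.length_cons] at ht
    exact queryMachine_cycle_compare b q s w t (by omega)

/-- Memory and stack of the machine for the query languages at the beginning of cycle `n`. -/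
def queryRun (T : ℕ → List Bool) : ℕ → List Bool × List (Option Bool)
  | 0 => ([], [])
  | n + 1 => queryCycle (queryRun T n).1 (queryRun T n).2 (T n)

theorem length_queryCycle (m : List Bool) (s : List (Option Bool)) (w : List Bool) :
    (queryCycle m s w).1.length ≤ max w.length m.length := by
  rcases m with _ | ⟨b, q⟩
  · rcases w with _ | ⟨_ | _, p⟩ <;> simp [queryCycle]
  · simp [queryCycle]

theorem length_queryRun (T : ℕ → List Bool) (n : ℕ) :
    (queryRun T (n + 1)).1.length ≤ StackLearner.longest T n := by
  induction n with
  | zero => exact (length_queryCycle _ _ _).trans (by simp [queryRun, StackLearner.longest])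
  | succ n ih =>
    refine (length_queryCycle _ _ _).trans ?_
    rw [StackLearner.longest_succ]
    omega

theorem queryMachine_isLinearRun (T : ℕ → List Bool) :
    queryMachine.IsLinearRun 6 T (fun n => (queryRun T n).1) (fun n _ => (queryRun T n).2)
      (fun n => queryConj (queryRun T (n + 1)).1) := by
  refine ⟨rfl, fun _ => rfl, fun n => ⟨?_, ?_, ?_⟩⟩
  · refine queryMachine_cycle _ _ _ _ ?_
    rw [length_conv]
  · exact (length_queryRun T n).trans (by omega)
  · have := length_queryRun T n
    dsimp only
    unfold queryConj
    split_ifs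
    · simp only [List.length_singleton]; omega
    · omega

/-! ### Correctness of the learner with one stack. -/

/-- The stack that stores a list of facts. -/
def factStack (ps : List (List Bool)) : List (Option Bool) :=
  (ps.map fun p => none :: p.map some).flatten

theorem topEnds_factStack (ps : List (List Bool)) : topEnds (factStack ps).head? = true := by
  rcases ps with _ | ⟨p, ps⟩ <;> rfl

theorem foldl_cmpStep (q p : List Bool) (ok : Bool) (s : List (Option Bool))
    (h : p.length = q.length) :
    q.foldl cmpStep (ok, p.map some ++ s) = (ok && decide (p = q), s) := by
  induction q generalizing p ok with
  | nil =>
    obtain rfl := List.length_eq_zero_iff.1 h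
    simp
  | cons u q ih =>
    rcases p with _ | ⟨v, p⟩
    · simp at h
    · have : cmpStep (ok, (v :: p).map some ++ s) u = (ok && decide (v = u), p.map some ++ s) := rfl
      rw [List.foldl_cons, this, ih _ _ (by simpa using h), Bool.and_assoc]
      simp

theorem cmpWord_factStack (q p : List Bool) (ps : List (List Bool)) (h : p.length = q.length) :
    cmpWord q (factStack (p :: ps)) = (decide (p = q), factStack ps) := by
  have : factStack (p :: ps) = none :: (p.map some ++ factStack ps) := rfl
  rw [cmpWord, this]
  simp [foldl_cmpStep q p true (factStack ps) h]

theorem cmpWord_nil (q : List Bool) : cmpWord q [] = (false, []) := by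
  unfold cmpWord
  simp only [List.head?_nil, List.tail_nil]
  induction q with
  | nil => rfl
  | cons u q ih => exact ih

section

variable (T : ℕ → List Bool) (b : Bool) (q : List Bool)

/-- The facts `ps` are on the stack at the beginning of cycle `n`, before the query was seen. -/
def Storing (n : ℕ) (ps : List (List Bool)) : Prop :=
  queryRun T n = ([], factStack ps) ∧ (∀ i < n, T i ≠ false :: q) ∧
    (∀ p ∈ ps, true :: p ∈ queryLang (b :: q)) ∧ ∀ i < n, ∀ p, T i = true :: p → p ∈ ps

/-- The query was seen before cycle `n`; `bit` tells if the fact `true :: q` was found, and the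
facts `ps` are still on the stack. -/
def Searching (n : ℕ) (bit : Bool) (ps : List (List Bool)) : Prop :=
  queryRun T n = (bit :: q, factStack ps) ∧ (bit = true → true :: q ∈ queryLang (b :: q)) ∧
    (∀ p ∈ ps, true :: p ∈ queryLang (b :: q)) ∧
    ((∃ i < n, T i = true :: q) → bit = true ∨ q ∈ ps)

variable {T b q}

theorem length_of_fact_mem {p : List Bool} (h : true :: p ∈ queryLang (b :: q)) :
    p.length = q.length := ((mem_queryLang_cons b true q p).1 h).1

theorem Storing.succ (hT : IsText T (queryLang (b :: q))) {n : ℕ} {ps : List (List Bool)}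
    (h : Storing T b q n ps) (hn : T n ≠ false :: q) : ∃ ps', Storing T b q (n + 1) ps' := by
  obtain ⟨h1, h2, h3, h4⟩ := h
  have hTn := (hT (T n)).2 ⟨n, rfl⟩
  obtain ⟨p, hp, -⟩ := hTn.resolve_left hn
  refine ⟨p :: ps, ?_, ?_, ?_, ?_⟩
  · rw [queryRun, h1, hp]
    rfl
  · intro i hi
    rcases Nat.lt_succ_iff_lt_or_eq.1 hi with hi | rfl
    · exact h2 i hi
    · exact hn
  · intro p' hp'
    rcases List.mem_cons.1 hp' with rfl | hp'
    · rw [hp] at hTn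
      exact hTn
    · exact h3 _ hp'
  · intro i hi p' hp'
    rcases Nat.lt_succ_iff_lt_or_eq.1 hi with hi | rfl
    · exact List.mem_cons_of_mem _ (h4 i hi p' hp')
    · rw [hp] at hp'
      simp only [List.cons.injEq, true_and] at hp'
      simp [hp']

theorem Storing.searching {n : ℕ} {ps : List (List Bool)}
    (h : Storing T b q n ps) (hn : T n = false :: q) : Searching T b q (n + 1) false ps := by
  obtain ⟨h1, h2, h3, h4⟩ := h
  refine ⟨?_, fun h => by simp at h, h3, ?_⟩
  · rw [queryRun, h1, hn]
    rfl
  · rintro ⟨i, hi, hi'⟩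
    rcases Nat.lt_succ_iff_lt_or_eq.1 hi with hi | rfl
    · exact Or.inr (h4 i hi q hi')
    · rw [hn] at hi'
      simp at hi'

/-- All facts in the text have the length of `q`, so a comparison removes exactly one block, and a
fact arriving as datum is compared at once and need not be stored. -/
theorem Searching.succ (hT : IsText T (queryLang (b :: q))) {n : ℕ} {bit : Bool}
    {ps : List (List Bool)} (h : Searching T b q n bit ps) :
    ∃ bit', (bit = true → bit' = true) ∧ Searching T b q (n + 1) bit' ps.tail := by
  obtain ⟨h1, h2, h3, h4⟩ := h
  have hTn := (hT (T n)).2 ⟨n, rfl⟩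
  have hcmp : cmpWord q (factStack ps) =
      (decide (ps.head? = some q), factStack ps.tail) := by
    rcases ps with _ | ⟨p, ps⟩
    · exact cmpWord_nil q
    · rw [cmpWord_factStack q p ps (length_of_fact_mem (h3 p (by simp)))]
      simp
  refine ⟨bit || decide (T n = true :: q) || decide (ps.head? = some q), by simp +contextual,
    ?_, ?_, ?_, ?_⟩
  · rw [queryRun, h1, queryCycle]
    simp only [hcmp, topEnds_factStack, Bool.and_true]
  · intro h
    simp only [Bool.or_eq_true, decide_eq_true_eq] at h
    rcases h with (h | h) | h
    · exact h2 h
    · rwa [h] at hTn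
    · exact h3 q (List.mem_of_head? h)
  · exact fun p hp => h3 p (List.mem_of_mem_tail hp)
  · rintro ⟨i, hi, hi'⟩
    rcases Nat.lt_succ_iff_lt_or_eq.1 hi with hi | rfl
    · rcases h4 ⟨i, hi, hi'⟩ with h | h
      · left; simp [h]
      · rcases ps with _ | ⟨p, ps⟩
        · simp at h
        · rcases List.mem_cons.1 h with rfl | h
          · left; simp
          · exact Or.inr h
    · left; simp [hi']

theorem Searching.add (hT : IsText T (queryLang (b :: q))) {n : ℕ} {bit : Bool}
    {ps : List (List Bool)} (h : Searching T b q n bit ps) (k : ℕ) :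
    ∃ bit', (bit = true → bit' = true) ∧ Searching T b q (n + k) bit' (ps.drop k) := by
  induction k with
  | zero => exact ⟨bit, id, h⟩
  | succ k ih =>
    obtain ⟨bit', h1, h2⟩ := ih
    obtain ⟨bit'', h3, h4⟩ := h2.succ hT
    refine ⟨bit'', fun h => h3 (h1 h), ?_⟩
    rwa [List.tail_drop] at h4

theorem exists_searching (hT : IsText T (queryLang (b :: q))) :
    ∃ n bit ps, Searching T b q n bit ps := by
  by_contra! hcon
  obtain ⟨n, hn⟩ := (hT (false :: q)).1 (Or.inl rfl)
  have : ∀ n, ∃ ps, Storing T b q n ps := by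
    intro n
    induction n with
    | zero => exact ⟨[], rfl, by simp, by simp, by simp⟩
    | succ n ih =>
      obtain ⟨ps, h⟩ := ih
      by_cases hn : T n = false :: q
      · exact absurd (h.searching hn) (hcon _ _ _)
      · exact h.succ hT hn
  obtain ⟨ps, h⟩ := this n
  exact hcon _ _ _ (h.searching hn)

theorem exists_searching_final (hT : IsText T (queryLang (b :: q))) :
    ∃ n, ∀ k, n ≤ k → (queryRun T k).1 = b :: q := by
  obtain ⟨n, bit, ps, h⟩ := exists_searching hT
  have hmem : true :: q ∈ queryLang (b :: q) ↔ b = true := by simp [mem_queryLang_cons]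
  rcases b with _ | _
  · refine ⟨n, fun k hk => ?_⟩
    obtain ⟨d, rfl⟩ := Nat.exists_eq_add_of_le hk
    obtain ⟨bit', -, h1, h2, -⟩ := h.add hT d
    have : bit' = false := by
      rcases bit' with _ | _
      · rfl
      · simpa using hmem.1 (h2 rfl)
    rw [h1, this]
  · obtain ⟨n₂, hn₂⟩ := (hT _).1 (hmem.2 rfl)
    -- Once the stack is empty and the fact about `q` has been presented, the invariant leaves no
    -- alternative to `bit = true`.
    have hfin : ∀ d, ps.length ≤ d → n₂ < n + d → ∃ ps', Searching T true q (n + d) true ps' := by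
      intro d hd hn
      obtain ⟨bit', -, h1⟩ := h.add hT d
      rw [List.drop_eq_nil_of_le hd] at h1
      rcases h1.2.2.2 ⟨n₂, hn, hn₂⟩ with rfl | h2
      · exact ⟨_, h1⟩
      · simp at h2
    refine ⟨n + (ps.length + n₂ + 1), fun k hk => ?_⟩
    obtain ⟨d, rfl⟩ := Nat.exists_eq_add_of_le hk
    obtain ⟨ps', h1, -⟩ := hfin (ps.length + n₂ + 1 + d) (by omega) (by omega)
    rw [add_assoc, h1]

end

theorem queryMachine_learns : queryMachine.LearnsInLinearTime queryFamily queryFamily.languages := by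
  refine ⟨6, fun T => ⟨_, _, _, queryMachine_isLinearRun T, ?_⟩⟩
  rintro _ ⟨e, he, rfl⟩ hT
  rcases e with _ | ⟨b, q⟩
  · exact absurd rfl he
  refine ⟨fun n => ?_, b :: q, he, rfl, ?_⟩
  · change queryConj _ ≠ []
    unfold queryConj
    split_ifs with h
    · simp
    · exact h
  · obtain ⟨n, hn⟩ := exists_searching_final hT
    exact ⟨n, fun k hk => by
      dsimp only
      rw [hn (k + 1) (by omega)]
      rfl⟩

/-! ### Words as numbers -/

section Digits

variable (A : Type)

/-- The base of the numeration by words: the letters and the padding symbol are the digits. -/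
noncomputable def base : ℕ := Nat.card A + 1

theorem base_pos : 0 < base A := Nat.succ_pos _

theorem base_pow_pos (n : ℕ) : 0 < base A ^ n := Nat.pow_pos (base_pos A)

variable {A} [Finite A]

/-- The value of a digit; the padding symbol has value `0`. -/
noncomputable def digitVal : Option A → ℕ
  | none => 0
  | some a => (Finite.equivFin A a : ℕ) + 1

open Classical in
/-- The digit with a given value. -/
noncomputable def digitOf : ℕ → Option A
  | 0 => none
  | n + 1 => if h : n < Nat.card A then some ((Finite.equivFin A).symm ⟨n, h⟩) else none

theorem digitVal_lt (d : Option A) : digitVal d < base A := by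
  rcases d with _ | a
  · exact base_pos A
  · exact Nat.succ_lt_succ (Finite.equivFin A a).2

theorem digitOf_digitVal (d : Option A) : digitOf (digitVal d) = d := by
  rcases d with _ | a <;> simp [digitOf, digitVal]

theorem digitVal_digitOf {n : ℕ} (h : n < base A) : digitVal (digitOf n : Option A) = n := by
  rcases n with _ | n
  · rfl
  · have h : n < Nat.card A := Nat.lt_of_succ_lt_succ h
    simp [digitOf, digitVal, h]

variable (A) in
/-- The digit of `n` at position `i`, where position `0` is the least significant one. -/
noncomputable def digitAt (n i : ℕ) : Option A := digitOf (n / base A ^ i % base A)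

/-- The cyclic successor of a digit. -/
noncomputable def nextDigit (d : Option A) : Option A := digitOf ((digitVal d + 1) % base A)

theorem digitVal_digitAt (n i : ℕ) : digitVal (digitAt A n i) = n / base A ^ i % base A :=
  digitVal_digitOf (Nat.mod_lt _ (base_pos A))

theorem digitAt_zero (i : ℕ) : digitAt A 0 i = none := by simp [digitAt, digitOf]

/-- The divisibility condition is the carry into position `i`. As the least significant digit stands
first, counting takes one sweep to the right. -/
theorem digitAt_succ (n i : ℕ) : digitAt A (n + 1) i =
    if base A ^ i ∣ n + 1 then nextDigit (digitAt A n i) else digitAt A n i := by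
  rw [nextDigit, digitVal_digitAt, digitAt, Nat.succ_div]
  split_ifs
  · rw [Nat.mod_add_mod]
  · rfl

/-- The carry leaves position `i` exactly if it arrives there and meets the largest digit; a finite
control can follow this. -/
theorem pow_succ_dvd_iff (n i : ℕ) : base A ^ (i + 1) ∣ n + 1 ↔
    base A ^ i ∣ n + 1 ∧ digitVal (digitAt A n i) + 1 = base A := by
  rw [digitVal_digitAt]
  have hb := base_pos A
  by_cases h : base A ^ i ∣ n + 1
  · obtain ⟨k, hk⟩ := id h
    have h1 : n / base A ^ i + 1 = k := by
      have := Nat.succ_div (a := n) (b := base A ^ i)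
      rw [if_pos h, hk, Nat.mul_div_cancel_left _ (base_pow_pos A i)] at this
      exact this.symm
    rw [hk, pow_succ, Nat.mul_dvd_mul_iff_left (base_pow_pos A i), ← h1]
    simp only [dvd_mul_right, true_and]
    rw [Nat.dvd_iff_mod_eq_zero, ← Nat.mod_add_mod]
    have h2 := Nat.mod_lt (n / base A ^ i) hb
    constructor
    · intro h3
      by_contra h4
      rw [Nat.mod_eq_of_lt (by omega)] at h3
      omega
    · intro h3
      rw [h3, Nat.mod_self]
  · simp only [h, false_and, iff_false]
    exact fun h' => h ((pow_dvd_pow _ (Nat.le_succ i)).trans h')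

theorem digitAt_mod {n N i : ℕ} (hi : i < N) : digitAt A (n % base A ^ N) i = digitAt A n i := by
  unfold digitAt
  congr 1
  obtain ⟨k, rfl⟩ := Nat.exists_eq_add_of_le (Nat.succ_le_of_lt hi)
  rw [show i.succ + k = i + (k + 1) by omega, pow_add, Nat.mod_mul_right_div_self,
    pow_succ, Nat.mod_mul_left_mod]

theorem digitAt_eq_none {n N i : ℕ} (hn : n < base A ^ N) (hi : N ≤ i) : digitAt A n i = none := by
  unfold digitAt
  rw [Nat.div_eq_of_lt (hn.trans_le (Nat.pow_le_pow_right (base_pos A) hi))]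
  simp [digitOf]

theorem lt_pow_of_digitAt {n N l : ℕ} (hn : n < base A ^ N)
    (h : ∀ i, l ≤ i → digitAt A n i = none) : n < base A ^ l := by
  induction N with
  | zero => exact hn.trans_le (Nat.pow_le_pow_right (base_pos A) (Nat.zero_le _))
  | succ N ih =>
    rcases le_or_gt (N + 1) l with hl | hl
    · exact hn.trans_le (Nat.pow_le_pow_right (base_pos A) hl)
    · apply ih
      have h1 := h N (by omega)
      have h2 := congrArg digitVal h1
      rw [digitVal_digitAt, Nat.mod_eq_of_lt] at h2
      · exact (Nat.div_eq_zero_iff_lt (base_pow_pos A N)).1 h2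
      · rw [pow_succ] at hn
        exact Nat.div_lt_of_lt_mul hn

theorem digitAt_inj {m n N : ℕ} (hm : m < base A ^ N) (hn : n < base A ^ N)
    (h : ∀ i, digitAt A m i = digitAt A n i) : m = n := by
  induction N generalizing m n with
  | zero => simp at hm hn; omega
  | succ N ih =>
    have hb := base_pos A
    have e0 : m % base A = n % base A := by
      have := congrArg digitVal (h 0)
      simpa [digitVal_digitAt] using this
    have e1 : m / base A = n / base A := by
      rw [pow_succ, mul_comm] at hm hn
      refine ih (Nat.div_lt_of_lt_mul hm) (Nat.div_lt_of_lt_mul hn) fun i => ?_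
      have := h (i + 1)
      unfold digitAt at this ⊢
      rw [Nat.div_div_eq_div_mul, Nat.div_div_eq_div_mul, mul_comm, ← pow_succ]
      exact this
    rw [← Nat.div_add_mod m (base A), ← Nat.div_add_mod n (base A), e0, e1]

/-- The number whose digits are the letters of a word. -/
noncomputable def wordCode : List A → ℕ
  | [] => 0
  | a :: l => digitVal (some a) + base A * wordCode l

theorem wordCode_lt (l : List A) : wordCode l < base A ^ l.length := by
  induction l with
  | nil => simp [wordCode]
  | cons a l ih =>
    have h := digitVal_lt (some a)
    rw [wordCode, List.length_cons, pow_succ, mul_comm (base A ^ _)]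
    calc _ < base A + base A * wordCode l := by omega
      _ = base A * (wordCode l + 1) := by ring
      _ ≤ _ := Nat.mul_le_mul_left _ ih

theorem digitAt_wordCode (l : List A) (i : ℕ) : digitAt A (wordCode l) i = l[i]? := by
  induction l generalizing i with
  | nil => simp [wordCode, digitAt_zero]
  | cons a l ih =>
    have h := digitVal_lt (some a)
    rcases i with _ | i
    · simp [digitAt, wordCode, Nat.mod_eq_of_lt h, digitOf_digitVal]
    · rw [List.getElem?_cons_succ, ← ih, digitAt, digitAt, wordCode, pow_succ,
        mul_comm (base A ^ i), ← Nat.div_div_eq_div_mul, Nat.add_mul_div_left _ _ (base_pos A),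
        Nat.div_eq_of_lt h, zero_add]

theorem length_le_of_digitAt {l : List A} {n N : ℕ} (hn : n < base A ^ N)
    (h : ∀ i, digitAt A n i = l[i]?) : l.length ≤ N := by
  have := h N
  rw [digitAt_eq_none hn le_rfl] at this
  exact List.getElem?_eq_none_iff.1 this.symm

open Classical in
variable (A) in
/-- The word with the digits of `n` as letters, if there is one. -/
noncomputable def wordOf (n : ℕ) : List A :=
  if h : ∃ l : List A, ∀ i, digitAt A n i = l[i]? then h.choose else []

theorem wordOf_eq {l : List A} {n : ℕ} (h : ∀ i, digitAt A n i = l[i]?) : wordOf A n = l := by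
  have hex : ∃ l : List A, ∀ i, digitAt A n i = l[i]? := ⟨l, h⟩
  rw [wordOf, dif_pos hex]
  exact List.ext_getElem? fun i => by rw [← hex.choose_spec, h]

end Digits

/-! ### A machine with two stacks that searches for a consistent index -/

/-- The parameters of the search: automata for the graph and for the indices, the constant of the
tell-tale sets, and the number of cells that exceed the longest datum. -/
structure ScanData (A B : Type) where
  Q₁ : Type
  Q₃ : Type
  finite₁ : Finite Q₁
  finite₃ : Finite Q₃
  graphDFA : DFA (Option B × Option A) Q₁
  indexDFA : DFA B Q₃
  tail : ℕ
  slack : ℕ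
  hyp₀ : List B

/-- A number that is counted up to the bound `n` only. -/
def sat (n k : ℕ) : Fin (n + 1) := ⟨min n k, by omega⟩

theorem sat_val_add_one (n k : ℕ) : sat n ((sat n k : ℕ) + 1) = sat n (k + 1) := by
  simp only [sat, Fin.mk.injEq]
  omega

/-- What is to be done with the current candidate after an inspection of the stored data. -/
inductive Decision
  | keep
  | advance
  | failNext
  | failWrap
  | pass

instance : Finite Decision :=
  Finite.of_injective (β := Fin 5)
    (fun | .keep => 0 | .advance => 1 | .failNext => 2 | .failWrap => 3 | .pass => 4)
    (by rintro (_ | _ | _ | _ | _) (_ | _ | _ | _ | _) h <;> simp_all)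

/-- The decision at the end of a pass over the stored data. The test word is too long if `long`
is true, an element of the language if `elt` is true, and the last one if `last` is true; the
candidate has reached the limit if `atLimit` is true. -/
def decision (bad found idx long elt last atLimit : Bool) : Decision :=
  if bad || !idx || (!long && elt && !found) then
    if atLimit then .failWrap else .failNext
  else if long || last then .pass else .advance

/-- The new digit of the test word. -/
def Decision.test {α : Type} (d : Decision) (x x' z : α) : α :=
  match d with
  | .keep => x
  | .advance => x'
  | _ => z

/-- The new digit of the candidate. -/
def Decision.cand {α : Type} (d : Decision) (a a' z : α) : α :=
  match d with
  | .keep => a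
  | .advance => a
  | .failNext => a'
  | _ => z

/-- The new digit of the limit. -/
def Decision.limit {α : Type} (d : Decision) (r r' : α) : α :=
  match d with
  | .failWrap => r'
  | _ => r

/-- The new letter of the conjecture. -/
def Decision.hyp {α : Type} (d : Decision) (a h : α) : α :=
  match d with
  | .pass => a
  | _ => h

/-- The letters of the memory: direction, flags `found` and `bad`, and digits of the test word, the
candidate, the limit and the conjecture. -/
abbrev MemLetter (A B : Type) :=
  (Bool × Bool × Bool) × Option A × Option B × Option B × Option B

/-- The work symbols: letters of the datum and of the stored word under inspection, digits of the
test word, the candidate and the limit together with those of their successors, and a letter of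
the conjecture. -/
abbrev WorkLetter (A B : Type) :=
  (Option A × Option A) × (Option A × Option A) × (Option B × Option B) × (Option B × Option B) ×
    Option B

section

variable {A B : Type} (D : ScanData A B)

/-- The finite control during the first sweep. -/
structure ScanCtrl where
  emp : Bool
  ended : Bool
  eq : Bool
  p₁ : Option (D.Q₁ × Bool)
  p₂ : Option (D.Q₁ × Bool)
  p₃ : Option (D.Q₃ × Bool)
  carryX : Bool
  carryA : Bool
  carryR : Bool
  atLimit : Bool
  long : Bool
  ends : Fin (D.tail + 1)
  cnt : Fin (D.slack + 1)

instance : Finite (ScanCtrl D) :=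
  have := D.finite₁
  have := D.finite₃
  Finite.of_injective
    (fun s : ScanCtrl D => (s.emp, s.ended, s.eq, s.p₁, s.p₂, s.p₃, s.carryX, s.carryA, s.carryR,
      s.atLimit, s.long, s.ends, s.cnt))
    (by rintro ⟨⟩ ⟨⟩ h; simpa using h)

/-- The states of the machine. -/
inductive ScanQ
  | start
  | peek
  | load (f : Bool × Bool × Bool)
  | scan (f : Bool × Bool × Bool) (s : ScanCtrl D)
  | put (o : Bool) (d : Decision) (f : Bool × Bool × Bool)
  | go (o : Bool) (d : Decision) (f : Bool × Bool × Bool)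
  | ret (o : Bool) (d : Decision) (f : Bool × Bool × Bool)
  | acc

instance : Finite (ScanQ D) :=
  Finite.of_injective
    (β := Option ((Fin 5 × Bool × Decision × (Bool × Bool × Bool)) ⊕
      ((Bool × Bool × Bool) × ScanCtrl D)))
    (fun
      | .start => some (.inl (0, false, .keep, false, false, false))
      | .peek => some (.inl (0, true, .keep, false, false, false))
      | .load f => some (.inl (1, false, .keep, f))
      | .scan f s => some (.inr (f, s))
      | .put o d f => some (.inl (2, o, d, f))
      | .go o d f => some (.inl (3, o, d, f))
      | .ret o d f => some (.inl (4, o, d, f))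
      | .acc => none)
    (by rintro (_ | _ | _ | _ | _ | _ | _ | _) (_ | _ | _ | _ | _ | _ | _ | _) h <;> simp_all)

/-- The stack that is selected by the direction. -/
def stackIdx (b : Bool) : Fin 2 := if b then 1 else 0

/-- An operation on one of the two stacks. -/
def opAt {S : Type} (b : Bool) (op : StackOp S) : Fin 2 → StackOp S :=
  fun j => if j = stackIdx b then op else .keep

/-- The pair of stacks with `l` in the selected direction and `l'` on the other stack. -/
def twoStacks {S : Type} (b : Bool) (l l' : List S) : Fin 2 → List S :=
  fun j => if j = stackIdx b then l else l'

/-- The letters of datum and memory in a cell. -/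
def cellView {A B C W : Type} : Cell A B C W → Option A × Option C
  | .input p => p
  | _ => (none, none)

/-- Is the cell blank? -/
def cellBlank {A B C W : Type} : Cell A B C W → Bool
  | .blank => true
  | _ => false

/-- The flags in a memory letter. -/
def memFlags (m : Option (MemLetter A B)) : Bool × Bool × Bool := m.elim (false, false, false) (·.1)

/-- The digit of the test word. -/
def memTest (m : Option (MemLetter A B)) : Option A := m.elim none (·.2.1)

/-- The digit of the candidate. -/
def memCand (m : Option (MemLetter A B)) : Option B := m.elim none (·.2.2.1)

/-- The digit of the limit. -/
def memLimit (m : Option (MemLetter A B)) : Option B := m.elim none (·.2.2.2.1)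

/-- The letter of the conjecture. -/
def memHyp (m : Option (MemLetter A B)) : Option B := m.elim none (·.2.2.2.2)

variable [Finite A] [Finite B]

open Classical in
/-- The control after reading letters of the datum, of the stored word, of the test word, of the
candidate, and of the limit. -/
noncomputable def ScanCtrl.next {D : ScanData A B} (s : ScanCtrl D) (w y x : Option A)
    (a r : Option B) : ScanCtrl D where
  emp := s.emp
  ended := s.ended || y.isNone
  eq := s.eq && decide (x = y)
  p₁ := (padDFA D.graphDFA).step s.p₁ (padLetter (a, y))
  p₂ := (padDFA D.graphDFA).step s.p₂ (padLetter (a, x))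
  p₃ := (padDFA D.indexDFA).step s.p₃ a
  carryX := s.carryX && decide (digitVal x + 1 = base A)
  carryA := s.carryA && decide (digitVal a + 1 = base B)
  carryR := s.carryR && decide (digitVal r + 1 = base B)
  atLimit := s.atLimit && decide (a = r)
  long := s.long || (a.isNone && x.isSome && decide (D.tail ≤ (s.ends : ℕ)))
  ends := if a.isNone then sat D.tail ((s.ends : ℕ) + 1) else s.ends
  cnt := if w.isSome then s.cnt else sat D.slack ((s.cnt : ℕ) + 1)

open Classical in
/-- The decision and the new flags at the end of the first sweep. -/
noncomputable def ScanCtrl.outcome {D : ScanData A B} (s : ScanCtrl D) (f : Bool × Bool × Bool) :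
    Decision × (Bool × Bool × Bool) :=
  if s.emp then
    (decision f.2.2 f.2.1 (decide (s.p₃ ∈ (padDFA D.indexDFA).accept)) s.long
      (decide (s.p₂ ∈ (padDFA D.graphDFA).accept)) s.carryX s.atLimit, (!f.1, false, false))
  else
    (.keep, (f.1, f.2.1 || s.eq, f.2.2 || !decide (s.p₁ ∈ (padDFA D.graphDFA).accept)))

open Classical in
/-- The transition function. -/
noncomputable def scanδ (q : ScanQ D)
    (c : Option (Cell A B (MemLetter A B) (WorkLetter A B))) (t : Fin 2 → Option (Option A)) :
    ScanQ D × Cell A B (MemLetter A B) (WorkLetter A B) × Move × (Fin 2 → StackOp (Option A)) :=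
  match q, c with
  | .start, _ => (.peek, .blank, .right, fun _ => .keep)
  | .peek, some c => (.load (memFlags (cellView c).2), c, .left, fun _ => .keep)
  | .load f, _ =>
    let e := (t (stackIdx f.1)).isNone
    (.scan f ⟨e, e, true, (padDFA D.graphDFA).start, (padDFA D.graphDFA).start,
      (padDFA D.indexDFA).start, true, true, true, true, false, sat _ 0, sat _ 0⟩, .blank, .right,
      fun _ => .keep)
  | .scan f s, some c =>
    if cellBlank c = true ∧ (s.cnt : ℕ) = D.slack then
      (.put (!f.1) (s.outcome f).1 (s.outcome f).2, c, .left,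
        opAt (!f.1) (if s.emp then .keep else .push none))
    else
      let w := (cellView c).1
      let m := (cellView c).2
      let x := memTest m
      let a := memCand m
      let r := memLimit m
      let y := if s.ended then none else (t (stackIdx f.1)).join
      (.scan f (s.next w y x a r),
        .work ((w, y), (x, if s.carryX then nextDigit x else x),
          (a, if s.carryA then nextDigit a else a), (r, if s.carryR then nextDigit r else r),
          memHyp m), .right,
        opAt f.1 (if s.ended then .keep else .pop))
  | .put o d f, some (.work l) =>
    (.put o d f, .work l, .left, opAt o (l.1.2.elim .keep fun y => .push (some y)))
  | .put o d f, _ => (.go o d f, .blank, .right, fun _ => .keep)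
  | .go o d f, some (.work l) => (.go o d f, .work l, .right, fun _ => .keep)
  | .go o d f, _ => (.ret o d f, .blank, .left, opAt o (.push none))
  | .ret o d f, some (.work ((w, _), (x, x'), (a, a'), (r, r'), h)) =>
    (.ret o d f, .output (some (f, d.test x x' none, d.cand a a' none, d.limit r r', d.hyp a h),
      d.hyp a h), .left, opAt o (w.elim .keep fun w => .push (some w)))
  | _, _ => (.acc, .blank, .stay, fun _ => .keep)

/-- The machine. -/
noncomputable abbrev scanMachine : StackLearner A B 2 where
  C := MemLetter A B
  W := WorkLetter A B
  S := Option A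
  Q := ScanQ D
  finite_C := inferInstance
  finite_W := inferInstance
  finite_S := inferInstance
  finite_Q := inferInstance
  start := .start
  accept q := match q with
    | .acc => true
    | _ => false
  δ := scanδ D
  initMem := (List.range D.slack).map fun i =>
    ((false, false, false), none, none, none, D.hyp₀[i]?)

/-- The state of the search between cycles: direction, flags, test word, candidate and limit as
numbers, the conjecture, the length of the memory, and the data on the active and on the other
stack. -/
structure ScanState (A B : Type) where
  dir : Bool
  found : Bool
  bad : Bool
  test : ℕ
  cand : ℕ
  limit : ℕ
  hyp : List B
  len : ℕ
  act : List (List A)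
  oth : List (List A)

/-- The letters of a stored word, followed by an end marker. -/
def block {A : Type} (y : List A) : List (Option A) := y.map some ++ [none]

/-- The stack that stores a list of words. -/
def blocks {A : Type} (l : List (List A)) : List (Option A) := (l.map block).flatten

namespace ScanState

/-- The memory that represents a state of the search. -/
noncomputable def memory (s : ScanState A B) : List (MemLetter A B) :=
  (List.range s.len).map fun i => ((s.dir, s.found, s.bad), digitAt A s.test i,
    digitAt B s.cand i, digitAt B s.limit i, s.hyp[i]?)

/-- The stacks that represent a state of the search. -/
def stk (s : ScanState A B) : Fin 2 → List (Option A) :=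
  twoStacks s.dir (blocks s.act) (blocks s.oth)

/-- The memory is long enough for all parts of the state. -/
structure Fits (s : ScanState A B) : Prop where
  len_pos : 1 ≤ s.len
  test_lt : s.test < base A ^ s.len
  cand_lt : s.cand < base B ^ s.len
  limit_lt : s.limit < base B ^ s.len
  hyp_le : s.hyp.length ≤ s.len
  act_lt : ∀ y ∈ s.act, y.length < s.len
  oth_lt : ∀ y ∈ s.oth, y.length < s.len

/-- The initial state. -/
def init : ScanState A B := ⟨false, false, false, 0, 0, 0, D.hyp₀, D.slack, [], []⟩

open Classical in
/-- The decision at the end of a pass; `N` is the new length of the memory. -/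
noncomputable def verdict (s : ScanState A B) (N : ℕ) : Decision :=
  decision s.bad s.found
    (decide (∃ e ∈ D.indexDFA.accepts, ∀ i, digitAt B s.cand i = e[i]?))
    (decide (∃ i, digitAt B s.cand i = none ∧ digitAt A s.test i ≠ none ∧
      D.tail ≤ Nat.count (fun j => digitAt B s.cand j = none) i))
    (decide (∃ e x, conv e x ∈ D.graphDFA.accepts ∧ (∀ i, digitAt B s.cand i = e[i]?) ∧
      ∀ i, digitAt A s.test i = x[i]?))
    (decide (base A ^ N ∣ s.test + 1))
    (decide (∀ i, digitAt B s.cand i = digitAt B s.limit i))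

open Classical in
/-- The state of the search after a cycle with datum `w`. -/
noncomputable def next (s : ScanState A B) (w : List A) : ScanState A B :=
  let N := max s.len (w.length + D.slack)
  match s.act with
  | y :: rest =>
    { s with
      found := s.found || decide (∀ i, digitAt A s.test i = y[i]?)
      bad := s.bad || !decide (∃ e, conv e y ∈ D.graphDFA.accepts ∧
        ∀ i, digitAt B s.cand i = e[i]?)
      len := N
      act := rest
      oth := w :: y :: s.oth }
  | [] =>
    let d := s.verdict D N
    { dir := !s.dir
      found := false
      bad := false
      test := d.test s.test ((s.test + 1) % base A ^ N) 0
      cand := d.cand s.cand ((s.cand + 1) % base B ^ N) 0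
      limit := d.limit s.limit ((s.limit + 1) % base B ^ N)
      hyp := d.hyp (wordOf B s.cand) s.hyp
      len := N
      act := w :: s.oth
      oth := [] }

end ScanState

end

/-! ### Two stacks addressed by a direction. -/

theorem stackIdx_not_ne (b : Bool) : stackIdx (!b) ≠ stackIdx b := by
  rcases b with _ | _ <;> simp [stackIdx]

theorem eq_stackIdx_or (b : Bool) (j : Fin 2) : j = stackIdx b ∨ j = stackIdx (!b) := by
  rcases b with _ | _ <;> simp only [stackIdx, Bool.not_true, Bool.not_false, if_true] <;>
    fin_cases j <;> simp

section

variable {S : Type} (b : Bool) (l l' : List S) (op : StackOp S)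

@[simp]
theorem twoStacks_same : twoStacks b l l' (stackIdx b) = l := if_pos rfl

@[simp]
theorem twoStacks_other : twoStacks b l l' (stackIdx (!b)) = l' := if_neg (stackIdx_not_ne b)

theorem twoStacks_not : twoStacks (!b) l l' = twoStacks b l' l := by
  funext j
  rcases eq_stackIdx_or b j with rfl | rfl
  · have := twoStacks_other (!b) l l'
    rw [Bool.not_not] at this
    rw [this, twoStacks_same]
  · rw [twoStacks_same, twoStacks_other]

theorem opAt_apply_same :
    (fun j => (opAt b op j).apply (twoStacks b l l' j)) = twoStacks b (op.apply l) l' := by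
  funext j
  rcases eq_stackIdx_or b j with rfl | rfl
  · simp [opAt]
  · simp [opAt, stackIdx_not_ne, StackOp.apply]

theorem opAt_apply_other :
    (fun j => (opAt (!b) op j).apply (twoStacks b l l' j)) = twoStacks b l (op.apply l') := by
  rw [← twoStacks_not, opAt_apply_same, twoStacks_not]

end

/-! ### One cycle of the search machine, sweep by sweep. -/

section

variable {A B : Type} [Finite A] [Finite B] (D : ScanData A B)

open Classical in
/-- The control of the first sweep in front of cell `i`. -/
noncomputable def ctrlAt (w : List A) (y : Option (List A)) (x a r : ℕ) (i : ℕ) : ScanCtrl D where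
  emp := y.isNone
  ended := y.isNone || decide ((y.getD []).length < i)
  eq := decide (∀ j < i, digitAt A x j = (y.getD [])[j]?)
  p₁ := (padDFA D.graphDFA).eval ((List.range i).map fun j =>
    padLetter (digitAt B a j, (y.getD [])[j]?))
  p₂ := (padDFA D.graphDFA).eval ((List.range i).map fun j =>
    padLetter (digitAt B a j, digitAt A x j))
  p₃ := (padDFA D.indexDFA).eval ((List.range i).map fun j => digitAt B a j)
  carryX := decide (base A ^ i ∣ x + 1)
  carryA := decide (base B ^ i ∣ a + 1)
  carryR := decide (base B ^ i ∣ r + 1)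
  atLimit := decide (∀ j < i, digitAt B a j = digitAt B r j)
  long := decide (∃ j < i, digitAt B a j = none ∧ digitAt A x j ≠ none ∧
    D.tail ≤ Nat.count (fun j => digitAt B a j = none) j)
  ends := sat D.tail (Nat.count (fun j => digitAt B a j = none) i)
  cnt := sat D.slack (i - w.length)

theorem ctrlAt_zero (w : List A) (y : Option (List A)) (x a r : ℕ) :
    ctrlAt D w y x a r 0 = ⟨y.isNone, y.isNone, true, (padDFA D.graphDFA).start,
      (padDFA D.graphDFA).start, (padDFA D.indexDFA).start, true, true, true, true, false,
      sat _ 0, sat _ 0⟩ := by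
  simp [ctrlAt]

theorem DFA.eval_map_range_succ {α σ : Type} (M : DFA α σ) (f : ℕ → α) (i : ℕ) :
    M.eval ((List.range (i + 1)).map f) = M.step (M.eval ((List.range i).map f)) (f i) := by
  rw [List.range_succ, List.map_append, List.map_singleton, DFA.eval_append_singleton]

/-- Shows that the letterwise update of the finite control maintains the closed description
`ctrlAt`, so that the whole sweep can be evaluated at once. -/
theorem ctrlAt_succ (w : List A) (y : Option (List A)) (x a r i : ℕ) :
    ctrlAt D w y x a r (i + 1) = (ctrlAt D w y x a r i).next w[i]? (y.getD [])[i]?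
      (digitAt A x i) (digitAt B a i) (digitAt B r i) := by
  have hall : ∀ p : ℕ → Prop, (∀ j < i + 1, p j) ↔ (∀ j < i, p j) ∧ p i := fun p =>
    ⟨fun h => ⟨fun j hj => h j (by omega), h i (by omega)⟩, fun h j hj => by
      rcases Nat.lt_succ_iff_lt_or_eq.1 hj with hj | rfl
      exacts [h.1 j hj, h.2]⟩
  have hex : ∀ p : ℕ → Prop, (∃ j < i + 1, p j) ↔ (∃ j < i, p j) ∨ p i := fun p =>
    ⟨fun ⟨j, hj, hp⟩ => by
      rcases Nat.lt_succ_iff_lt_or_eq.1 hj with hj | rfl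
      exacts [Or.inl ⟨j, hj, hp⟩, Or.inr hp], fun h => by
      rcases h with ⟨j, hj, hp⟩ | hp
      exacts [⟨j, by omega, hp⟩, ⟨i, by omega, hp⟩]⟩
  unfold ctrlAt ScanCtrl.next
  simp only [ScanCtrl.mk.injEq, true_and, DFA.eval_map_range_succ]
  refine ⟨?_, ?_, ?_, ?_, ?_, ?_, ?_, ?_, ?_⟩
  · rw [Bool.or_assoc]
    congr 1
    rw [Bool.eq_iff_iff]
    simp only [Bool.or_eq_true, decide_eq_true_eq, Option.isNone_iff_eq_none,
      List.getElem?_eq_none_iff]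
    omega
  · rw [Bool.eq_iff_iff]
    simp only [Bool.and_eq_true, decide_eq_true_eq, hall]
  · rw [← Bool.decide_and, decide_eq_decide, pow_succ_dvd_iff]
  · rw [← Bool.decide_and, decide_eq_decide, pow_succ_dvd_iff]
  · rw [← Bool.decide_and, decide_eq_decide, pow_succ_dvd_iff]
  · rw [Bool.eq_iff_iff]
    simp only [Bool.and_eq_true, decide_eq_true_eq, hall]
  · rw [Bool.eq_iff_iff]
    simp only [decide_eq_true_eq, Bool.or_eq_true, Bool.and_eq_true, Option.isNone_iff_eq_none,
      Option.isSome_iff_ne_none, hex, sat, and_assoc]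
    refine or_congr Iff.rfl (and_congr Iff.rfl (and_congr Iff.rfl ?_))
    exact Iff.trans ⟨fun h => le_min le_rfl h, fun h => h.trans (min_le_right _ _)⟩
      decide_eq_true_iff.symm
  · rw [Nat.count_succ]
    by_cases h : digitAt B a i = none
    · simp [h, sat_val_add_one]
    · have : (digitAt B a i).isNone = false := by
        rcases hd : digitAt B a i with _ | _
        exacts [absurd hd h, rfl]
      simp [h, this]
  · by_cases h : i < w.length
    · have h1 : i + 1 - w.length = 0 := by omega
      have h2 : i - w.length = 0 := by omega
      simp [h, h1, h2]
    · have h1 : i + 1 - w.length = i - w.length + 1 := by omega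
      simp [List.getElem?_eq_none (not_lt.1 h), h1, sat_val_add_one]

/-- The content of the tape after the first sweep. -/
noncomputable def workAt (w : List A) (y : Option (List A)) (x a r : ℕ) (h : List B) (i : ℕ) :
    WorkLetter A B :=
  ((w[i]?, (y.getD [])[i]?), (digitAt A x i, digitAt A (x + 1) i),
    (digitAt B a i, digitAt B (a + 1) i), (digitAt B r i, digitAt B (r + 1) i), h[i]?)

theorem block_drop_of_le {A : Type} {y : List A} {i : ℕ} (h : i ≤ y.length) :
    (block y).drop i = y[i]? :: (block y).drop (i + 1) := by
  have hi : i < (block y).length := by simp [block]; omega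
  rw [List.drop_eq_getElem_cons hi]
  congr 1
  simp only [block]
  rcases Nat.lt_or_eq_of_le h with h | rfl
  · rw [List.getElem_append_left (by simpa using h), List.getElem_map, List.getElem?_eq_getElem h]
  · simp

theorem block_drop_of_lt {A : Type} {y : List A} {i : ℕ} (h : y.length < i) : (block y).drop i = [] :=
  List.drop_eq_nil_of_le (by simp [block]; omega)

theorem memory_getElem? (s : ScanState A B) (i : ℕ) : s.memory[i]? =
    if i < s.len then some ((s.dir, s.found, s.bad), digitAt A s.test i,
      digitAt B s.cand i, digitAt B s.limit i, s.hyp[i]?) else none := by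
  unfold ScanState.memory
  rw [List.getElem?_map]
  split_ifs with h
  · rw [List.getElem?_range h]; rfl
  · rw [List.getElem?_eq_none (by simpa using h)]; rfl

variable {s : ScanState A B}

theorem ScanState.Fits.memTest (hs : s.Fits) (i : ℕ) :
    memTest s.memory[i]? = digitAt A s.test i := by
  rw [memory_getElem?]
  split_ifs with h
  · rfl
  · exact (digitAt_eq_none hs.test_lt (not_lt.1 h)).symm

theorem ScanState.Fits.memCand (hs : s.Fits) (i : ℕ) :
    memCand s.memory[i]? = digitAt B s.cand i := by
  rw [memory_getElem?]
  split_ifs with h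
  · rfl
  · exact (digitAt_eq_none hs.cand_lt (not_lt.1 h)).symm

theorem ScanState.Fits.memLimit (hs : s.Fits) (i : ℕ) :
    memLimit s.memory[i]? = digitAt B s.limit i := by
  rw [memory_getElem?]
  split_ifs with h
  · rfl
  · exact (digitAt_eq_none hs.limit_lt (not_lt.1 h)).symm

theorem ScanState.Fits.memHyp (hs : s.Fits) (i : ℕ) :
    memHyp s.memory[i]? = s.hyp[i]? := by
  rw [memory_getElem?]
  split_ifs with h
  · rfl
  · rw [List.getElem?_eq_none (hs.hyp_le.trans (not_lt.1 h))]; rfl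

theorem cellView_elim {A B C W : Type} (p : Option A × Option C) :
    cellView ((padLetter p).elim (Cell.blank : Cell A B C W) Cell.input) = p := by
  rcases p with ⟨_ | a, _ | b⟩ <;> rfl

theorem cellBlank_elim {A B C W : Type} (p : Option A × Option C) :
    cellBlank ((padLetter p).elim (Cell.blank : Cell A B C W) Cell.input) = true ↔
      p = (none, none) := by
  rcases p with ⟨_ | a, _ | b⟩ <;> simp [padLetter, cellBlank]

/-- One cycle of the machine, in terms of the outcome of the first sweep. -/
theorem scanMachine_cycle_outcome (hs : s.Fits) (w : List A) (y : Option (List A))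
    (rest : List (List A)) (hy : s.act = y.toList ++ rest) (hrest : y = none → rest = [])
    (N : ℕ) (hN : N = max s.len (w.length + D.slack)) (d : Decision) (f : Bool × Bool × Bool)
    (hdf : (ctrlAt D w y s.test s.cand s.limit N).outcome (s.dir, s.found, s.bad) = (d, f))
    (m' : List (MemLetter A B)) (e : List B) (hm' : m' = (List.range N).map fun i =>
      (f, d.test (digitAt A s.test i) (digitAt A (s.test + 1) i) none,
        d.cand (digitAt B s.cand i) (digitAt B (s.cand + 1) i) none,
        d.limit (digitAt B s.limit i) (digitAt B (s.limit + 1) i),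
        d.hyp (digitAt B s.cand i) s.hyp[i]?))
    (he : ∀ i < N, e[i]? = d.hyp (digitAt B s.cand i) s.hyp[i]?) (he' : e.length ≤ N)
    (t : ℕ) (ht : 4 * N + 7 ≤ t) :
    (scanMachine D).Cycle t w s.memory s.stk m' e
      (twoStacks s.dir (blocks rest) (block w ++ ((y.elim [] block) ++ blocks s.oth))) := by
  set M := scanMachine D with hM
  set cells : ℕ → Cell A B (MemLetter A B) (WorkLetter A B) :=
    fun i => (padLetter (w[i]?, s.memory[i]?)).elim .blank .input with hcells
  have hδ : ∀ q c t, M.δ q c t = scanδ D q c t := fun _ _ _ => rfl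
  have hylen : ∀ z, y = some z → z.length < N := by
    rintro z rfl
    have := hs.act_lt z (by rw [hy]; simp)
    omega
  have hview : ∀ i, cellView (cells i) = (w[i]?, s.memory[i]?) := fun i => cellView_elim _
  have hmlen : s.memory.length = s.len := by simp [ScanState.memory]
  have hblank : ∀ i, cellBlank (cells i) = true ↔ w.length ≤ i ∧ s.len ≤ i := fun i => by
    rw [cellBlank_elim]
    simp [hmlen]
  have hNblank : cells N = .blank := by
    have h1 : w[N]? = none := List.getElem?_eq_none (by omega)
    have h2 : s.memory[N]? = none := List.getElem?_eq_none (by omega)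
    simp only [hcells, h1, h2]
    rfl
  set f₀ : Bool × Bool × Bool := (s.dir, s.found, s.bad) with hf₀
  have h0 : M.step^[2] (M.startConfig w s.memory s.stk) = ⟨ScanQ.load f₀, 0, cells, s.stk⟩ := by
    rw [StackLearner.startConfig_eq]
    change M.step ⟨ScanQ.peek, 1, cells, s.stk⟩ = _
    have e1 : memFlags (cellView (cells 0)).2 = f₀ := by
      rw [hview, memory_getElem?, if_pos (show 0 < s.len from hs.len_pos)]
      rfl
    rw [M.step_eq (s' := ScanQ.load f₀) (b := cells 0) (mv := .left) (ops := fun _ => .keep) rfl]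
    · simp only [StackLearner.write, Function.update_eq_self]
      rfl
    · rw [← e1]
      rfl
  -- The sweep to the right pops one symbol of the stored word per cell, the end marker included. It
  -- finishes because stored words are strictly shorter than `N`.
  let stk₁ (i : ℕ) : Fin 2 → List (Option A) := twoStacks s.dir
    ((y.elim [] fun z => (block z).drop i) ++ blocks rest) (blocks s.oth)
  have hstk₁ : stk₁ 0 = s.stk := by
    simp only [stk₁, ScanState.stk]
    rw [hy]
    rcases y with _ | z
    · simp
    · simp [blocks]
  have h1 : M.step^[1] ⟨ScanQ.load f₀, 0, cells, s.stk⟩ =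
      ⟨ScanQ.scan f₀ (ctrlAt D w y s.test s.cand s.limit 0), 1, cells, stk₁ 0⟩ := by
    rw [ctrlAt_zero, Function.iterate_one]
    have e1 : ((s.stk (stackIdx s.dir)).head?).isNone = y.isNone := by
      rw [← hstk₁]
      simp only [stk₁, twoStacks_same]
      rcases y with _ | z
      · rw [hrest rfl]; rfl
      · rcases z with _ | ⟨a, z⟩ <;> rfl
    rw [hstk₁, ← e1]
    rfl
  have h2 := M.iterate_step_right
    (fun i => ScanQ.scan f₀ (ctrlAt D w y s.test s.cand s.limit i)) stk₁
    (fun i => .work (workAt w y s.test s.cand s.limit s.hyp i)) cells N (by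
      intro i hi
      refine ⟨rfl, opAt s.dir (if (ctrlAt D w y s.test s.cand s.limit i).ended then .keep
        else .pop), ?_, ?_⟩
      · have hturn : ¬ (cellBlank (cells i) = true ∧
            ((ctrlAt D w y s.test s.cand s.limit i).cnt : ℕ) = D.slack) := by
          rw [hblank]
          simp only [ctrlAt, sat]
          omega
        have hlet : (if (ctrlAt D w y s.test s.cand s.limit i).ended then none else
            ((stk₁ i (stackIdx s.dir)).head?).join) = (y.getD [])[i]? := by
          simp only [stk₁, twoStacks_same, ctrlAt]
          rcases y with _ | z
          · simp
          · simp only [Option.isNone_some, Option.getD_some, Bool.false_or, Option.elim_some,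
              decide_eq_true_eq]
            split_ifs with h
            · exact (List.getElem?_eq_none h.le).symm
            · rw [block_drop_of_le (not_lt.1 h)]
              rfl
        rw [hδ]
        simp only [scanδ]
        rw [if_neg hturn, hlet, hview]
        dsimp only
        rw [hs.memTest, hs.memCand, hs.memLimit, hs.memHyp, ctrlAt_succ]
        simp only [workAt, digitAt_succ]
        simp [ctrlAt]
        rfl
      · simp only [stk₁]
        rw [opAt_apply_same]
        congr 1
        rcases y with _ | z
        · simp [ctrlAt, StackOp.apply]
        · simp only [Option.elim_some, ctrlAt, Option.isNone_some, Option.getD_some, Bool.false_or,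
            decide_eq_true_eq]
          split_ifs with h
          · rw [block_drop_of_lt h, block_drop_of_lt (h.trans (Nat.lt_succ_self _))]
            rfl
          · rw [block_drop_of_le (not_lt.1 h)]
            rfl)
  set tape : ℕ → Cell A B (MemLetter A B) (WorkLetter A B) := fun i =>
    if i < N then .work (workAt w y s.test s.cand s.limit s.hyp i) else cells i with htape
  have htN : tape N = .blank := by
    rw [htape]
    simp only [lt_irrefl, if_false, hNblank]
  have htw : ∀ i < N, tape i = .work (workAt w y s.test s.cand s.limit s.hyp i) := fun i hi => by
    simp only [htape, if_pos hi]
  have hupd : Function.update tape N .blank = tape := by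
    rw [Function.update_eq_self_iff, htN]
  have hite : (fun i => if i < N then tape i else tape i) = tape := by simp
  -- On the way back the stored word is pushed onto the other stack from its last letter to its
  -- first, above its end marker, and so keeps its orientation.
  let stk₂ (i : ℕ) : Fin 2 → List (Option A) := twoStacks s.dir (blocks rest)
    ((y.elim [] fun z => (z.drop i).map some ++ [none]) ++ blocks s.oth)
  have h3 : M.step^[1] ⟨ScanQ.scan f₀ (ctrlAt D w y s.test s.cand s.limit N), N + 1, tape,
      stk₁ N⟩ = ⟨ScanQ.put (!s.dir) d f, 0 + N, tape, stk₂ (0 + N)⟩ := by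
    rw [Function.iterate_one, M.step_eq (s' := ScanQ.put (!s.dir) d f) (b := tape N) (mv := .left)
      (ops := opAt (!s.dir) (if y.isNone then .keep else .push none)) rfl]
    · simp only [StackLearner.write, Function.update_eq_self, StackLearner.moveHead,
        Nat.add_sub_cancel, zero_add]
      congr 1
      simp only [stk₁, stk₂]
      rw [opAt_apply_other]
      rcases y with _ | z
      · rfl
      · have hz := hylen z rfl
        simp only [Option.elim_some, block_drop_of_lt hz, List.drop_eq_nil_of_le hz.le]
        rfl
    · simp only [StackLearner.scanned]
      rw [hδ]
      simp only [scanδ]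
      rw [if_pos, hdf]
      · rfl
      · rw [htN]
        refine ⟨rfl, ?_⟩
        simp only [ctrlAt, sat]
        omega
  have h4 := M.iterate_step_left (fun _ => ScanQ.put (!s.dir) d f) stk₂ tape 0 N tape (by
    intro i _ hi
    rw [zero_add] at hi
    refine ⟨rfl, opAt (!s.dir) ((y.getD [])[i]?.elim .keep fun y => .push (some y)), ?_, ?_⟩
    · rw [htw i hi]
      rfl
    · simp only [stk₂]
      rw [opAt_apply_other]
      congr 1
      rcases y with _ | z
      · rfl
      · simp only [Option.elim_some, Option.getD_some]
        rcases lt_or_ge i z.length with h | h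
        · rw [List.drop_eq_getElem_cons h, List.getElem?_eq_getElem h]
          rfl
        · rw [List.getElem?_eq_none h, List.drop_eq_nil_of_le h,
            List.drop_eq_nil_of_le (h.trans (Nat.le_succ i))]
          rfl)
  have hite0 : (fun i => if 0 ≤ i ∧ i < 0 + N then tape i else tape i) = tape := by simp
  rw [hite0] at h4
  have h5 : M.step^[1] ⟨ScanQ.put (!s.dir) d f, 0, tape, stk₂ 0⟩ =
      ⟨ScanQ.go (!s.dir) d f, 1, tape, stk₂ 0⟩ := rfl
  have h6 := M.iterate_step_right (fun _ => ScanQ.go (!s.dir) d f) (fun _ => stk₂ 0) tape tape N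
    (fun i hi => ⟨rfl, fun _ => .keep, by rw [htw i hi]; rfl, rfl⟩)
  rw [hite] at h6
  -- A second sweep back puts the new datum on top of it in the same way.
  let stk₃ (i : ℕ) : Fin 2 → List (Option A) := twoStacks s.dir (blocks rest)
    ((w.drop i).map some ++ none :: ((y.elim [] block) ++ blocks s.oth))
  have h7 : M.step^[1] ⟨ScanQ.go (!s.dir) d f, N + 1, tape, stk₂ 0⟩ =
      ⟨ScanQ.ret (!s.dir) d f, 0 + N, tape, stk₃ (0 + N)⟩ := by
    rw [Function.iterate_one, M.step_eq (s' := ScanQ.ret (!s.dir) d f) (b := .blank) (mv := .left)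
      (ops := opAt (!s.dir) (.push none)) rfl]
    · simp only [StackLearner.write, hupd, StackLearner.moveHead, Nat.add_sub_cancel, zero_add]
      congr 1
      simp only [stk₂, stk₃]
      rw [opAt_apply_other, List.drop_eq_nil_of_le (by omega)]
      rfl
    · simp only [StackLearner.scanned, htN]
      rfl
  have h8 := M.iterate_step_left (fun _ => ScanQ.ret (!s.dir) d f) stk₃
    (fun i => .output (m'[i]?, e[i]?)) 0 N tape (by
    intro i _ hi
    rw [zero_add] at hi
    refine ⟨rfl, opAt (!s.dir) (w[i]?.elim .keep fun w => .push (some w)), ?_, ?_⟩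
    · rw [htw i hi, he i hi, hm', List.getElem?_map, List.getElem?_range hi]
      rfl
    · simp only [stk₃]
      rw [opAt_apply_other]
      congr 1
      rcases lt_or_ge i w.length with h | h
      · rw [List.drop_eq_getElem_cons h, List.getElem?_eq_getElem h]
        rfl
      · rw [List.getElem?_eq_none h, List.drop_eq_nil_of_le h,
          List.drop_eq_nil_of_le (h.trans (Nat.le_succ i))]
        rfl)
  set tape' : ℕ → Cell A B (MemLetter A B) (WorkLetter A B) := fun i =>
    if 0 ≤ i ∧ i < 0 + N then .output (m'[i]?, e[i]?) else tape i with htape'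
  have h9 : M.step^[1] ⟨ScanQ.ret (!s.dir) d f, 0, tape', stk₃ 0⟩ =
      ⟨ScanQ.acc, 0, tape', stk₃ 0⟩ := rfl
  have hfin := M.iterate_step_trans (M.iterate_step_trans (M.iterate_step_trans
    (M.iterate_step_trans (M.iterate_step_trans (M.iterate_step_trans (M.iterate_step_trans
    (M.iterate_step_trans (M.iterate_step_trans h0 h1) h2) h3) h4) h5) h6) h7) h8) h9
  -- Four sweeps over `N` cells and seven single steps.
  refine M.cycle_of_iterate hfin rfl (by omega) ?_ ?_
  · rw [StackLearner.outputs_iff]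
    have hm'len : m'.length = N := by rw [hm']; simp
    intro i hi
    dsimp only
    rw [hm'len, max_eq_left he'] at hi
    rcases Nat.lt_or_eq_of_le hi with hi | rfl
    · simp only [htape', Nat.zero_le, zero_add, hi, true_and, if_true]
      rw [padLetter_eq_some (by rw [List.getElem?_eq_getElem (by omega)]; simp)]
      rfl
    · simp only [htape', zero_add, lt_irrefl, and_false, if_false, htN]
      rw [List.getElem?_eq_none hm'len.le, List.getElem?_eq_none he']
      rfl
  · simp only [stk₃, List.drop_zero, block]
    congr 1
    simp

end

/-! ### The machine simulates the abstract search within the resource bounds. -/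

section

variable {A B : Type} [Finite A] [Finite B] (D : ScanData A B)

theorem decision_eq_pass {bad found idx long elt last atLimit : Bool}
    (h : decision bad found idx long elt last atLimit = .pass) : idx = true := by
  unfold decision at h
  split_ifs at h with h1 h2
  · simp only [Bool.or_eq_true, not_or] at h1
    simpa using h1.1.2

variable {D} {s : ScanState A B}

theorem ScanState.exists_of_verdict_eq_pass {N : ℕ} (h : s.verdict D N = .pass) :
    ∃ e ∈ D.indexDFA.accepts, ∀ i, digitAt B s.cand i = e[i]? := by
  classical
  exact of_decide_eq_true (decision_eq_pass h)

theorem forall_lt_digitAt_iff {C : Type} {f g : ℕ → C} {N : ℕ} {z : C} (hf : ∀ i, N ≤ i → f i = z)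
    (hg : ∀ i, N ≤ i → g i = z) : (∀ i < N, f i = g i) ↔ ∀ i, f i = g i := by
  refine ⟨fun h i => ?_, fun h i _ => h i⟩
  rcases lt_or_ge i N with hi | hi
  · exact h i hi
  · rw [hf i hi, hg i hi]

/-- All tracks are padding from `N` on, so what the control has checked on `N` cells holds at all
positions. -/
theorem outcome_none (hconv : ∀ z ∈ D.graphDFA.accepts, ∃ x y, z = conv x y) {w : List A} {N : ℕ}
    (hx : s.test < base A ^ N) (ha : s.cand < base B ^ N) (hr : s.limit < base B ^ N) :
    (ctrlAt D w none s.test s.cand s.limit N).outcome (s.dir, s.found, s.bad) =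
      (s.verdict D N, (!s.dir, false, false)) := by
  have hx' := fun i (hi : N ≤ i) => digitAt_eq_none hx hi
  have ha' := fun i (hi : N ≤ i) => digitAt_eq_none ha hi
  have hr' := fun i (hi : N ≤ i) => digitAt_eq_none hr hi
  unfold ScanCtrl.outcome ScanState.verdict
  rw [if_pos (by rfl)]
  simp only [ctrlAt]
  congr 2
  · exact decide_eq_decide.2 (padDFA_eval_range _ _ _ ha')
  · rw [decide_eq_decide]
    refine exists_congr fun i => ⟨fun h => h.2, fun h => ⟨?_, h⟩⟩
    by_contra hi
    exact h.2.1 (hx' i (not_lt.1 hi))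
  · exact decide_eq_decide.2 (padDFA_conv _ _ _ _ ha' hx' hconv)
  · rw [decide_eq_decide, forall_lt_digitAt_iff ha' hr']

theorem outcome_some (hconv : ∀ z ∈ D.graphDFA.accepts, ∃ x y, z = conv x y) {w y : List A}
    {N : ℕ} (hx : s.test < base A ^ N) (ha : s.cand < base B ^ N) (hy : y.length < N)
    (hact : ∃ rest, s.act = y :: rest) :
    (ctrlAt D w (some y) s.test s.cand s.limit N).outcome (s.dir, s.found, s.bad) =
      (.keep, ((s.next D w).dir, (s.next D w).found, (s.next D w).bad)) := by
  have hx' := fun i (hi : N ≤ i) => digitAt_eq_none hx hi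
  have ha' := fun i (hi : N ≤ i) => digitAt_eq_none ha hi
  have hy' : ∀ i, N ≤ i → y[i]? = none := fun i hi => List.getElem?_eq_none (by omega)
  obtain ⟨rest, hact⟩ := hact
  unfold ScanCtrl.outcome ScanState.next
  rw [if_neg (by simp [ctrlAt])]
  simp only [ctrlAt, hact, Option.getD_some]
  congr 4
  · rw [decide_eq_decide, forall_lt_digitAt_iff hx' hy']
  · refine congrArg Bool.not (decide_eq_decide.2 ((padDFA_conv _ _ _ _ ha' hy' hconv).trans ?_))
    constructor
    · rintro ⟨e, y', h1, h2, h3⟩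
      obtain rfl : y = y' := List.ext_getElem? h3
      exact ⟨e, h1, h2⟩
    · rintro ⟨e, h1, h2⟩
      exact ⟨e, y, h1, h2, fun _ => rfl⟩

theorem ScanState.next_len (s : ScanState A B) (w : List A) :
    (s.next D w).len = max s.len (w.length + D.slack) := by
  unfold ScanState.next
  split <;> rfl

theorem length_wordOf_le {n N : ℕ} (h : n < base B ^ N) : (wordOf B n).length ≤ N := by
  unfold wordOf
  split_ifs with hex
  · exact length_le_of_digitAt h hex.choose_spec
  · simp

theorem ScanState.Fits.next (hD : 1 ≤ D.slack) (hs : s.Fits) (w : List A) :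
    (s.next D w).Fits := by
  set N := max s.len (w.length + D.slack) with hN
  have hle : s.len ≤ N := le_max_left _ _
  have hx : s.test < base A ^ N :=
    hs.test_lt.trans_le (Nat.pow_le_pow_right (base_pos A) hle)
  have ha : s.cand < base B ^ N :=
    hs.cand_lt.trans_le (Nat.pow_le_pow_right (base_pos B) hle)
  have hr : s.limit < base B ^ N :=
    hs.limit_lt.trans_le (Nat.pow_le_pow_right (base_pos B) hle)
  have hw : w.length < N := by omega
  have h1 := hs.len_pos
  have h2 := hs.hyp_le
  have hA := base_pow_pos A N
  have hB := base_pow_pos B N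
  have hact := fun y hy => (hs.act_lt y hy).trans_le hle
  have hoth := fun y hy => (hs.oth_lt y hy).trans_le hle
  unfold ScanState.next
  split
  · rename_i y rest hyr
    rw [hyr] at hact
    refine ⟨by dsimp only; omega, hx, ha, hr, by dsimp only; omega,
      fun z hz => hact z (List.mem_cons_of_mem _ hz), ?_⟩
    intro z hz
    rcases List.mem_cons.1 hz with rfl | hz
    · exact hw
    rcases List.mem_cons.1 hz with rfl | hz
    · exact hact _ (by simp)
    · exact hoth z hz
  · dsimp only
    rw [← hN]
    have hlen := length_wordOf_le ha
    have e1 : (s.test + 1) % base A ^ N < base A ^ N := Nat.mod_lt _ hA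
    have e2 : (s.cand + 1) % base B ^ N < base B ^ N := Nat.mod_lt _ hB
    have e3 : (s.limit + 1) % base B ^ N < base B ^ N := Nat.mod_lt _ hB
    refine ⟨by dsimp only; omega, ?_, ?_, ?_, ?_, ?_, by simp⟩
    · rcases s.verdict D N with _ | _ | _ | _ | _ <;> simp only [Decision.test] <;> assumption
    · rcases s.verdict D N with _ | _ | _ | _ | _ <;> simp only [Decision.cand] <;> assumption
    · rcases s.verdict D N with _ | _ | _ | _ | _ <;> simp only [Decision.limit] <;> assumption
    · rcases s.verdict D N with _ | _ | _ | _ | _ <;> simp only [Decision.hyp] <;> omega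
    · intro z hz
      rcases List.mem_cons.1 hz with rfl | hz
      · exact hw
      · exact hoth z hz

/-- The machine simulates the search. -/
theorem scanMachine_cycle (hD : 1 ≤ D.slack)
    (hconv : ∀ z ∈ D.graphDFA.accepts, ∃ x y, z = conv x y) (hs : s.Fits) (w : List A) (t : ℕ)
    (ht : 4 * max s.len (w.length + D.slack) + 7 ≤ t) :
    (scanMachine D).Cycle t w s.memory s.stk (s.next D w).memory (s.next D w).hyp
      (s.next D w).stk := by
  set N := max s.len (w.length + D.slack) with hN
  have hle : s.len ≤ N := le_max_left _ _
  have hx : s.test < base A ^ N :=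
    hs.test_lt.trans_le (Nat.pow_le_pow_right (base_pos A) hle)
  have ha : s.cand < base B ^ N :=
    hs.cand_lt.trans_le (Nat.pow_le_pow_right (base_pos B) hle)
  have hr : s.limit < base B ^ N :=
    hs.limit_lt.trans_le (Nat.pow_le_pow_right (base_pos B) hle)
  have hfit := hs.next hD w
  have hlen : (s.next D w).len = N := s.next_len w
  rcases hact : s.act with _ | ⟨y, rest⟩
  · have key := scanMachine_cycle_outcome D hs w none [] (by simp [hact]) (fun _ => rfl) N hN
      _ _ (outcome_none hconv hx ha hr) (s.next D w).memory (s.next D w).hyp (by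
        unfold ScanState.memory
        rw [hlen]
        refine List.map_congr_left fun i hi => ?_
        have hi : i < N := List.mem_range.1 hi
        unfold ScanState.next
        rw [hact]
        dsimp only
        rw [← hN]
        congr 1
        rcases hv : s.verdict D N with _ | _ | _ | _ | _ <;>
          simp only [Decision.test, Decision.cand, Decision.limit, Decision.hyp, digitAt_mod hi,
            digitAt_zero, Prod.mk.injEq, true_and]
        -- Only codes of indices pass, so the digits of the candidate spell `wordOf B s.cand`.
        obtain ⟨e, -, he⟩ := ScanState.exists_of_verdict_eq_pass hv
        rw [wordOf_eq he, he]) (by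
        intro i hi
        unfold ScanState.next
        rw [hact]
        dsimp only
        rw [← hN]
        rcases hv : s.verdict D N with _ | _ | _ | _ | _ <;> simp only [Decision.hyp]
        obtain ⟨e, -, he⟩ := ScanState.exists_of_verdict_eq_pass hv
        rw [wordOf_eq he, he]) (hlen ▸ hfit.hyp_le) t ht
    have hstk : (s.next D w).stk =
        twoStacks s.dir (blocks []) (block w ++ ((none : Option (List A)).elim [] block ++
          blocks s.oth)) := by
      unfold ScanState.next
      rw [hact]
      simp only [ScanState.stk, twoStacks_not]
      simp [blocks]
    rw [hstk]
    exact key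
  · have hy : y.length < N := (hs.act_lt y (by simp [hact])).trans_le hle
    have key := scanMachine_cycle_outcome D hs w (some y) rest (by simp [hact]) (by simp) N hN
      _ _ (outcome_some hconv hx ha hy ⟨rest, hact⟩) (s.next D w).memory (s.next D w).hyp (by
        unfold ScanState.memory
        rw [hlen]
        refine List.map_congr_left fun i hi => ?_
        unfold ScanState.next
        rw [hact]
        rfl) (by
        intro i hi
        unfold ScanState.next
        rw [hact]
        rfl) (hlen ▸ hfit.hyp_le) t ht
    have hstk : (s.next D w).stk =
        twoStacks s.dir (blocks rest) (block w ++ ((some y).elim [] block ++ blocks s.oth)) := by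
      unfold ScanState.next
      rw [hact]
      simp only [ScanState.stk]
      simp [blocks]
    rw [hstk]
    exact key

variable (D) in
/-- The state of the search at the beginning of cycle `n`. -/
noncomputable def scanRun (T : ℕ → List A) : ℕ → ScanState A B
  | 0 => ScanState.init D
  | n + 1 => (scanRun T n).next D (T n)

theorem scanRun_fits (hD : 1 ≤ D.slack) (hh : D.hyp₀.length ≤ D.slack) (T : ℕ → List A) (n : ℕ) :
    (scanRun D T n).Fits := by
  induction n with
  | zero => exact ⟨hD, base_pow_pos _ _, base_pow_pos _ _, base_pow_pos _ _, hh, by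
      simp [scanRun, ScanState.init], by simp [scanRun, ScanState.init]⟩
  | succ n ih => exact ih.next hD (T n)

/-- This equality gives the space bound, and it also guarantees that the room for candidates and
test words grows with the data. -/
theorem scanRun_len_succ (T : ℕ → List A) (n : ℕ) :
    (scanRun D T (n + 1)).len = StackLearner.longest T n + D.slack := by
  induction n with
  | zero =>
    rw [scanRun, ScanState.next_len]
    simp [scanRun, ScanState.init, StackLearner.longest]
  | succ n ih =>
    rw [scanRun, ScanState.next_len, ih, StackLearner.longest_succ]
    omega

theorem scanMachine_isLinearRun (hD : 1 ≤ D.slack) (hh : D.hyp₀.length ≤ D.slack)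
    (hconv : ∀ z ∈ D.graphDFA.accepts, ∃ x y, z = conv x y) (T : ℕ → List A) :
    (scanMachine D).IsLinearRun (4 * D.slack + 11) T (fun n => (scanRun D T n).memory)
      (fun n => (scanRun D T n).stk) (fun n => (scanRun D T (n + 1)).hyp) := by
  refine ⟨?_, fun j => ?_, fun n => ⟨?_, ?_, ?_⟩⟩
  · simp [scanRun, ScanState.init, ScanState.memory, digitAt_zero]
  · simp [scanRun, ScanState.init, ScanState.stk, blocks, twoStacks]
  · refine scanMachine_cycle hD hconv (scanRun_fits hD hh T n) (T n) _ ?_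
    have h1 : (scanRun D T n).memory.length = (scanRun D T n).len := by simp [ScanState.memory]
    rw [length_conv, h1]
    have h2 : max (scanRun D T n).len ((T n).length + D.slack) ≤
        max (T n).length (scanRun D T n).len + D.slack := by omega
    generalize max (T n).length (scanRun D T n).len = a at h2 ⊢
    nlinarith
  · have := scanRun_len_succ (D := D) T n
    simp only [ScanState.memory, List.length_map, List.length_range]
    omega
  · have := scanRun_len_succ (D := D) T n
    have := (scanRun_fits hD hh T (n + 1)).hyp_le
    dsimp only
    omega

end

/-! ### Convergence of the search -/

/-- A search with candidates `a k`, test numbers `x k`, limits `r k` and results `h k` settles on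
the result of the number `a₀` if `a₀` is never rejected and each smaller candidate is rejected
before its test number exceeds a certain bound. -/
theorem search_converges {H : Type*} {x a r M : ℕ → ℕ} {h : ℕ → H} {W : ℕ → H}
    {wrap next pass adv : ℕ → Prop} {a₀ k₀ : ℕ} {ξ β : ℕ → ℕ}
    (hstep : ∀ k, wrap k ∨ next k ∨ pass k ∨ adv k)
    (hwrap : ∀ k, wrap k → a k = r k ∧ x (k + 1) = 0 ∧ a (k + 1) = 0 ∧
      r (k + 1) = (r k + 1) % M k ∧ h (k + 1) = h k)
    (hnext : ∀ k, next k → a k < r k ∧ x (k + 1) = 0 ∧ a (k + 1) = a k + 1 ∧ r (k + 1) = r k ∧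
      h (k + 1) = h k)
    (hpass : ∀ k, pass k → x (k + 1) = 0 ∧ a (k + 1) = 0 ∧ r (k + 1) = r k ∧ h (k + 1) = W (a k))
    (hadv : ∀ k, adv k → x (k + 1) = x k + 1 ∧ a (k + 1) = a k ∧ r (k + 1) = r k ∧
      h (k + 1) = h k ∧ x k < β (a k))
    (hlt : ∀ k, k₀ ≤ k → a k < a₀ → x k ≤ ξ (a k) → ¬ pass k ∧ (adv k → x k < ξ (a k)))
    (heq : ∀ k, k₀ ≤ k → a k = a₀ → ¬ wrap k ∧ ¬ next k)
    (hM : ∀ k, k₀ ≤ k → a₀ < M k) :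
    ∃ k₁, ∀ k, k₁ ≤ k → h k = W a₀ := by
  -- Lexicographic descent: a rejection without wrapping decreases `r k - a k`, and an advance keeps
  -- this and decreases `β (a k) - x k`. So a wrap or a pass must come.
  have restart : ∀ d d' k, r k - a k ≤ d → β (a k) - x k ≤ d' → ∃ k', k ≤ k' ∧
      (wrap k' ∨ pass k') := by
    intro d
    induction d with
    | zero =>
      intro d'
      induction d' with
      | zero =>
        intro k h1 h2
        rcases hstep k with hk | hk | hk | hk
        · exact ⟨k, le_rfl, .inl hk⟩
        · have := hnext k hk
          omega
        · exact ⟨k, le_rfl, .inr hk⟩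
        · have := hadv k hk
          omega
      | succ d' ih =>
        intro k h1 h2
        rcases hstep k with hk | hk | hk | hk
        · exact ⟨k, le_rfl, .inl hk⟩
        · have := hnext k hk
          omega
        · exact ⟨k, le_rfl, .inr hk⟩
        · obtain ⟨e1, e2, e3, -, e4⟩ := hadv k hk
          obtain ⟨k', hk', h'⟩ := ih (k + 1) (by omega) (by rw [e2]; omega)
          exact ⟨k', by omega, h'⟩
    | succ d ihd =>
      intro d'
      induction d' with
      | zero =>
        intro k h1 h2
        rcases hstep k with hk | hk | hk | hk
        · exact ⟨k, le_rfl, .inl hk⟩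
        · obtain ⟨e1, e2, e3, e4, -⟩ := hnext k hk
          obtain ⟨k', hk', h'⟩ := ihd _ (k + 1) (by omega) le_rfl
          exact ⟨k', by omega, h'⟩
        · exact ⟨k, le_rfl, .inr hk⟩
        · have := hadv k hk
          omega
      | succ d' ih =>
        intro k h1 h2
        rcases hstep k with hk | hk | hk | hk
        · exact ⟨k, le_rfl, .inl hk⟩
        · obtain ⟨e1, e2, e3, e4, -⟩ := hnext k hk
          obtain ⟨k', hk', h'⟩ := ihd _ (k + 1) (by omega) le_rfl
          exact ⟨k', by omega, h'⟩
        · exact ⟨k, le_rfl, .inr hk⟩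
        · obtain ⟨e1, e2, e3, -, e4⟩ := hadv k hk
          obtain ⟨k', hk', h'⟩ := ih (k + 1) (by omega) (by rw [e2]; omega)
          exact ⟨k', by omega, h'⟩
  -- Holds after any restart. It persists beyond `k₀`: smaller candidates are rejected no later than
  -- at test number `ξ (a k)`, and `a₀` is left only by passing.
  let J : ℕ → Prop := fun k => a k ≤ a₀ ∧ (a k < a₀ → x k ≤ ξ (a k))
  have hJ : ∀ k, k₀ ≤ k → J k → J (k + 1) ∧ r k ≤ r (k + 1) ∧ (wrap k → r k < a₀ ∧
      r (k + 1) = r k + 1) ∧ (pass k → a k = a₀) := by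
    intro k hk hJk
    have hp : pass k → a k = a₀ := fun hp => by
      by_contra hne
      have hlt' : a k < a₀ := lt_of_le_of_ne hJk.1 hne
      exact (hlt k hk hlt' (hJk.2 hlt')).1 hp
    have hw : wrap k → r k < a₀ ∧ r (k + 1) = r k + 1 := fun hw => by
      have h1 := hwrap k hw
      have h2 : a k ≠ a₀ := fun h => (heq k hk h).1 hw
      have h3 := hJk.1
      have h4 := hM k hk
      refine ⟨by omega, ?_⟩
      rw [h1.2.2.2.1, Nat.mod_eq_of_lt (by omega)]
    refine ⟨?_, ?_, hw, hp⟩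
    · rcases hstep k with h | h | h | h
      · obtain ⟨-, e2, e3, -⟩ := hwrap k h
        exact ⟨by omega, fun _ => by omega⟩
      · obtain ⟨-, e2, e3, -⟩ := hnext k h
        have h2 : a k ≠ a₀ := fun h' => (heq k hk h').2 h
        have h3 := hJk.1
        exact ⟨by omega, fun _ => by omega⟩
      · obtain ⟨e2, e3, -⟩ := hpass k h
        exact ⟨by omega, fun _ => by omega⟩
      · obtain ⟨e2, e3, -⟩ := hadv k h
        refine ⟨by rw [e3]; exact hJk.1, fun hlt' => ?_⟩
        rw [e3] at hlt' ⊢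
        have := (hlt k hk hlt' (hJk.2 hlt')).2 h
        omega
    · rcases hstep k with h | h | h | h
      · have := (hw h).2
        omega
      · exact (hnext k h).2.2.2.1.ge
      · exact (hpass k h).2.2.1.ge
      · exact (hadv k h).2.2.1.ge
  obtain ⟨k', hk', hr⟩ := restart _ _ k₀ le_rfl le_rfl
  have hJ1 : J (k' + 1) := by
    rcases hr with h | h
    · obtain ⟨-, e2, e3, -⟩ := hwrap _ h
      exact ⟨by omega, fun _ => by omega⟩
    · obtain ⟨e2, e3, -⟩ := hpass _ h
      exact ⟨by omega, fun _ => by omega⟩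
  have hJall : ∀ k, k' + 1 ≤ k → J k := fun k hk => by
    induction k, hk using Nat.le_induction with
    | base => exact hJ1
    | succ k hk ih => exact (hJ k (by omega) ih).1
  have hmono : ∀ k l, k' + 1 ≤ k → k ≤ l → r k ≤ r l := fun k l hk hl => by
    induction l, hl using Nat.le_induction with
    | base => exact le_rfl
    | succ l hl ih => exact ih.trans (hJ l (by omega) (hJall l (by omega))).2.1
  -- Under `J`, a wrap occurs only while the limit is below `a₀` and raises it by one. So after
  -- finitely many wraps the next restart is a pass.
  have hex : ∀ d k, k' + 1 ≤ k → a₀ - r k ≤ d → ∃ l, k ≤ l ∧ pass l := by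
    intro d
    induction d with
    | zero =>
      intro k hk hd
      obtain ⟨l, hl, h | h⟩ := restart _ _ k le_rfl le_rfl
      · have h1 := ((hJ l (by omega) (hJall l (by omega))).2.2.1 h).1
        have h2 := hmono k l hk hl
        omega
      · exact ⟨l, hl, h⟩
    | succ d ih =>
      intro k hk hd
      obtain ⟨l, hl, h | h⟩ := restart _ _ k le_rfl le_rfl
      · have h1 := (hJ l (by omega) (hJall l (by omega))).2.2.1 h
        have h2 := hmono k l hk hl
        obtain ⟨l', hl', hp⟩ := ih (l + 1) (by omega) (by omega)
        exact ⟨l', by omega, hp⟩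
      · exact ⟨l, hl, h⟩
  -- Under `J` every pass is a pass of `a₀`, so the result never changes after the first one.
  obtain ⟨l, hl, hp⟩ := hex _ (k' + 1) le_rfl le_rfl
  refine ⟨l + 1, fun k hk => ?_⟩
  induction k, hk using Nat.le_induction with
  | base => rw [(hpass l hp).2.2.2, (hJ l (by omega) (hJall l hl)).2.2.2 hp]
  | succ k hk ih =>
    rcases hstep k with h | h | h | h
    · rw [(hwrap k h).2.2.2.2, ih]
    · rw [(hnext k h).2.2.2.2, ih]
    · rw [(hpass k h).2.2.2, (hJ k (by omega) (hJall k (by omega))).2.2.2 h]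
    · rw [(hadv k h).2.2.2.1, ih]

section

variable {A B : Type} [Finite A] [Finite B] (D : ScanData A B)

/-- The state at time `n + j`, for `j` at most the number of words on the active stack at time
`n`. -/
theorem scanRun_inspect (T : ℕ → List A) (l : List (List A)) : ∀ n, (scanRun D T n).act = l →
    (∀ j ≤ l.length, (scanRun D T (n + j)).hyp = (scanRun D T n).hyp) ∧
    (scanRun D T (n + l.length)).test = (scanRun D T n).test ∧
    (scanRun D T (n + l.length)).cand = (scanRun D T n).cand ∧
    (scanRun D T (n + l.length)).limit = (scanRun D T n).limit ∧
    (scanRun D T (n + l.length)).act = [] ∧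
    ((scanRun D T (n + l.length)).found = true ↔ (scanRun D T n).found = true ∨
      ∃ y ∈ l, ∀ i, digitAt A (scanRun D T n).test i = y[i]?) ∧
    ((scanRun D T (n + l.length)).bad = true ↔ (scanRun D T n).bad = true ∨
      ∃ y ∈ l, ¬ ∃ e, conv e y ∈ D.graphDFA.accepts ∧
        ∀ i, digitAt B (scanRun D T n).cand i = e[i]?) := by
  induction l with
  | nil =>
    intro n hn
    simp [hn]
  | cons y l ih =>
    intro n hn
    have hs : scanRun D T (n + 1) = (scanRun D T n).next D (T n) := rfl
    have hact : (scanRun D T (n + 1)).act = l := by rw [hs, ScanState.next, hn]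
    have htest : (scanRun D T (n + 1)).test = (scanRun D T n).test := by
      rw [hs, ScanState.next, hn]
    have hcand : (scanRun D T (n + 1)).cand = (scanRun D T n).cand := by
      rw [hs, ScanState.next, hn]
    have hlimit : (scanRun D T (n + 1)).limit = (scanRun D T n).limit := by
      rw [hs, ScanState.next, hn]
    have hhyp : (scanRun D T (n + 1)).hyp = (scanRun D T n).hyp := by
      rw [hs, ScanState.next, hn]
    have hfound : (scanRun D T (n + 1)).found = true ↔ (scanRun D T n).found = true ∨
        ∀ i, digitAt A (scanRun D T n).test i = y[i]? := by
      rw [hs, ScanState.next, hn]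
      simp only [Bool.or_eq_true, decide_eq_true_iff]
    have hbad : (scanRun D T (n + 1)).bad = true ↔ (scanRun D T n).bad = true ∨
        ¬ ∃ e, conv e y ∈ D.graphDFA.accepts ∧
          ∀ i, digitAt B (scanRun D T n).cand i = e[i]? := by
      rw [hs, ScanState.next, hn]
      simp only [Bool.or_eq_true, Bool.not_eq_true', decide_eq_false_iff_not]
    obtain ⟨h1, h2, h3, h4, h5, h6, h7⟩ := ih (n + 1) hact
    rw [htest, hfound] at h6
    rw [hcand, hbad] at h7
    have e : n + (y :: l).length = n + 1 + l.length := by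
      rw [List.length_cons]
      omega
    rw [e]
    refine ⟨fun j hj => ?_, h2.trans htest, h3.trans hcand, h4.trans hlimit, h5, ?_, ?_⟩
    · rcases j with _ | j
      · rfl
      · rw [← hhyp, ← h1 j (by simpa using hj), Nat.add_right_comm, Nat.add_assoc n]
    · rw [h6, or_assoc]
      simp
    · rw [h7, or_assoc]
      simp

/-- No datum is ever lost; this lets rejection be expressed by the data seen so far. -/
theorem mem_scanRun_stored (T : ℕ → List A) (n : ℕ) (y : List A) :
    y ∈ (scanRun D T n).act ∨ y ∈ (scanRun D T n).oth ↔ ∃ i < n, T i = y := by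
  induction n with
  | zero => simp [scanRun, ScanState.init]
  | succ n ih =>
    have h1 : (∃ i < n + 1, T i = y) ↔ (∃ i < n, T i = y) ∨ T n = y := by
      constructor
      · rintro ⟨i, hi, rfl⟩
        rcases Nat.lt_succ_iff_lt_or_eq.1 hi with hi | rfl
        · exact .inl ⟨i, hi, rfl⟩
        · exact .inr rfl
      · rintro (⟨i, hi, rfl⟩ | rfl)
        · exact ⟨i, by omega, rfl⟩
        · exact ⟨n, by omega, rfl⟩
    rw [h1, ← ih]
    rw [scanRun, ScanState.next]
    split
    · rename_i z rest hz
      rw [hz]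
      simp only [List.mem_cons, eq_comm (a := y) (b := T n)]
      tauto
    · rename_i hz
      rw [hz]
      simp only [List.mem_cons, eq_comm (a := y) (b := T n), List.not_mem_nil, false_or, or_false]
      tauto

/-- The machine only tests the candidate and the limit for equality; by this invariant, inequality
means that the candidate is smaller. -/
theorem scanRun_cand_le_limit (hD : 1 ≤ D.slack) (hh : D.hyp₀.length ≤ D.slack) (T : ℕ → List A)
    (n : ℕ) : (scanRun D T n).cand ≤ (scanRun D T n).limit := by
  induction n with
  | zero => exact le_rfl
  | succ n ih =>
    have hf := scanRun_fits (D := D) hD hh T n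
    have hle : (scanRun D T n).len ≤ max (scanRun D T n).len ((T n).length + D.slack) :=
      le_max_left _ _
    rw [scanRun, ScanState.next]
    split
    · exact ih
    · dsimp only
      rcases hv : (scanRun D T n).verdict D
          (max (scanRun D T n).len ((T n).length + D.slack)) with _ | _ | _ | _ | _ <;>
        simp only [Decision.cand, Decision.limit]
      · exact ih
      · exact ih
      · have hne : (scanRun D T n).cand ≠ (scanRun D T n).limit := by
          intro heq
          unfold ScanState.verdict decision at hv
          simp only [heq, implies_true, decide_true, if_true] at hv
          split_ifs at hv
        exact (Nat.mod_le _ _).trans (by omega)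
      · exact Nat.zero_le _
      · exact Nat.zero_le _

end

/-! ### Rejection of candidates, and passes over the stored data. -/

section

variable {A B : Type} [Finite A] [Finite B]

/-- The candidate `a` with test number `x` is rejected when the words in `S` have been seen. -/
def Rejected (F : AutomaticFamily B A) (c : ℕ) (S : List A → Prop) (x a : ℕ) : Prop :=
  ¬ ∃ e ∈ F.index, (∀ i, digitAt B a i = e[i]?) ∧ (∀ y, S y → y ∈ F.lang e) ∧
    ∀ z ∈ F.lang e, x < base A ^ (e.length + c) → (∀ i, digitAt A x i = z[i]?) → S z

/-- Before position `i` the candidate has `i - e.length` padding digits. Counting them up to `c`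
thus lets a finite control detect a digit of the test number at position `e.length + c` or later. -/
theorem exists_digit_beyond_iff {e : List B} {a x N c : ℕ} (hx : x < base A ^ N)
    (he : ∀ i, digitAt B a i = e[i]?) :
    (∃ i, digitAt B a i = none ∧ digitAt A x i ≠ none ∧
      c ≤ Nat.count (fun j => digitAt B a j = none) i) ↔ ¬ x < base A ^ (e.length + c) := by
  have hcount : ∀ i, Nat.count (fun j => digitAt B a j = none) i = i - e.length := by
    intro i
    induction i with
    | zero => simp
    | succ i ih =>
      rw [Nat.count_succ, ih, he]
      by_cases h : e.length ≤ i
      · rw [if_pos (List.getElem?_eq_none h)]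
        omega
      · rw [if_neg (by simpa using h)]
        omega
  constructor
  · rintro ⟨i, h1, h2, h3⟩ hlt
    rw [he, List.getElem?_eq_none_iff] at h1
    rw [hcount] at h3
    exact h2 (digitAt_eq_none hlt (by omega))
  · intro h
    by_contra hne
    refine h (lt_pow_of_digitAt hx fun i hi => ?_)
    by_contra hi'
    refine hne ⟨i, ?_, hi', ?_⟩
    · rw [he]
      exact List.getElem?_eq_none (by omega)
    · rw [hcount]
      omega

variable {D : ScanData A B} {F : AutomaticFamily B A} {s : ScanState A B} {S : List A → Prop}
  {N : ℕ}

theorem decision_spec (bad found idx long elt last atLimit : Bool) :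
    let rej := (bad = true ∨ ¬ idx = true ∨ (¬ long = true ∧ elt = true ∧ ¬ found = true))
    let d := decision bad found idx long elt last atLimit
    (d = .failWrap ∧ rej ∧ atLimit = true) ∨ (d = .failNext ∧ rej ∧ ¬ atLimit = true) ∨
      (d = .pass ∧ ¬ rej ∧ (long = true ∨ last = true)) ∨
      (d = .advance ∧ ¬ rej ∧ ¬ long = true ∧ ¬ last = true) := by
  cases bad <;> cases found <;> cases idx <;> cases long <;> cases elt <;> cases last <;>
    cases atLimit <;> simp [decision]

/-- Translates the flags of the finite control into `Rejected`. Digits determine a word, so the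
existential statements decided by the automata all concern the same index and the same test word. -/
theorem ScanState.verdict_spec (hG : D.graphDFA.accepts = F.graph)
    (hI : D.indexDFA.accepts = F.index) (hs : s.Fits)
    (hf : s.found = true ↔ ∃ y, S y ∧ ∀ i, digitAt A s.test i = y[i]?)
    (hb : s.bad = true ↔ ∃ y, S y ∧ ¬ ∃ e, conv e y ∈ D.graphDFA.accepts ∧
        ∀ i, digitAt B s.cand i = e[i]?) :
    (s.verdict D N = .failWrap ∧ Rejected F D.tail S s.test s.cand ∧ s.cand = s.limit) ∨
    (s.verdict D N = .failNext ∧ Rejected F D.tail S s.test s.cand ∧ s.cand ≠ s.limit) ∨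
    (s.verdict D N = .pass ∧ ¬ Rejected F D.tail S s.test s.cand ∧
      (¬ s.test < base A ^ ((wordOf B s.cand).length + D.tail) ∨ base A ^ N ∣ s.test + 1)) ∨
    (s.verdict D N = .advance ∧ ¬ Rejected F D.tail S s.test s.cand ∧
      s.test < base A ^ ((wordOf B s.cand).length + D.tail) ∧ ¬ base A ^ N ∣ s.test + 1) := by
  classical
  have key := decision_spec s.bad s.found
    (decide (∃ e ∈ D.indexDFA.accepts, ∀ i, digitAt B s.cand i = e[i]?))
    (decide (∃ i, digitAt B s.cand i = none ∧ digitAt A s.test i ≠ none ∧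
      D.tail ≤ Nat.count (fun j => digitAt B s.cand j = none) i))
    (decide (∃ e x, conv e x ∈ D.graphDFA.accepts ∧ (∀ i, digitAt B s.cand i = e[i]?) ∧
      ∀ i, digitAt A s.test i = x[i]?))
    (decide (base A ^ N ∣ s.test + 1))
    (decide (∀ i, digitAt B s.cand i = digitAt B s.limit i))
  have hv : s.verdict D N = decision s.bad s.found
    (decide (∃ e ∈ D.indexDFA.accepts, ∀ i, digitAt B s.cand i = e[i]?))
    (decide (∃ i, digitAt B s.cand i = none ∧ digitAt A s.test i ≠ none ∧
      D.tail ≤ Nat.count (fun j => digitAt B s.cand j = none) i))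
    (decide (∃ e x, conv e x ∈ D.graphDFA.accepts ∧ (∀ i, digitAt B s.cand i = e[i]?) ∧
      ∀ i, digitAt A s.test i = x[i]?))
    (decide (base A ^ N ∣ s.test + 1))
    (decide (∀ i, digitAt B s.cand i = digitAt B s.limit i)) := rfl
  rw [← hv] at key
  simp only [decide_eq_true_iff] at key
  rw [hf, hb, hG, hI] at key
  have hlim : (∀ i, digitAt B s.cand i = digitAt B s.limit i) ↔ s.cand = s.limit :=
    ⟨fun h => digitAt_inj hs.cand_lt hs.limit_lt h, fun h i => by rw [h]⟩
  rw [hlim] at key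
  by_cases hex : ∃ e ∈ F.index, ∀ i, digitAt B s.cand i = e[i]?
  · obtain ⟨e, heI, he⟩ := hex
    have huniq : ∀ e', (∀ i, digitAt B s.cand i = e'[i]?) → e' = e := fun e' h =>
      List.ext_getElem? fun i => by rw [← h, he]
    rw [exists_digit_beyond_iff hs.test_lt he] at key
    rw [wordOf_eq he]
    have hrej : Rejected F D.tail S s.test s.cand ↔
        (∃ y, S y ∧ ¬ ∃ e, conv e y ∈ F.graph ∧ ∀ i, digitAt B s.cand i = e[i]?) ∨
        (¬ ∃ e ∈ F.index, ∀ i, digitAt B s.cand i = e[i]?) ∨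
        (¬ ¬ s.test < base A ^ (e.length + D.tail) ∧
          (∃ e x, conv e x ∈ F.graph ∧ (∀ i, digitAt B s.cand i = e[i]?) ∧
            ∀ i, digitAt A s.test i = x[i]?) ∧
          ¬ ∃ y, S y ∧ ∀ i, digitAt A s.test i = y[i]?) := by
      unfold Rejected
      constructor
      · intro h
        by_contra hno
        rw [not_or, not_or] at hno
        obtain ⟨h1, -, h3⟩ := hno
        refine h ⟨e, heI, he, fun y hy => ?_, fun z hz hlt hzx => ?_⟩
        · by_contra hy'
          refine h1 ⟨y, hy, ?_⟩
          rintro ⟨e', h4, h5⟩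
          rw [huniq e' h5, AutomaticFamily.conv_mem_graph] at h4
          exact hy' h4.2
        · by_contra hz'
          refine h3 ⟨not_not.2 hlt, ⟨e, z, (F.conv_mem_graph _ _).2 ⟨heI, hz⟩, he, hzx⟩, ?_⟩
          rintro ⟨y, hy, hy'⟩
          obtain rfl : y = z := List.ext_getElem? fun i => by rw [← hy', hzx]
          exact hz' hy
      · rintro h ⟨e', he'I, he', h1, h2⟩
        obtain rfl := huniq e' he'
        rcases h with ⟨y, hy, h⟩ | h | ⟨h3, ⟨e, x, h4, h5, h6⟩, h7⟩
        · exact h ⟨e', (F.conv_mem_graph _ _).2 ⟨heI, h1 y hy⟩, he⟩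
        · exact h ⟨e', heI, he⟩
        · rw [huniq e h5, AutomaticFamily.conv_mem_graph] at h4
          exact h7 ⟨x, h2 x h4.2 (not_not.1 h3) h6, h6⟩
    rw [← hrej, not_not] at key
    exact key
  · have hrej : Rejected F D.tail S s.test s.cand := by
      rintro ⟨e, h1, h2, -⟩
      exact hex ⟨e, h1, h2⟩
    rcases key with h | h | h | h
    · exact .inl ⟨h.1, hrej, h.2.2⟩
    · exact .inr (.inl ⟨h.1, hrej, h.2.2⟩)
    · exact absurd (.inr (.inl hex)) h.2.1
    · exact absurd (.inr (.inl hex)) h.2.1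

variable (D) in
/-- The time at which the search begins its `k`-th pass over the stored data. -/
noncomputable def roundTime (T : ℕ → List A) : ℕ → ℕ
  | 0 => 0
  | k + 1 => roundTime T k + (scanRun D T (roundTime T k)).act.length + 1

theorem le_roundTime (T : ℕ → List A) (k : ℕ) : k ≤ roundTime D T k := by
  induction k with
  | zero => exact Nat.zero_le _
  | succ k ih =>
    rw [roundTime]
    omega

theorem exists_roundTime_le_lt (T : ℕ → List A) (n : ℕ) :
    ∃ k, roundTime D T k ≤ n ∧ n < roundTime D T (k + 1) := by
  classical
  have hex : ∃ k, n < roundTime D T (k + 1) := ⟨n, le_roundTime T (n + 1)⟩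
  refine ⟨Nat.find hex, ?_, Nat.find_spec hex⟩
  rcases h : Nat.find hex with _ | k
  · exact Nat.zero_le _
  · exact not_lt.1 (Nat.find_min hex (by omega))

/-- The cycle that ends a pass swaps the stacks, so each pass starts with all data on the active
stack and clean flags; data arriving meanwhile wait for the next pass. -/
theorem scanRun_roundTime_fresh (T : ℕ → List A) (k : ℕ) :
    (scanRun D T (roundTime D T k)).oth = [] ∧
    (scanRun D T (roundTime D T k)).found = false ∧
    (scanRun D T (roundTime D T k)).bad = false := by
  rcases k with _ | k
  · exact ⟨rfl, rfl, rfl⟩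
  · obtain ⟨-, -, -, -, h, -⟩ := scanRun_inspect D T _ (roundTime D T k) rfl
    rw [roundTime, scanRun, ScanState.next, h]
    exact ⟨rfl, rfl, rfl⟩

/-- What happens during the `k`-th pass over the stored data. -/
theorem scanRun_round (hG : D.graphDFA.accepts = F.graph) (hI : D.indexDFA.accepts = F.index)
    (hD : 1 ≤ D.slack) (hh : D.hyp₀.length ≤ D.slack) (T : ℕ → List A) (k : ℕ) :
    ∃ (d : Decision) (N : ℕ),
      let s := scanRun D T (roundTime D T k)
      let s' := scanRun D T (roundTime D T (k + 1))
      let R := Rejected F D.tail (fun y => ∃ i < roundTime D T k, T i = y) s.test s.cand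
      N = s'.len ∧ s.len ≤ N ∧
      (∀ n, roundTime D T k ≤ n → n < roundTime D T (k + 1) → (scanRun D T n).hyp = s.hyp) ∧
      s'.test = d.test s.test ((s.test + 1) % base A ^ N) 0 ∧
      s'.cand = d.cand s.cand ((s.cand + 1) % base B ^ N) 0 ∧
      s'.limit = d.limit s.limit ((s.limit + 1) % base B ^ N) ∧
      s'.hyp = d.hyp (wordOf B s.cand) s.hyp ∧
      ((d = .failWrap ∧ R ∧ s.cand = s.limit) ∨ (d = .failNext ∧ R ∧ s.cand ≠ s.limit) ∨
        (d = .pass ∧ ¬ R ∧ (¬ s.test < base A ^ ((wordOf B s.cand).length + D.tail) ∨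
          base A ^ N ∣ s.test + 1)) ∨
        (d = .advance ∧ ¬ R ∧ s.test < base A ^ ((wordOf B s.cand).length + D.tail) ∧
          ¬ base A ^ N ∣ s.test + 1)) := by
  set n := roundTime D T k with hn
  obtain ⟨h1, h2, h3, h4, h5, h6, h7⟩ := scanRun_inspect D T _ n rfl
  set u := n + (scanRun D T n).act.length with hu
  obtain ⟨f1, f2, f3⟩ := scanRun_roundTime_fresh (D := D) T k
  rw [← hn] at f1 f2 f3
  have hmem := fun y => mem_scanRun_stored D T n y
  simp only [f1, List.not_mem_nil, or_false] at hmem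
  have hseen : ∀ p : List A → Prop, (∃ y ∈ (scanRun D T n).act, p y) ↔
      ∃ y, (∃ i < n, T i = y) ∧ p y := fun p => exists_congr fun y => by rw [hmem]
  rw [f2, hseen] at h6
  rw [f3, hseen] at h7
  simp only [Bool.false_eq_true, false_or] at h6 h7
  have ht : roundTime D T (k + 1) = u + 1 := rfl
  set N := max (scanRun D T u).len ((T u).length + D.slack) with hN
  have hlen : ∀ j, (scanRun D T n).len ≤ (scanRun D T (n + j)).len := by
    intro j
    induction j with
    | zero => exact le_rfl
    | succ j ih =>
      refine ih.trans ?_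
      rw [← Nat.add_assoc, scanRun, ScanState.next_len]
      exact le_max_left _ _
  have hs' : scanRun D T (roundTime D T (k + 1)) = (scanRun D T u).next D (T u) := by rw [ht, scanRun]
  refine ⟨(scanRun D T u).verdict D N, N, ?_⟩
  have hspec := (scanRun D T u).verdict_spec (N := N) (S := fun y => ∃ i < n, T i = y) hG hI
    (scanRun_fits hD hh T u) (by rw [h2]; exact h6) (by rw [h3]; exact h7)
  rw [h2, h3, h4] at hspec
  dsimp only
  refine ⟨?_, (hlen _).trans (le_max_left _ _), ?_, ?_, ?_, ?_, ?_, hspec⟩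
  · rw [hs', ScanState.next_len]
  · intro m hm1 hm2
    obtain ⟨j, rfl⟩ := Nat.exists_eq_add_of_le hm1
    exact h1 j (by omega)
  · rw [hs', ScanState.next, h5, h2]
  · rw [hs', ScanState.next, h5, h3]
  · rw [hs', ScanState.next, h5, h4]
  · rw [hs', ScanState.next, h5, h3]
    dsimp only
    have : (scanRun D T u).hyp = (scanRun D T n).hyp := h1 _ le_rfl
    rw [this]

end

/-- Every language has an index that is only by a constant longer than one of its elements. -/
theorem AutomaticFamily.exists_index_le_length {A B : Type} (F : AutomaticFamily B A) :
    ∃ K, ∀ e ∈ F.index, ∃ e' ∈ F.index, F.lang e' = F.lang e ∧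
      ∃ x ∈ F.lang e, e'.length ≤ x.length + K := by
  classical
  obtain ⟨K, hK⟩ := F.exists_index_bound
  refine ⟨K, fun e he => ?_⟩
  -- A finite language is treated with the least bound for the lengths of its words; an infinite one
  -- has an element longer than the given index.
  by_cases hex : ∃ m, ∀ x ∈ F.lang e, x.length ≤ m
  · obtain ⟨e', he', h, hlen⟩ := hK e he _ (Nat.find_spec hex)
    refine ⟨e', he', h, ?_⟩
    -- If all elements were too short, one less than the least bound would still be a bound.
    by_contra hno
    push Not at hno
    obtain ⟨x, hx⟩ := F.lang_nonempty e he
    have h1 := hno x hx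
    refine Nat.find_min hex (m := Nat.find hex - 1) (by omega) fun y hy => ?_
    have h2 := hno y hy
    omega
  · push Not at hex
    obtain ⟨x, hx, hlt⟩ := hex e.length
    exact ⟨e, he, rfl, x, hx, by omega⟩

/-! ### The search in the limit. -/

section

open Filter

variable {A B : Type} [Finite A] [Finite B] {D : ScanData A B} {F : AutomaticFamily B A}

theorem scanRun_hyp_mem (hI : D.indexDFA.accepts = F.index) (hF : D.hyp₀ ∈ F.index)
    (T : ℕ → List A) (n : ℕ) : (scanRun D T n).hyp ∈ F.index := by
  induction n with
  | zero => exact hF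
  | succ n ih =>
    rw [scanRun, ScanState.next]
    split
    · exact ih
    · dsimp only
      rcases hv : (scanRun D T n).verdict D
          (max (scanRun D T n).len ((T n).length + D.slack)) with _ | _ | _ | _ | _ <;>
        simp only [Decision.hyp] <;> try exact ih
      obtain ⟨e, he, h⟩ := ScanState.exists_of_verdict_eq_pass hv
      rw [wordOf_eq h, ← hI]
      exact he

theorem roundTime_strictMono (T : ℕ → List A) : StrictMono (roundTime D T) :=
  strictMono_nat_of_lt_succ fun k => by
    rw [roundTime]
    omega

theorem eventually_seen {T : ℕ → List A} {L : Language A} (hT : IsText T L) {y : List A}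
    (hy : y ∈ L) : ∀ᶠ k in atTop, ∃ i < roundTime D T k, T i = y := by
  obtain ⟨i, rfl⟩ := (hT y).1 hy
  filter_upwards [eventually_ge_atTop (i + 1)] with k hk
  exact ⟨i, hk.trans (le_roundTime T k), rfl⟩

theorem eventually_le_len {T : ℕ → List A} {L : Language A} (hT : IsText T L) {y : List A}
    (hy : y ∈ L) :
    ∀ᶠ k in atTop, y.length + D.slack ≤ (scanRun D T (roundTime D T (k + 1))).len := by
  obtain ⟨i, rfl⟩ := (hT y).1 hy
  filter_upwards [eventually_ge_atTop i] with k hk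
  have h1 := le_roundTime (D := D) T k
  rw [roundTime, scanRun_len_succ]
  have := StackLearner.length_le_longest T
    (show i ≤ roundTime D T k + (scanRun D T (roundTime D T k)).act.length by omega)
  omega

/-- Each number that precedes all codes of indices of `L` is rejected eventually, before its test
number exceeds a certain bound. -/
theorem exists_rejecting_test
    (htell : ∀ e ∈ F.index, ∀ e' ∈ F.index,
      (∀ x ∈ F.lang e, x.length ≤ e.length + D.tail → x ∈ F.lang e') →
      (∀ x ∈ F.lang e', x ∈ F.lang e) → F.lang e' = F.lang e)
    {T : ℕ → List A} {e₀ : List B} (he₀ : e₀ ∈ F.index) (hT : IsText T (F.lang e₀)) {a : ℕ}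
    (ha : a < base B ^ e₀.length)
    (hmin : ∀ e ∈ F.index, (∀ i, digitAt B a i = e[i]?) → F.lang e ≠ F.lang e₀)
    (hlen : ∀ᶠ k in atTop, e₀.length + D.tail ≤ (scanRun D T (roundTime D T (k + 1))).len) :
    ∃ ξ, ∀ᶠ k in atTop, ∀ x ≤ ξ,
      Rejected F D.tail (fun y => ∃ i < roundTime D T k, T i = y) x a ∨
      (x < ξ ∧ x < base A ^ ((wordOf B a).length + D.tail) ∧
        ¬ base A ^ (scanRun D T (roundTime D T (k + 1))).len ∣ x + 1) := by
  by_cases hex : ∃ e ∈ F.index, ∀ i, digitAt B a i = e[i]?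
  swap
  · refine ⟨0, Eventually.of_forall fun k x _ => .inl ?_⟩
    rintro ⟨e, h1, h2, -⟩
    exact hex ⟨e, h1, h2⟩
  obtain ⟨e, he, hae⟩ := hex
  have huniq : ∀ e', (∀ i, digitAt B a i = e'[i]?) → e' = e := fun e' h =>
    List.ext_getElem? fun i => by rw [← h, hae]
  by_cases hsub : ∀ y ∈ F.lang e₀, y ∈ F.lang e
  swap
  · push Not at hsub
    obtain ⟨y, hy, hye⟩ := hsub
    refine ⟨0, ?_⟩
    filter_upwards [eventually_seen (D := D) hT hy] with k hk x _
    left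
    rintro ⟨e', -, h2, h3, -⟩
    obtain rfl := huniq e' h2
    exact hye (h3 y hk)
  -- The remaining case is that `F.lang e` properly contains the target. The tell-tale property of
  -- `e` supplies a short word `z` outside the target, which never occurs and refutes the candidate
  -- once it is the test word.
  obtain ⟨z, hz, hzlen, hz₀⟩ : ∃ z ∈ F.lang e, z.length ≤ e.length + D.tail ∧ z ∉ F.lang e₀ := by
    by_contra hno
    push Not at hno
    exact hmin e he hae (htell e he e₀ he₀ hno hsub).symm
  have hzc : wordCode z < base A ^ (e.length + D.tail) :=
    (wordCode_lt z).trans_le (Nat.pow_le_pow_right (base_pos A) hzlen)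
  refine ⟨wordCode z, ?_⟩
  filter_upwards [hlen] with k hk x hx
  rcases hx.lt_or_eq with hlt | rfl
  · right
    refine ⟨hlt, by rw [wordOf_eq hae]; omega, fun hdvd => ?_⟩
    -- A test number below the code of `z` is not the last one, for otherwise `x + 1` would be at
    -- least `base A ^ (e.length + D.tail)`, which exceeds the code of `z`.
    have h1 := Nat.le_of_dvd (Nat.succ_pos _) hdvd
    have h2 := length_le_of_digitAt ha hae
    have h3 := Nat.pow_le_pow_right (base_pos A) (n := base A)
      (show e.length + D.tail ≤ (scanRun D T (roundTime D T (k + 1))).len by omega)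
    omega
  · left
    rintro ⟨e', -, h2, -, h4⟩
    obtain rfl := huniq e' h2
    obtain ⟨i, -, hi⟩ := h4 z hz hzc (digitAt_wordCode z)
    exact hz₀ ((hT z).2 ⟨i, hi⟩)

/-- An index of the language is never rejected from some point on. -/
theorem eventually_not_rejected {T : ℕ → List A} {e : List B} (he : e ∈ F.index)
    (hT : IsText T (F.lang e)) {a : ℕ} (hae : ∀ i, digitAt B a i = e[i]?) :
    ∀ᶠ k in atTop, ∀ x, ¬ Rejected F D.tail (fun y => ∃ i < roundTime D T k, T i = y) x a := by
  -- Only finitely many test words matter for `e`, so from some point on all those in the language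
  -- have been seen.
  have hfin : ({y : List A | y.length ≤ e.length + D.tail ∧ y ∈ F.lang e}).Finite :=
    (List.finite_length_le A _).subset fun y hy => hy.1
  have hev : ∀ᶠ k in atTop, ∀ y ∈ {y : List A | y.length ≤ e.length + D.tail ∧ y ∈ F.lang e},
      ∃ i < roundTime D T k, T i = y :=
    (eventually_all_finite hfin).2 fun y hy => eventually_seen hT hy.2
  filter_upwards [hev] with k hk x
  refine not_not.2 ⟨e, he, hae, ?_, fun z hz hlt hx => ?_⟩
  · rintro y ⟨i, -, hi⟩
    exact (hT y).2 ⟨i, hi⟩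
  · exact hk z ⟨length_le_of_digitAt hlt hx, hz⟩

theorem scanRun_convergesTo (hG : D.graphDFA.accepts = F.graph)
    (hI : D.indexDFA.accepts = F.index) (hD : 1 ≤ D.slack) (hh : D.hyp₀.length ≤ D.slack)
    (hF : D.hyp₀ ∈ F.index)
    (htell : ∀ e ∈ F.index, ∀ e' ∈ F.index,
      (∀ x ∈ F.lang e, x.length ≤ e.length + D.tail → x ∈ F.lang e') →
      (∀ x ∈ F.lang e', x ∈ F.lang e) → F.lang e' = F.lang e)
    (hshort : ∀ e ∈ F.index, ∃ e' ∈ F.index, F.lang e' = F.lang e ∧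
      ∃ x ∈ F.lang e, e'.length + D.tail ≤ x.length + D.slack)
    {L : Language A} (hL : L ∈ F.languages) {T : ℕ → List A} (hT : IsText T L) :
    ConvergesTo F (fun n => (scanRun D T (n + 1)).hyp) L := by
  classical
  refine ⟨fun n => scanRun_hyp_mem hI hF T _, ?_⟩
  obtain ⟨e₁, he₁, rfl⟩ := hL
  -- The index `e₀` is so short that, once `z` has been seen, the memory has room for `e₀` and for
  -- all its test words.
  obtain ⟨e₀, he₀, h₀, z, hz, hzlen⟩ := hshort e₁ he₁
  rw [← h₀] at hT hz ⊢
  have hlen : ∀ᶠ k in atTop, e₀.length + D.tail ≤ (scanRun D T (roundTime D T (k + 1))).len :=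
    (eventually_le_len hT hz).mono fun k hk => hzlen.trans hk
  have hex : ∃ a, ∃ e ∈ F.index, F.lang e = F.lang e₀ ∧ ∀ i, digitAt B a i = e[i]? :=
    ⟨wordCode e₀, e₀, he₀, rfl, digitAt_wordCode e₀⟩
  -- The least code of an index of the target; the corresponding index `e` may differ from `e₀`, but
  -- its code is bounded by that of `e₀`.
  set a₀ := Nat.find hex with ha₀
  obtain ⟨e, he, hee, hae⟩ := Nat.find_spec hex
  rw [← ha₀] at hae
  have ha₀lt : a₀ < base B ^ e₀.length :=
    (Nat.find_min' hex ⟨e₀, he₀, rfl, digitAt_wordCode e₀⟩).trans_lt (wordCode_lt e₀)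
  have hmin : ∀ a < a₀, ∀ e ∈ F.index, (∀ i, digitAt B a i = e[i]?) → F.lang e ≠ F.lang e₀ :=
    fun a ha e h1 h2 h3 => Nat.find_min hex ha ⟨e, h1, h3, h2⟩
  have hrej := fun a : ℕ => fun ha : a < a₀ =>
    exists_rejecting_test htell he₀ hT (ha.trans ha₀lt) (hmin a ha) hlen
  choose! ξ hξ using hrej
  have hξ' := (eventually_all_finite (Set.finite_lt_nat a₀)).2 hξ
  obtain ⟨k₀, hk₀⟩ := eventually_atTop.1
    (hξ'.and (hlen.and (eventually_not_rejected (D := D) he (hee ▸ hT) hae)))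
  choose d N hround using scanRun_round hG hI hD hh T
  have hcl := fun n => scanRun_cand_le_limit D hD hh T n
  have hfits := fun n => scanRun_fits (D := D) hD hh T n
  obtain ⟨k₁, hk₁⟩ := search_converges (k₀ := k₀) (a₀ := a₀) (ξ := ξ) (W := wordOf B)
    (β := fun a => base A ^ ((wordOf B a).length + D.tail)) (M := fun k => base B ^ N k)
    (x := fun k => (scanRun D T (roundTime D T k)).test)
    (a := fun k => (scanRun D T (roundTime D T k)).cand)
    (r := fun k => (scanRun D T (roundTime D T k)).limit)
    (h := fun k => (scanRun D T (roundTime D T k)).hyp)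
    (wrap := fun k => d k = .failWrap) (next := fun k => d k = .failNext)
    (pass := fun k => d k = .pass) (adv := fun k => d k = .advance)
    (fun k => by
      obtain ⟨-, -, -, -, -, -, -, h⟩ := hround k
      tauto)
    (fun k hk => by
      obtain ⟨-, -, -, h1, h2, h3, h4, h5⟩ := hround k
      rw [hk] at h1 h2 h3 h4 h5
      simp only [reduceCtorEq, false_and, or_false] at h5
      exact ⟨h5.2.2, h1, h2, h3, h4⟩)
    (fun k hk => by
      obtain ⟨-, hle, -, h1, h2, h3, h4, h5⟩ := hround k
      rw [hk] at h1 h2 h3 h4 h5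
      simp only [reduceCtorEq, false_and, or_false, false_or] at h5
      have h6 := lt_of_le_of_ne (hcl _) h5.2.2
      have h7 := (hfits (roundTime D T k)).limit_lt.trans_le
        (Nat.pow_le_pow_right (base_pos B) hle)
      refine ⟨h6, h1, h2.trans ?_, h3, h4⟩
      exact Nat.mod_eq_of_lt (by omega))
    (fun k hk => by
      obtain ⟨-, -, -, h1, h2, h3, h4, -⟩ := hround k
      rw [hk] at h1 h2 h3 h4
      exact ⟨h1, h2, h3, h4⟩)
    (fun k hk => by
      obtain ⟨-, hle, -, h1, h2, h3, h4, h5⟩ := hround k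
      rw [hk] at h1 h2 h3 h4 h5
      simp only [reduceCtorEq, false_and, false_or] at h5
      have h7 := (hfits (roundTime D T k)).test_lt.trans_le
        (Nat.pow_le_pow_right (base_pos A) hle)
      -- The counter does not overflow, since the largest test number of length `N k` counts as the
      -- last one and leads to no advance.
      have h8 : (scanRun D T (roundTime D T k)).test + 1 ≠ base A ^ N k := fun h =>
        h5.2.2.2 (h ▸ dvd_rfl)
      refine ⟨h1.trans (Nat.mod_eq_of_lt (by omega)), h2, h3, h4, h5.2.2.1⟩)
    (fun k hk hlt hx => by
      obtain ⟨hN, -, -, -, -, -, -, h5⟩ := hround k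
      rcases (hk₀ k hk).1 _ hlt _ hx with h | ⟨h6, h7, h8⟩
      · refine ⟨fun hp => ?_, fun hp => ?_⟩
        · rw [hp] at h5
          simp only [reduceCtorEq, false_and, or_false, false_or] at h5
          exact absurd h h5.2.1
        · rw [hp] at h5
          simp only [reduceCtorEq, false_and, false_or] at h5
          exact absurd h h5.2.1
      · refine ⟨fun hp => ?_, fun _ => h6⟩
        rw [hp] at h5
        simp only [reduceCtorEq, false_and, or_false, false_or] at h5
        rcases h5.2.2 with h | h
        · exact h h7
        · rw [hN] at h
          exact h8 h)
    (fun k hk heq => by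
      obtain ⟨-, -, -, -, -, -, -, h5⟩ := hround k
      have h := (hk₀ k hk).2.2 (scanRun D T (roundTime D T k)).test
      rw [← heq] at h
      rcases h5 with h5 | h5 | h5 | h5
      · exact absurd h5.2.1 h
      · exact absurd h5.2.1 h
      · simp [h5.1]
      · simp [h5.1])
    (fun k hk => by
      obtain ⟨hN, -⟩ := hround k
      have := (hk₀ k hk).2.1
      exact ha₀lt.trans_le (Nat.pow_le_pow_right (base_pos B) (by omega)))
  -- Conjectures change only at the end of a pass, so convergence along the passes gives convergence
  -- along all cycles.
  refine ⟨e, he, hee, roundTime D T k₁, fun n hn => ?_⟩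
  obtain ⟨k, h1, h2⟩ := exists_roundTime_le_lt (D := D) T (n + 1)
  have hk : k₁ ≤ k := by
    by_contra hlt
    have := (roundTime_strictMono (D := D) T).monotone (show k + 1 ≤ k₁ by omega)
    omega
  obtain ⟨-, -, h3, -⟩ := hround k
  exact (h3 _ h1 h2).trans ((hk₁ k hk).trans (wordOf_eq hae))

theorem Learnable.exists_stackLearner (F : AutomaticFamily B A) (h : Learnable F.languages) :
    ∃ M : StackLearner A B 2, M.LearnsInLinearTime F F.languages := by
  have hne : ∀ L ∈ F.languages, ∃ x, x ∈ L := by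
    rintro L ⟨e, he, rfl⟩
    exact F.lang_nonempty e he
  obtain ⟨c, hc⟩ := F.exists_uniform_telltale fun e he => by
    obtain ⟨b, hb⟩ := h.exists_telltale hne ⟨e, he, rfl⟩
    exact ⟨b, fun e' he' => hb _ ⟨e', he', rfl⟩⟩
  obtain ⟨K, hK⟩ := F.exists_index_le_length
  obtain ⟨Q₁, _, M₁, hM₁⟩ := F.graph_regular
  obtain ⟨Q₃, _, M₃, hM₃⟩ := F.index_regular
  -- The first conjecture must already be an index. If there is none, the class is empty and any
  -- word will do.
  obtain ⟨h₀, hh₀⟩ : ∃ h₀ : List B, ∀ e ∈ F.index, h₀ ∈ F.index := by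
    by_cases hex : ∃ e, e ∈ F.index
    · exact ⟨hex.choose, fun _ _ => hex.choose_spec⟩
    · exact ⟨[], fun e he => absurd ⟨e, he⟩ hex⟩
  -- The slack provides `K + c` cells for a short index together with its test words, room for the
  -- initial conjecture, and one cell that keeps the memory nonempty so that it can carry the flags.
  let D : ScanData A B :=
    { Q₁ := Q₁, Q₃ := Q₃, finite₁ := inferInstance, finite₃ := inferInstance, graphDFA := M₁
      indexDFA := M₃, tail := c, slack := K + c + h₀.length + 1, hyp₀ := h₀ }
  have hG : D.graphDFA.accepts = F.graph := hM₁
  have hD : 1 ≤ D.slack := Nat.le_add_left _ _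
  have hh : D.hyp₀.length ≤ D.slack := by
    change h₀.length ≤ K + c + h₀.length + 1
    omega
  have hconv : ∀ z ∈ D.graphDFA.accepts, ∃ x y, z = conv x y := by
    rw [hG]
    rintro z ⟨e, x, -, -, rfl⟩
    exact ⟨e, x, rfl⟩
  refine ⟨scanMachine D, _, fun T => ⟨_, _, _, scanMachine_isLinearRun hD hh hconv T, ?_⟩⟩
  intro L hL hT
  refine scanRun_convergesTo hG hM₃ hD hh ?_ hc (fun e he => ?_) hL hT
  · obtain ⟨e, he, -⟩ := hL
    exact hh₀ e he
  · obtain ⟨e', he', h1, x, hx, hlen⟩ := hK e he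
    refine ⟨e', he', h1, x, hx, ?_⟩
    change e'.length + c ≤ x.length + (K + c + h₀.length + 1)
    omega

end

end AutLearn

theorem theorem3p8 :
    (∃ (A B : Type) (_ : Finite A) (_ : Finite B) (F : AutLearn.AutomaticFamily B A),
      (∃ M : AutLearn.StackLearner A B 1, M.LearnsInLinearTime F F.languages) ∧
      ¬ AutLearn.AutomaticallyLearnable F.languages) ∧
    (∀ (A B : Type) [Finite A] [Finite B] (F : AutLearn.AutomaticFamily B A),
      AutLearn.Learnable F.languages →
      ∃ M : AutLearn.StackLearner A B 2, M.LearnsInLinearTime F F.languages) :=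
  ⟨⟨Bool, Bool, inferInstance, inferInstance, AutLearn.queryFamily,
    ⟨AutLearn.queryMachine, AutLearn.queryMachine_learns⟩,
    AutLearn.not_automaticallyLearnable_queryFamily⟩,
    fun _ _ _ _ F h => h.exists_stackLearner F⟩
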